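/- Let $M$ be a closed (compact, without boundary) smooth 3-manifold and let $f:M\to M$ be a $C^1$ diffeomorphism that is partially hyperbolic: $TM=E^s\oplus E^c\oplus E^u$, where $E^s,E^c,E^u$ are continuous $Df$-invariant line bundles, and for some smooth Riemannian metric on $M$, all $x\in M$ and all unit vectors $v^s\in E^s_x$, $v^c\in E^c_x$, $v^u\in E^u_x$, $$\|Df(x)v^s\|<1<\|Df(x)v^u\|,\qquad \|Df(x)v^s\|<\|Df(x)v^c\|<\|Df(x)v^u\|.$$ The accessibility class $AC(x)$ of a point $x$ is the set of all $y\in M$ for which there are a path $c:[0,1]\to M$ with $c(0)=x$, $c(1)=y$ and a subdivision $0=t_0<\dots<t_N=1$ such that each restriction $c|_{[t_i,t_{i+1}]}$ is either a $C^1$ curve tangent to $E^s$ or a $C^1$ curve tangent to $E^u$ (vanishing derivatives being allowed). A local center curve $W^c_{loc}(x)$ is an embedded open $C^1$ arc through $x$ that is tangent to $E^c$ at each of its points; it exists but need not be unique. For any point $x\in M$, the following statements are equivalent: 1. $AC(x)$ is open in $M$. 2. $AC(x)$ has non-empty interior in $M$. 3. For every choice of local center curve $W^c_{loc}(x)$,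 the set $AC(x)\cap W^c_{loc}(x)$ has non-empty interior in $W^c_{loc}(x)$. 4. For some choice of local center curve $W^c_{loc}(x)$, the set $AC(x)\cap W^c_{loc}(x)$ has non-empty interior in $W^c_{loc}(x)$. -/

import Mathlib

open Set Topology
open scoped Manifold ContDiff

/-- The model space of 3-manifolds. -/
abbrev E3 : Type := EuclideanSpace ℝ (Fin 3)

/-- A field of tangent subspaces `x ↦ E x ⊆ T_x M` on a 3-manifold. -/
abbrev TangentField (M : Type*) [TopologicalSpace M] [ChartedSpace E3 M] :=
  ∀ x : M, Submodule ℝ (TangentSpace (𝓡 3) x)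

section

variable {M : Type*} [TopologicalSpace M] [ChartedSpace E3 M] [IsManifold (𝓡 3) ∞ M]

/-- `E` is a continuous line subbundle of `TM`: near every point it is spanned by a
nowhere vanishing continuous vector field. -/
def IsContinuousLineBundle (E : TangentField M) : Prop :=
  ∀ x₀ : M, ∃ U ∈ 𝓝 x₀, ∃ V : (x : M) → TangentSpace (𝓡 3) x,
    ContinuousOn (fun x => (⟨x, V x⟩ : TangentBundle (𝓡 3) M)) U ∧
    ∀ x ∈ U, V x ≠ 0 ∧ E x = Submodule.span ℝ {V x}

/-- A smooth Riemannian metric on `M`. -/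
abbrev SmoothMetric (M : Type*) [TopologicalSpace M] [ChartedSpace E3 M]
    [IsManifold (𝓡 3) ∞ M] :=
  Bundle.ContMDiffRiemannianMetric (𝓡 3) ∞ E3 (fun x : M => TangentSpace (𝓡 3) x)

/-- The norm of a tangent vector for a Riemannian metric. -/
noncomputable def SmoothMetric.tnorm (g : SmoothMetric M) (x : M)
    (v : TangentSpace (𝓡 3) x) : ℝ :=
  Real.sqrt (g.inner x v v)

/-- The diffeomorphism `f` of the 3-manifold `M` is partially hyperbolic with invariant splitting
`TM = Es ⊕ Ec ⊕ Eu` into continuous line bundles. -/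
structure IsPartiallyHyperbolic (f : M ≃ₘ^1⟮𝓡 3, 𝓡 3⟯ M) (Es Ec Eu : TangentField M) : Prop where
  lineBundle_s : IsContinuousLineBundle Es
  lineBundle_c : IsContinuousLineBundle Ec
  lineBundle_u : IsContinuousLineBundle Eu
  splitting : ∀ x : M, DirectSum.IsInternal ![Es x, Ec x, Eu x]
  invariant_s : ∀ x : M, (Es x).map (mfderiv (𝓡 3) (𝓡 3) f x).toLinearMap = Es (f x)
  invariant_c : ∀ x : M, (Ec x).map (mfderiv (𝓡 3) (𝓡 3) f x).toLinearMap = Ec (f x)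
  invariant_u : ∀ x : M, (Eu x).map (mfderiv (𝓡 3) (𝓡 3) f x).toLinearMap = Eu (f x)
  hyperbolicity : ∃ g : SmoothMetric M, ∀ x : M, ∀ vs ∈ Es x, ∀ vc ∈ Ec x, ∀ vu ∈ Eu x,
    g.tnorm x vs = 1 → g.tnorm x vc = 1 → g.tnorm x vu = 1 →
    g.tnorm (f x) (mfderiv (𝓡 3) (𝓡 3) f x vs) < 1 ∧
    1 < g.tnorm (f x) (mfderiv (𝓡 3) (𝓡 3) f x vu) ∧
    g.tnorm (f x) (mfderiv (𝓡 3) (𝓡 3) f x vs) < g.tnorm (f x) (mfderiv (𝓡 3) (𝓡 3) f x vc) ∧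
    g.tnorm (f x) (mfderiv (𝓡 3) (𝓡 3) f x vc) < g.tnorm (f x) (mfderiv (𝓡 3) (𝓡 3) f x vu)

/-- `c` is a `C¹` curve on `[a, b]` (one-sided derivatives at the ends) tangent to `E`. -/
def IsTangentArc (E : TangentField M) (c : ℝ → M) (a b : ℝ) : Prop :=
  ContMDiffOn 𝓘(ℝ, ℝ) (𝓡 3) 1 c (Icc a b) ∧
  ∀ t ∈ Icc a b, mfderivWithin 𝓘(ℝ, ℝ) (𝓡 3) c (Icc a b) t (1 : ℝ) ∈ E (c t)

/-- `c : [0, 1] → M` is an su-path: there is a subdivision `0 = t 0 < ⋯ < t N = 1` such that each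
restriction of `c` to `[t i, t (i + 1)]` is a `C¹` curve tangent to `Es` or a `C¹` curve tangent
to `Eu`. Only the values of `c` on `[0, 1]` matter. -/
def IsSuPath (Es Eu : TangentField M) (c : ℝ → M) : Prop :=
  ∃ (N : ℕ) (t : ℕ → ℝ), t 0 = 0 ∧ t N = 1 ∧ ∀ i < N, t i < t (i + 1) ∧
    (IsTangentArc Es c (t i) (t (i + 1)) ∨ IsTangentArc Eu c (t i) (t (i + 1)))

/-- The accessibility class of `x`. -/
def accessibilityClass (Es Eu : TangentField M) (x : M) : Set M :=
  {y | ∃ c : ℝ → M, IsSuPath Es Eu c ∧ c 0 = x ∧ c 1 = y}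

/-- `W` is a local center curve through `x`: an embedded open `C¹` arc through `x` that is
tangent to `Ec` at each of its points. -/
def IsLocalCenterCurve (Ec : TangentField M) (x : M) (W : Set M) : Prop :=
  ∃ (ε : ℝ) (γ : ℝ → M), 0 < ε ∧ γ 0 = x ∧ W = γ '' Ioo (-ε) ε ∧
    ContMDiffOn 𝓘(ℝ, ℝ) (𝓡 3) 1 γ (Ioo (-ε) ε) ∧
    IsEmbedding ((Ioo (-ε) ε).domRestrict γ) ∧
    ∀ t ∈ Ioo (-ε) ε, mfderiv 𝓘(ℝ, ℝ) (𝓡 3) γ t (1 : ℝ) ≠ 0 ∧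
      mfderiv 𝓘(ℝ, ℝ) (𝓡 3) γ t (1 : ℝ) ∈ Ec (γ t)

/-- `A ∩ W` has non-empty interior in the subspace topology of `W`. -/
def HasInteriorIn (A W : Set M) : Prop :=
  (interior ((Subtype.val : W → M) ⁻¹' A)).Nonempty

end

/-! The only hard point is that `Es` and `Eu`, although merely continuous, are uniquely integrable.
Once this is known, each of them has a local flow that depends continuously on the starting point,
and the equivalences become topological.

Unique integrability is proved without constructing stable manifolds. Suppose two short curves
tangent to `Es` leave the same point and their endpoints differ mainly in the center and unstable
directions. By domination, `f` preserves this cone of pairs and expands the transverse gap by at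
least `ρ * L`, with `ρ > 1`, while it shortens the curves by at least the factor `L`. After `N`
iterates the gap is at most a constant times the length, so the initial gap is at most a constant
times `ρ ^ (-N)`, hence zero (`exists_endpoint_eq`). Two short curves from one point that reach the
same stable coordinate have their endpoints in this cone, so those endpoints coincide. The unstable
case is the same statement for the inverse of `f`.

Peano's theorem gives integral curves of a normalised section of the bundle. Uniqueness upgrades
them to a continuous local flow whose time is a linear coordinate and whose orbits contain all short
tangent curves (`exists_isLocalFlow`).

Interior points then propagate along tangent arcs (`mem_interior_of_joinedByArc`), so an
accessibility class with an interior point is open. If the class contains a piece of a center curve,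
flow that piece along `Es` and flow a nearby point `q` along `Eu`. In a chart the resulting surface
and curve cross almost linearly, and the Poincaré–Miranda theorem makes them meet. Hence every such
`q` belongs to the class (`mem_nhds_of_transverse_curve`). Peano's theorem also supplies the center
curves. -/

set_option linter.unusedSectionVars false

/-! ### Peano existence, and continuity of solutions where they are unique -/

section ODE

variable {E : Type*} [NormedAddCommGroup E] [NormedSpace ℝ E]

/-- A pointwise limit of approximate solutions of `y' = V y` satisfies the difference estimate
that characterises solutions. -/
theorem hasDerivWithinAt_of_difference_estimate {V : E → E} {y : ℝ → E} {S : Set ℝ}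
    (h : ∀ ε > 0, ∃ δ > 0, ∀ s ∈ S, ∀ t ∈ S, |t - s| ≤ δ →
      ‖y t - y s - (t - s) • V (y s)‖ ≤ ε * |t - s|) {s : ℝ} (hs : s ∈ S) :
    HasDerivWithinAt y (V (y s)) S s := by
  rw [hasDerivWithinAt_iff_isLittleO, Asymptotics.isLittleO_iff]
  intro ε hε
  obtain ⟨δ, hδ, H⟩ := h ε hε
  have h1 : ∀ᶠ t in 𝓝[S] s, |t - s| ≤ δ := by
    apply mem_nhdsWithin_of_mem_nhds
    filter_upwards [Metric.closedBall_mem_nhds s hδ] with t ht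
    simpa [Real.dist_eq] using ht
  filter_upwards [h1, self_mem_nhdsWithin] with t ht hS
  simpa [Real.norm_eq_abs] using H s hs t hS ht

theorem norm_sub_le_of_hasDerivAt_bounded {V : E → E} {L : ℝ} (hL : ∀ x, ‖V x‖ ≤ L) {y : ℝ → E}
    (hy : ∀ t, HasDerivAt y (V (y t)) t) (s t : ℝ) : ‖y t - y s‖ ≤ L * |t - s| := by
  have := Convex.norm_image_sub_le_of_norm_hasDerivWithin_le (s := univ) (f := y)
    (f' := fun t => V (y t)) (C := L) (x := s) (y := t)
    (fun t _ => (hy t).hasDerivWithinAt) (fun t _ => hL _) convex_univ (mem_univ _) (mem_univ _)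
  simpa using this

/-- The mean value inequality for `y` minus its tangent line. The admissible `δ` depends only on the
modulus of continuity of `V` and on `L`, not on `y`, so the estimate survives pointwise limits of
solutions. -/
theorem difference_estimate_of_hasDerivAt {V : E → E} {L : ℝ} (hL : ∀ x, ‖V x‖ ≤ L) {y : ℝ → E}
    (hy : ∀ t, HasDerivAt y (V (y t)) t) {ε δ : ℝ}
    (hδ : ∀ a b, ‖a - b‖ ≤ δ → ‖V a - V b‖ ≤ ε) {s t : ℝ} (hst : L * |t - s| ≤ δ) :
    ‖y t - y s - (t - s) • V (y s)‖ ≤ ε * |t - s| := by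
  have hL0 : 0 ≤ L := (norm_nonneg _).trans (hL 0)
  have := Convex.norm_image_sub_le_of_norm_hasDerivWithin_le (s := uIcc s t)
    (f := fun r => y r - (r - s) • V (y s))
    (f' := fun r => V (y r) - (1 : ℝ) • V (y s)) (C := ε) (x := s) (y := t)
    (fun r _ => ((hy r).sub (((hasDerivAt_id r).sub_const s).smul_const (V (y s)))).hasDerivWithinAt)
    (fun r hr => by
      rw [one_smul]
      apply hδ
      refine (norm_sub_le_of_hasDerivAt_bounded hL hy s r).trans (le_trans ?_ hst)
      exact mul_le_mul_of_nonneg_left (abs_sub_left_of_mem_uIcc hr) hL0)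
      (convex_uIcc s t) left_mem_uIcc right_mem_uIcc
  simpa [sub_right_comm] using this

/-- The explicit Euler scheme with step `h`. -/
noncomputable def eulerStep (V : E → E) (h : ℝ) (x : E) : ℕ → E
  | 0 => x
  | n + 1 => eulerStep V h x n + h • V (eulerStep V h x n)

/-- The displacement is a sum of vectors `h • V (x j)`, each close to `h • v`. Leaving `v` free
allows it to be the field at either end of the range, which covers backward differences too. -/
theorem eulerStep_estimate (V : E → E) {h : ℝ} (hh : 0 ≤ h) (x : E) {ε : ℝ} (v : E) {k m : ℕ}
    (hkm : k ≤ m)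
    (hv : ∀ j, k ≤ j → j < m → ‖V (eulerStep V h x j) - v‖ ≤ ε) :
    ‖eulerStep V h x m - eulerStep V h x k - (((m : ℝ) - k) * h) • v‖ ≤ ε * (((m : ℝ) - k) * h) := by
  induction m, hkm using Nat.le_induction with
  | base => simp
  | succ m hkm ih =>
    have h1 := ih (fun j hj hjm => hv j hj (hjm.trans (Nat.lt_succ_self _)))
    have h2 := hv m hkm (Nat.lt_succ_self _)
    have h3 : eulerStep V h x (m + 1) - eulerStep V h x k - ((((m + 1 : ℕ) : ℝ) - k) * h) • v
        = (eulerStep V h x m - eulerStep V h x k - (((m : ℝ) - k) * h) • v)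
          + h • (V (eulerStep V h x m) - v) := by
      simp only [eulerStep]
      push_cast
      module
    rw [h3]
    refine (norm_add_le _ _).trans ?_
    rw [norm_smul, Real.norm_of_nonneg hh]
    push_cast
    nlinarith

theorem norm_eulerStep_sub_le {V : E → E} {L : ℝ} (hL : ∀ x, ‖V x‖ ≤ L) {h : ℝ} (hh : 0 ≤ h)
    (x : E) (k m : ℕ) :
    ‖eulerStep V h x m - eulerStep V h x k‖ ≤ L * (|(m : ℝ) - k| * h) := by
  wlog hkm : k ≤ m generalizing k m
  · rw [norm_sub_rev, abs_sub_comm]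
    exact this m k (le_of_not_ge hkm)
  have := eulerStep_estimate V hh x (ε := L) 0 hkm (fun j _ _ => by simpa using hL _)
  rw [abs_of_nonneg (by simpa using hkm)]
  simpa using this

theorem abs_floor_sub_le {a : ℝ} (ha : 0 ≤ a) : |(⌊a⌋₊ : ℝ) - a| ≤ 1 := by
  rw [abs_le]
  constructor
  · linarith [Nat.lt_floor_add_one a]
  · linarith [Nat.floor_le ha]

/-- Forward half of Peano's existence theorem. -/
theorem exists_forward_solution [ProperSpace E] {V : E → E} (hV : UniformContinuous V) {L : ℝ}
    (hL : ∀ x, ‖V x‖ ≤ L) (x : E) :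
    ∃ y : ℝ → E, y 0 = x ∧ ∀ t ∈ Ici (0 : ℝ), HasDerivWithinAt y (V (y t)) (Ici 0) t := by
  have hL0 : 0 ≤ L := (norm_nonneg _).trans (hL 0)
  set h : ℕ → ℝ := fun n => 1 / ((n : ℝ) + 1) with hh
  have hpos : ∀ n, 0 < h n := fun n => by positivity
  have hone : ∀ n, h n ≤ 1 := fun n => by
    rw [hh]; simp only
    rw [div_le_one (by positivity)]
    linarith [Nat.cast_nonneg (α := ℝ) n]
  have hlim : Filter.Tendsto h Filter.atTop (𝓝 0) := tendsto_one_div_add_atTop_nhds_zero_nat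
  set u : ℕ → ℝ → E := fun n t => eulerStep V (h n) x ⌊t / h n⌋₊ with hu
  have hfl : ∀ n, ∀ t, 0 ≤ t → |(⌊t / h n⌋₊ : ℝ) * h n - t| ≤ h n := by
    intro n t ht
    have h1 := abs_floor_sub_le (div_nonneg ht (hpos n).le)
    have h2 : (⌊t / h n⌋₊ : ℝ) * h n - t = ((⌊t / h n⌋₊ : ℝ) - t / h n) * h n := by
      field_simp [(hpos n).ne']
    rw [h2, abs_mul, abs_of_pos (hpos n)]
    nlinarith [hpos n]
  have hdiff : ∀ n, ∀ s t, 0 ≤ s → 0 ≤ t →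
      |((⌊t / h n⌋₊ : ℝ) - ⌊s / h n⌋₊) * h n - (t - s)| ≤ 2 * h n := by
    intro n s t hs ht
    have h1 := abs_le.1 (hfl n t ht)
    have h2 := abs_le.1 (hfl n s hs)
    rw [abs_le]
    constructor <;> nlinarith [h1.1, h1.2, h2.1, h2.2]
  have hball : ∀ t, 0 ≤ t → ∀ n, u n t ∈ Metric.closedBall x (L * (t + 2)) := by
    intro t ht n
    rw [mem_closedBall_iff_norm]
    have h1 := norm_eulerStep_sub_le hL (hpos n).le x 0 ⌊t / h n⌋₊
    simp only [eulerStep, Nat.cast_zero, sub_zero, Nat.abs_cast] at h1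
    refine h1.trans ?_
    gcongr
    have := (abs_le.1 (hfl n t ht)).2
    linarith [hone n]
  -- The polygons stay in a compact ball at each time, so one ultrafilter gives limits at all times
  -- simultaneously. This replaces the Arzelà–Ascoli extraction.
  let l : Ultrafilter ℕ := Ultrafilter.of Filter.atTop
  have hl : (l : Filter ℕ) ≤ Filter.atTop := Ultrafilter.of_le _
  have hex : ∀ t, ∃ z, 0 ≤ t → Filter.Tendsto (fun n => u n t) l (𝓝 z) := by
    intro t
    by_cases ht : 0 ≤ t
    · obtain ⟨z, -, hz⟩ := (isCompact_closedBall x (L * (t + 2))).ultrafilter_le_nhds'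
        (l.map (fun n => u n t)) (by
          rw [Ultrafilter.mem_map]
          exact Filter.univ_mem' (hball t ht))
      exact ⟨z, fun _ => hz⟩
    · exact ⟨x, fun h => absurd h ht⟩
  choose y hy using hex
  refine ⟨y, ?_, fun t ht => hasDerivWithinAt_of_difference_estimate (S := Ici 0) ?_ ht⟩
  · refine tendsto_nhds_unique (hy 0 le_rfl) ?_
    have : (fun n => u n 0) = fun _ => x := by
      ext n; simp [hu, eulerStep]
    rw [this]
    exact tendsto_const_nhds
  · intro ε hε
    obtain ⟨δ, hδ, hVδ⟩ := Metric.uniformContinuous_iff_le.1 hV ε hε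
    simp only [dist_eq_norm] at hVδ
    -- Half of `δ` is kept for the rounding of times to multiples of `h n`. Using `L + 1` avoids
    -- dividing by zero.
    refine ⟨δ / (2 * (L + 1)), by positivity, fun s hs t ht hst => ?_⟩
    have hs0 : 0 ≤ s := hs
    have ht0 : 0 ≤ t := ht
    have hsmall : ∀ᶠ n in (l : Filter ℕ), L * (2 * h n) ≤ δ / 2 := by
      have : Filter.Tendsto (fun n => L * (2 * h n)) (l : Filter ℕ) (𝓝 (L * (2 * 0))) :=
        ((hlim.const_mul 2).const_mul L).mono_left hl
      refine this.eventually_le_const ?_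
      simpa using hδ
    have hbd : L * |t - s| ≤ δ / 2 := by
      have h1 : L * |t - s| ≤ (L + 1) * (δ / (2 * (L + 1))) := by
        gcongr; linarith
      refine h1.trans (le_of_eq ?_)
      field_simp
    -- The required estimate holds for the polygons up to `2 * h n`, the total rounding error of the
    -- two times; this error disappears in the limit.
    have key : ∀ᶠ n in (l : Filter ℕ), ‖u n t - u n s - (t - s) • V (u n s)‖
        ≤ ε * (|t - s| + 2 * h n) + (2 * h n) * L := by
      filter_upwards [hsmall] with n hn
      set k := ⌊s / h n⌋₊ with hk
      set m := ⌊t / h n⌋₊ with hm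
      have hd := hdiff n s t hs0 ht0
      have habs : |(m : ℝ) - k| * h n ≤ |t - s| + 2 * h n := by
        rw [← abs_of_pos (hpos n), ← abs_mul, abs_of_pos (hpos n)]
        have := abs_sub_abs_le_abs_sub (((m : ℝ) - k) * h n) (t - s)
        linarith
      have hL2 : L * (|(m : ℝ) - k| * h n) ≤ δ := by
        calc L * (|(m : ℝ) - k| * h n) ≤ L * (|t - s| + 2 * h n) := by gcongr
          _ = L * |t - s| + L * (2 * h n) := by ring
          _ ≤ δ := by linarith
      have hmain : ‖u n t - u n s - (((m : ℝ) - k) * h n) • V (u n s)‖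
          ≤ ε * (|(m : ℝ) - k| * h n) := by
        rcases le_total k m with hkm | hkm
        · rw [abs_of_nonneg (by simpa using hkm)] at hL2 ⊢
          refine eulerStep_estimate V (hpos n).le x _ hkm (fun j hj hjm => hVδ ?_)
          refine (norm_eulerStep_sub_le hL (hpos n).le x k j).trans (le_trans ?_ hL2)
          rw [abs_of_nonneg (by simpa using hj)]
          have := hpos n
          gcongr
        · rw [abs_sub_comm, abs_of_nonneg (by simpa using hkm)] at hL2 ⊢
          have := eulerStep_estimate V (hpos n).le x (ε := ε) (V (u n s)) hkm
            (fun j hj hjm => hVδ (by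
              refine (norm_eulerStep_sub_le hL (hpos n).le x k j).trans (le_trans ?_ hL2)
              rw [abs_sub_comm, abs_of_nonneg (by simpa using hjm.le)]
              have := hpos n
              gcongr))
          have e : -(u n t - u n s - (((m : ℝ) - k) * h n) • V (u n s))
              = u n s - u n t - (((k : ℝ) - m) * h n) • V (u n s) := by module
          rw [← norm_neg, e]
          exact this
      have h3 : u n t - u n s - (t - s) • V (u n s)
          = (u n t - u n s - (((m : ℝ) - k) * h n) • V (u n s))
            + ((((m : ℝ) - k) * h n) - (t - s)) • V (u n s) := by module
      rw [h3]
      refine (norm_add_le _ _).trans ?_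
      rw [norm_smul, Real.norm_eq_abs]
      have := hpos n
      gcongr
      · exact hmain.trans (by gcongr)
      · exact hL _
    have hlimL : Filter.Tendsto (fun n => ‖u n t - u n s - (t - s) • V (u n s)‖) l
        (𝓝 ‖y t - y s - (t - s) • V (y s)‖) :=
      (((hy t ht0).sub (hy s hs0)).sub
        (((hV.continuous.tendsto _).comp (hy s hs0)).const_smul _)).norm
    have hlimR : Filter.Tendsto (fun n => ε * (|t - s| + 2 * h n) + (2 * h n) * L) l
        (𝓝 (ε * (|t - s| + 2 * 0) + (2 * 0) * L)) := by
      have h0 : Filter.Tendsto h l (𝓝 0) := hlim.mono_left hl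
      exact (((h0.const_mul 2).const_add _).const_mul ε).add ((h0.const_mul 2).mul_const L)
    have := le_of_tendsto_of_tendsto hlimL hlimR key
    simpa using this

/-- Peano's existence theorem for bounded uniformly continuous vector fields. -/
theorem exists_solution [ProperSpace E] {V : E → E} (hV : UniformContinuous V) {L : ℝ}
    (hL : ∀ x, ‖V x‖ ≤ L) (x : E) :
    ∃ y : ℝ → E, y 0 = x ∧ ∀ t, HasDerivAt y (V (y t)) t := by
  obtain ⟨y₁, h10, h1⟩ := exists_forward_solution hV hL x
  -- Past times come from a forward solution of the reversed field, glued at time `0`.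
  obtain ⟨y₂, h20, h2⟩ := exists_forward_solution (V := fun x => - V x) hV.neg
    (fun x => by simpa using hL x) x
  have h2' : ∀ t ∈ Iic (0 : ℝ),
      HasDerivWithinAt (fun t => y₂ (-t)) (V (y₂ (-t))) (Iic 0) t := by
    intro t ht
    have := (h2 (-t) (by simpa using ht)).scomp t (h' := (-1 : ℝ)) (s := Iic 0)
      ((hasDerivAt_neg t).hasDerivWithinAt) (fun r hr => by simpa using hr)
    simpa using! this
  refine ⟨fun t => if 0 ≤ t then y₁ t else y₂ (-t), by simp [h10], fun t => ?_⟩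
  have e1 : ∀ r ∈ Ici (0 : ℝ), (if 0 ≤ r then y₁ r else y₂ (-r)) = y₁ r := fun r hr =>
    if_pos hr
  have e2 : ∀ r ∈ Iic (0 : ℝ), (if 0 ≤ r then y₁ r else y₂ (-r)) = y₂ (-r) := fun r hr => by
    rcases eq_or_lt_of_le (show r ≤ 0 from hr) with h | h
    · simp [h, h10, h20]
    · exact if_neg (not_le.2 h)
  rcases lt_trichotomy t 0 with ht | ht | ht
  · have := (h2' t ht.le).congr (f₁ := fun t => if 0 ≤ t then y₁ t else y₂ (-t))
      (fun r hr => e2 r hr) (e2 t ht.le)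
    simp only [e2 t ht.le]
    exact this.hasDerivAt (Iic_mem_nhds ht)
  · subst ht
    have a1 := (h1 0 self_mem_Ici).congr (f₁ := fun t => if 0 ≤ t then y₁ t else y₂ (-t))
      (fun r hr => e1 r hr) (e1 0 self_mem_Ici)
    have a2 := (h2' 0 self_mem_Iic).congr (f₁ := fun t => if 0 ≤ t then y₁ t else y₂ (-t))
      (fun r hr => e2 r hr) (e2 0 self_mem_Iic)
    simp only [e1 0 self_mem_Ici]
    simp only [neg_zero, h20] at a2
    rw [h10] at a1 ⊢
    have := a2.union a1
    rw [Iic_union_Ici, hasDerivWithinAt_univ] at this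
    exact this
  · have := (h1 t ht.le).congr (f₁ := fun t => if 0 ≤ t then y₁ t else y₂ (-t))
      (fun r hr => e1 r hr) (e1 t ht.le)
    simp only [e1 t ht.le]
    exact this.hasDerivAt (Ici_mem_nhds ht)

/-- Solutions depend continuously on the initial point wherever they are unique. -/
theorem tendsto_solution_of_unique [ProperSpace E] {V : E → E} (hV : UniformContinuous V) {L : ℝ}
    (hL : ∀ x, ‖V x‖ ≤ L) {Y : E → ℝ → E} (hY0 : ∀ x, Y x 0 = x)
    (hY : ∀ x t, HasDerivAt (Y x) (V (Y x t)) t) {x₀ : E} {t₀ : ℝ}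
    (huniq : ∀ y : ℝ → E, y 0 = x₀ → (∀ t, HasDerivAt y (V (y t)) t) → y t₀ = Y x₀ t₀) :
    ContinuousAt (fun z : E × ℝ => Y z.1 z.2) (x₀, t₀) := by
  have hL0 : 0 ≤ L := (norm_nonneg _).trans (hL 0)
  -- Along any ultrafilter tending to `x₀` the solutions converge at every time by compactness, and
  -- the limit is a solution from `x₀`. Uniqueness identifies its value at `t₀`.
  have hpt : Filter.Tendsto (fun x => Y x t₀) (𝓝 x₀) (𝓝 (Y x₀ t₀)) := by
    rw [Filter.tendsto_iff_ultrafilter]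
    intro l hl
    have hb : ∀ t, ∃ z, Filter.Tendsto (fun x => Y x t) l (𝓝 z) := by
      intro t
      obtain ⟨z, -, hz⟩ := (isCompact_closedBall x₀ (1 + L * |t|)).ultrafilter_le_nhds'
        (l.map (fun x => Y x t)) (by
          rw [Ultrafilter.mem_map]
          filter_upwards [hl (Metric.closedBall_mem_nhds x₀ one_pos)] with x hx
          rw [mem_preimage, mem_closedBall_iff_norm]
          rw [mem_closedBall_iff_norm] at hx
          have := norm_sub_le_of_hasDerivAt_bounded hL (hY x) 0 t
          rw [hY0, sub_zero] at this
          calc ‖Y x t - x₀‖ = ‖(x - x₀) + (Y x t - x)‖ := by congr 1; abel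
            _ ≤ _ := norm_add_le_of_le hx this)
      exact ⟨z, hz⟩
    choose y hy using hb
    have h0 : y 0 = x₀ := by
      refine tendsto_nhds_unique (hy 0) ?_
      simp only [hY0]
      exact hl
    rw [← huniq y h0 (fun t => ?_)]
    · exact hy t₀
    · rw [← hasDerivWithinAt_univ]
      refine hasDerivWithinAt_of_difference_estimate (fun ε hε => ?_) (mem_univ t)
      obtain ⟨δ, hδ, hVδ⟩ := Metric.uniformContinuous_iff_le.1 hV ε hε
      simp only [dist_eq_norm] at hVδ
      refine ⟨δ / (L + 1), by positivity, fun s _ t _ hst => ?_⟩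
      have hbd : L * |t - s| ≤ δ := by
        calc L * |t - s| ≤ (L + 1) * (δ / (L + 1)) := by gcongr; linarith
          _ = δ := by field_simp
      have hlimL : Filter.Tendsto (fun x => ‖Y x t - Y x s - (t - s) • V (Y x s)‖) l
          (𝓝 ‖y t - y s - (t - s) • V (y s)‖) :=
        (((hy t).sub (hy s)).sub (((hV.continuous.tendsto _).comp (hy s)).const_smul _)).norm
      exact le_of_tendsto hlimL (Filter.Eventually.of_forall fun x =>
        difference_estimate_of_hasDerivAt hL (hY x) (fun a b hab => hVδ hab) hbd)
  -- All solutions are `L`-Lipschitz in time, so continuity in the starting point at the fixed time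
  -- `t₀` gives joint continuity.
  rw [ContinuousAt, tendsto_iff_norm_sub_tendsto_zero]
  have h1 : Filter.Tendsto (fun z : E × ℝ => ‖Y z.1 t₀ - Y x₀ t₀‖ + L * |z.2 - t₀|) (𝓝 (x₀, t₀))
      (𝓝 (0 + L * |t₀ - t₀|)) := by
    refine Filter.Tendsto.add ?_ ?_
    · have := (tendsto_iff_norm_sub_tendsto_zero.1 hpt).comp (continuous_fst.tendsto (x₀, t₀))
      exact this
    · exact (continuous_const.mul (continuous_snd.sub continuous_const).abs).tendsto (x₀, t₀)
  simp only [sub_self, abs_zero, mul_zero, add_zero] at h1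
  refine squeeze_zero (fun _ => norm_nonneg _) (fun z => ?_) h1
  have := norm_sub_le_of_hasDerivAt_bounded hL (hY z.1) t₀ z.2
  calc ‖Y z.1 z.2 - Y x₀ t₀‖ = ‖(Y z.1 t₀ - Y x₀ t₀) + (Y z.1 z.2 - Y z.1 t₀)‖ := by
        congr 1; abel
    _ ≤ _ := norm_add_le_of_le le_rfl this

end ODE

/-! ### The Poincaré–Miranda theorem in the plane -/

section Miranda

/-- If `θ` varied by `π` or more, it would take two values differing by exactly `π`, at which the
cosines have opposite signs. -/
theorem abs_sub_lt_pi_of_cos_pos {S : Set (ℝ × ℝ)} (hS : IsPreconnected S) {θ : ℝ × ℝ → ℝ}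
    (hθ : Continuous θ) {c : ℝ} (h : ∀ z ∈ S, 0 < Real.cos (θ z - c)) {z w : ℝ × ℝ} (hz : z ∈ S)
    (hw : w ∈ S) : |θ z - θ w| < Real.pi := by
  wlog hzw : θ w ≤ θ z generalizing z w
  · rw [abs_sub_comm]
    exact this hw hz (le_of_not_ge hzw)
  rw [abs_of_nonneg (sub_nonneg.2 hzw)]
  by_contra! hcon
  obtain ⟨x, hx, hxe⟩ := hS.intermediate_value hw hz hθ.continuousOn
    (show θ w + Real.pi ∈ Icc (θ w) (θ z) from ⟨by linarith [Real.pi_pos], by linarith⟩)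
  have h1 := h x hx
  have h2 := h w hw
  rw [hxe, add_sub_right_comm, Real.cos_add_pi] at h1
  linarith

theorem pos_of_sin_pos_of_abs_lt_pi {x : ℝ} (h : 0 < Real.sin x) (hx : |x| < Real.pi) : 0 < x := by
  by_contra! hcon
  linarith [Real.sin_nonpos_of_nonpos_of_neg_pi_le hcon (abs_lt.1 hx).1.le]

/-- The Poincaré–Miranda theorem in dimension two. -/
theorem exists_zero_of_sign_changes {a b c d : ℝ} (hab : a ≤ b) (hcd : c ≤ d)
    {F G : ℝ × ℝ → ℝ} (hF : ContinuousOn F (Icc a b ×ˢ Icc c d))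
    (hG : ContinuousOn G (Icc a b ×ˢ Icc c d))
    (hFa : ∀ y ∈ Icc c d, F (a, y) < 0) (hFb : ∀ y ∈ Icc c d, 0 < F (b, y))
    (hGc : ∀ x ∈ Icc a b, G (x, c) < 0) (hGd : ∀ x ∈ Icc a b, 0 < G (x, d)) :
    ∃ z ∈ Icc a b ×ˢ Icc c d, F z = 0 ∧ G z = 0 := by
  by_contra! hcon
  -- Clamping to the rectangle extends `F` and `G` to the whole plane without creating zeros.
  set P : ℝ × ℝ → ℝ × ℝ := fun z => (projIcc a b hab z.1, projIcc c d hcd z.2) with hP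
  have hPc : Continuous P := by
    have h1 : Continuous fun x => (projIcc a b hab x : ℝ) :=
      continuous_subtype_val.comp continuous_projIcc
    have h2 : Continuous fun x => (projIcc c d hcd x : ℝ) :=
      continuous_subtype_val.comp continuous_projIcc
    exact (h1.comp continuous_fst).prodMk (h2.comp continuous_snd)
  have hPm : ∀ z, P z ∈ Icc a b ×ˢ Icc c d := fun z => ⟨Subtype.prop _, Subtype.prop _⟩
  have hPid : ∀ z ∈ Icc a b ×ˢ Icc c d, P z = z := fun z hz => by
    simp [hP, projIcc_of_mem hab hz.1, projIcc_of_mem hcd hz.2]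
  have hFc : Continuous (F ∘ P) := hF.comp_continuous hPc hPm
  have hGc' : Continuous (G ∘ P) := hG.comp_continuous hPc hPm
  have hsc : IsSimplyConnected (univ : Set (ℝ × ℝ)) := by
    have := (convex_univ (𝕜 := ℝ) (E := ℝ × ℝ)).contractibleSpace univ_nonempty
    exact inferInstanceAs (SimplyConnectedSpace (univ : Set (ℝ × ℝ)))
  -- Without a common zero, `F + i G` has a continuous logarithm on the simply connected plane; its
  -- imaginary part is a continuous angle.
  obtain ⟨f, hf, hexp⟩ := Complex.exists_continuousOn_eqOn_exp_comp (X := ℝ × ℝ) hsc isOpen_univ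
    (g := fun z => ((F (P z) : ℂ) + (G (P z) : ℂ) * Complex.I)) (by
      refine Continuous.continuousOn ?_
      exact (Complex.continuous_ofReal.comp hFc).add
        ((Complex.continuous_ofReal.comp hGc').mul continuous_const)) (by
      rintro ⟨z, -, hz⟩
      have h1 := congrArg Complex.re hz
      have h2 := congrArg Complex.im hz
      simp at h1 h2
      exact hcon (P z) (hPm z) h1 h2)
  rw [continuousOn_univ] at hf
  set θ : ℝ × ℝ → ℝ := fun z => (f z).im with hθ
  have hθc : Continuous θ := Complex.continuous_im.comp hf
  have hre : ∀ z ∈ Icc a b ×ˢ Icc c d, F z = Real.exp (f z).re * Real.cos (θ z) := by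
    intro z hz
    have := congrArg Complex.re (hexp (mem_univ z))
    simpa [Complex.exp_re, hPid z hz] using this.symm
  have him : ∀ z ∈ Icc a b ×ˢ Icc c d, G z = Real.exp (f z).re * Real.sin (θ z) := by
    intro z hz
    have := congrArg Complex.im (hexp (mem_univ z))
    simpa [Complex.exp_im, hPid z hz] using this.symm
  have hcos : ∀ z ∈ Icc a b ×ˢ Icc c d, (0 < F z → 0 < Real.cos (θ z)) ∧
      (F z < 0 → Real.cos (θ z) < 0) ∧ (0 < G z → 0 < Real.sin (θ z)) ∧
      (G z < 0 → Real.sin (θ z) < 0) := by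
    intro z hz
    have hp := Real.exp_pos (f z).re
    rw [hre z hz, him z hz]
    refine ⟨fun h => (mul_pos_iff_of_pos_left hp).1 h, fun h => ?_,
      fun h => (mul_pos_iff_of_pos_left hp).1 h, fun h => ?_⟩ <;> nlinarith
  have la : a ∈ Icc a b := left_mem_Icc.2 hab
  have lb : b ∈ Icc a b := right_mem_Icc.2 hab
  have lc : c ∈ Icc c d := left_mem_Icc.2 hcd
  have ld : d ∈ Icc c d := right_mem_Icc.2 hcd
  have sb := abs_sub_lt_pi_of_cos_pos (S := {b} ×ˢ Icc c d)
    (isPreconnected_singleton.prod isPreconnected_Icc) hθc (c := 0) (by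
      rintro ⟨x, y⟩ ⟨rfl, hy⟩
      simpa using (hcos (x, y) ⟨lb, hy⟩).1 (hFb y hy)) (z := (b, d)) (w := (b, c))
    ⟨rfl, ld⟩ ⟨rfl, lc⟩
  have sa := abs_sub_lt_pi_of_cos_pos (S := {a} ×ˢ Icc c d)
    (isPreconnected_singleton.prod isPreconnected_Icc) hθc (c := Real.pi) (by
      rintro ⟨x, y⟩ ⟨rfl, hy⟩
      simpa using (hcos (x, y) ⟨la, hy⟩).2.1 (hFa y hy)) (z := (a, c)) (w := (a, d))
    ⟨rfl, lc⟩ ⟨rfl, ld⟩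
  have sd := abs_sub_lt_pi_of_cos_pos (S := Icc a b ×ˢ {d})
    (isPreconnected_Icc.prod isPreconnected_singleton) hθc (c := Real.pi / 2) (by
      rintro ⟨x, y⟩ ⟨hx, rfl⟩
      simpa [Real.cos_sub_pi_div_two] using (hcos (x, y) ⟨hx, ld⟩).2.2.1 (hGd x hx))
      (z := (a, d)) (w := (b, d))
    ⟨la, rfl⟩ ⟨lb, rfl⟩
  have sc := abs_sub_lt_pi_of_cos_pos (S := Icc a b ×ˢ {c})
    (isPreconnected_Icc.prod isPreconnected_singleton) hθc (c := -(Real.pi / 2)) (by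
      rintro ⟨x, y⟩ ⟨hx, rfl⟩
      simpa [Real.cos_add_pi_div_two] using (hcos (x, y) ⟨hx, lc⟩).2.2.2 (hGc x hx))
    (z := (b, c)) (w := (a, c)) ⟨lb, rfl⟩ ⟨la, rfl⟩
  have bd := hcos (b, d) ⟨lb, ld⟩
  have bc := hcos (b, c) ⟨lb, lc⟩
  have ad := hcos (a, d) ⟨la, ld⟩
  have ac := hcos (a, c) ⟨la, lc⟩
  have bd1 := bd.1 (hFb d ld)
  have bd2 := bd.2.2.1 (hGd b lb)
  have bc1 := bc.1 (hFb c lc)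
  have bc2 := bc.2.2.2 (hGc b lb)
  have ad1 := ad.2.1 (hFa d ld)
  have ad2 := ad.2.2.1 (hGd a la)
  have ac1 := ac.2.1 (hFa c lc)
  have ac2 := ac.2.2.2 (hGc a la)
  -- The corner values lie in four different quadrants, so the angle increases along each side when
  -- the boundary is traversed counterclockwise. The four increments nevertheless sum to zero around
  -- the closed loop.
  have p1 := pos_of_sin_pos_of_abs_lt_pi (by rw [Real.sin_sub]; nlinarith) sb
  have p2 := pos_of_sin_pos_of_abs_lt_pi (by rw [Real.sin_sub]; nlinarith) sd
  have p3 := pos_of_sin_pos_of_abs_lt_pi (by rw [Real.sin_sub]; nlinarith) sa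
  have p4 := pos_of_sin_pos_of_abs_lt_pi (by rw [Real.sin_sub]; nlinarith) sc
  linarith

end Miranda

/-! ### Metrics, derivatives in charts and sections of line bundles -/

section Interface

variable {M : Type*} [TopologicalSpace M] [ChartedSpace E3 M] [IsManifold (𝓡 3) ∞ M]
  {F : Type*} [NormedAddCommGroup F] [NormedSpace ℝ F]

open scoped Bundle in
theorem SmoothMetric.continuous_inner_self (g : SmoothMetric M) :
    Continuous (fun z : TangentBundle (𝓡 3) M => g.inner z.1 z.2 z.2) := by
  let _ : Bundle.RiemannianBundle (fun x : M => TangentSpace (𝓡 3) x) := ⟨g.toRiemannianMetric⟩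
  have : IsContinuousRiemannianBundle E3 (fun x : M => TangentSpace (𝓡 3) x) :=
    ⟨g.inner, g.contMDiff.continuous, fun _ _ _ => rfl⟩
  exact Continuous.inner_bundle (F := E3) (E := fun x : M => TangentSpace (𝓡 3) x)
    (b := fun z : TangentBundle (𝓡 3) M => z.1) (v := fun z => z.2) (w := fun z => z.2)
    continuous_id continuous_id

theorem SmoothMetric.continuous_tnorm (g : SmoothMetric M) :
    Continuous (fun z : TangentBundle (𝓡 3) M => g.tnorm z.1 z.2) :=
  Real.continuous_sqrt.comp g.continuous_inner_self

theorem SmoothMetric.tnorm_nonneg (g : SmoothMetric M) (x : M) (v : TangentSpace (𝓡 3) x) :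
    0 ≤ g.tnorm x v := Real.sqrt_nonneg _

theorem SmoothMetric.tnorm_pos (g : SmoothMetric M) (x : M) {v : TangentSpace (𝓡 3) x}
    (hv : v ≠ 0) : 0 < g.tnorm x v := Real.sqrt_pos.2 (g.pos x v hv)

theorem SmoothMetric.tnorm_smul (g : SmoothMetric M) (x : M) (a : ℝ) (v : TangentSpace (𝓡 3) x) :
    g.tnorm x (a • v) = |a| * g.tnorm x v := by
  unfold SmoothMetric.tnorm
  simp only [map_smul, _root_.smul_apply, smul_eq_mul]
  rw [← mul_assoc, Real.sqrt_mul (mul_self_nonneg a), Real.sqrt_mul_self_eq_abs]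

/-- The derivative of a vector-valued function on `M`, as a map from the model space. -/
noncomputable def chartDeriv (h : M → F) (q : M) : E3 →L[ℝ] F := mfderiv (𝓡 3) 𝓘(ℝ, F) h q

/-- A `C¹` map on a manifold is strictly differentiable in the chart at the base point. -/
theorem ContMDiffAt.isLittleO_sub {h : M → F} {r : M}
    (hh : ContMDiffAt (𝓡 3) 𝓘(ℝ, F) 1 h r) :
    (fun z : M × M => h z.2 - h z.1 - chartDeriv h r
      (extChartAt (𝓡 3) r z.2 - extChartAt (𝓡 3) r z.1)) =o[𝓝 (r, r)]
    fun z : M × M => extChartAt (𝓡 3) r z.2 - extChartAt (𝓡 3) r z.1 := by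
  set φ := extChartAt (𝓡 3) r with hφ
  have h1 : ContDiffAt ℝ 1 (h ∘ φ.symm) (φ r) := by
    have := (contMDiffAt_iff.1 hh).2
    simpa [contDiffWithinAt_univ] using! this
  have h2 := h1.hasStrictFDerivAt one_ne_zero
  have h3 : chartDeriv h r = fderiv ℝ (h ∘ φ.symm) (φ r) := by
    have := (hh.mdifferentiableAt one_ne_zero).hasMFDerivAt.2
    have h6 : HasFDerivWithinAt (h ∘ φ.symm) (chartDeriv h r) (range (𝓡 3)) (φ r) := this
    simp only [mfld_simps, hasFDerivWithinAt_univ] at h6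
    exact h6.fderiv.symm
  rw [h3]
  have h4 : Filter.Tendsto (fun z : M × M => (φ z.2, φ z.1)) (𝓝 (r, r)) (𝓝 (φ r, φ r)) := by
    have hc := continuousAt_extChartAt (I := 𝓡 3) r
    exact (hc.comp_of_eq (f := Prod.snd) (x := (r, r)) continuousAt_snd rfl).prodMk_nhds
      (hc.comp_of_eq (f := Prod.fst) (x := (r, r)) continuousAt_fst rfl)
  have h5 := h2.isLittleO.comp_tendsto h4
  refine h5.congr' ?_ Filter.EventuallyEq.rfl
  have hs := extChartAt_source_mem_nhds (I := 𝓡 3) r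
  have : ∀ᶠ z : M × M in 𝓝 (r, r), z.1 ∈ φ.source ∧ z.2 ∈ φ.source := by
    rw [nhds_prod_eq]
    exact (Filter.eventually_of_mem hs fun _ h => h).prod_mk
      (Filter.eventually_of_mem hs fun _ h => h)
  filter_upwards [this] with z hz
  simp [φ.left_inv hz.1, φ.left_inv hz.2]

/-- The derivative of a `C¹` function along a continuous vector field is continuous. -/
theorem ContMDiffOn.continuousAt_mfderiv_apply {h : M → F} {U : Set M} (hU : IsOpen U)
    (hh : ContMDiffOn (𝓡 3) 𝓘(ℝ, F) 1 h U) {V : (x : M) → TangentSpace (𝓡 3) x} {q : M}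
    (hq : q ∈ U) (hV : ContinuousAt (fun x => (⟨x, V x⟩ : TangentBundle (𝓡 3) M)) q) :
    ContinuousAt (fun x => chartDeriv h x (V x)) q := by
  have h1 := hh.continuousOn_tangentMapWithin le_rfl hU.uniqueMDiffOn
  have h2 : ContinuousAt (tangentMapWithin (𝓡 3) 𝓘(ℝ, F) h U) ⟨q, V q⟩ := by
    refine h1.continuousAt ?_
    exact (hU.preimage (FiberBundle.continuous_proj E3 _)).mem_nhds hq
  have h3 : ContinuousAt (fun x => (tangentMapWithin (𝓡 3) 𝓘(ℝ, F) h U ⟨x, V x⟩)) q :=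
    ContinuousAt.comp (g := tangentMapWithin (𝓡 3) 𝓘(ℝ, F) h U)
      (f := fun x => (⟨x, V x⟩ : TangentBundle (𝓡 3) M)) h2 hV
  have h4 : Continuous (fun z : TangentBundle 𝓘(ℝ, F) F => (z.2 : F)) :=
    (contMDiff_snd_tangentBundle_modelSpace F 𝓘(ℝ, F) (n := 0)).continuous
  refine (h4.continuousAt.comp h3).congr ?_
  filter_upwards [hU.mem_nhds hq] with x hx
  simp only [Function.comp, tangentMapWithin, mfderivWithin_of_isOpen hU hx]
  rfl

theorem IsContinuousLineBundle.exists_local_section {E : TangentField M}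
    (hE : IsContinuousLineBundle E) (x₀ : M) :
    ∃ V : (x : M) → TangentSpace (𝓡 3) x, ∀ᶠ x in 𝓝 x₀,
      ContinuousAt (fun x => (⟨x, V x⟩ : TangentBundle (𝓡 3) M)) x ∧
      V x ≠ 0 ∧ E x = Submodule.span ℝ {V x} := by
  obtain ⟨U, hU, V, hV, hVE⟩ := hE x₀
  refine ⟨V, ?_⟩
  filter_upwards [eventually_mem_nhds_iff.2 hU] with x hx
  exact ⟨hV.continuousAt hx, hVE x (mem_of_mem_nhds hx)⟩

end Interface

/-! ### Dual functionals of three independent vectors in Euclidean space -/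

section PseudoInverse

variable {n : ℕ}

/-- The linear map with columns `v i`. -/
noncomputable def columnMap (v : Fin 3 → EuclideanSpace ℝ (Fin n)) :
    E3 →L[ℝ] EuclideanSpace ℝ (Fin n) :=
  ∑ i, (EuclideanSpace.proj (𝕜 := ℝ) i).smulRight (v i)

theorem columnMap_apply (v : Fin 3 → EuclideanSpace ℝ (Fin n)) (a : E3) :
    columnMap v a = ∑ i, a i • v i := by
  simp [columnMap]

theorem continuous_columnMap :
    Continuous (columnMap : (Fin 3 → EuclideanSpace ℝ (Fin n)) → _) := by
  unfold columnMap
  refine continuous_finsetSum _ fun i _ => ?_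
  exact ((ContinuousLinearMap.smulRightL ℝ E3 (EuclideanSpace ℝ (Fin n))
    (EuclideanSpace.proj (𝕜 := ℝ) i)).continuous).comp (continuous_apply i)

theorem columnMap_injective {v : Fin 3 → EuclideanSpace ℝ (Fin n)} (hv : LinearIndependent ℝ v) :
    Function.Injective (columnMap v) := by
  rw [injective_iff_map_eq_zero]
  intro a ha
  rw [columnMap_apply] at ha
  ext i
  exact Fintype.linearIndependent_iff.1 hv _ ha i

/-- The Moore–Penrose left inverse of an injective linear map. -/
noncomputable def leftPseudoInverse (A : E3 →L[ℝ] EuclideanSpace ℝ (Fin n)) :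
    EuclideanSpace ℝ (Fin n) →L[ℝ] E3 :=
  (Ring.inverse (A.adjoint ∘L A)) ∘L A.adjoint

theorem isUnit_adjoint_comp_self {A : E3 →L[ℝ] EuclideanSpace ℝ (Fin n)}
    (hA : Function.Injective A) : IsUnit (A.adjoint ∘L A) := by
  rw [ContinuousLinearMap.isUnit_iff_bijective]
  have hinj : Function.Injective (A.adjoint ∘L A) := by
    rw [injective_iff_map_eq_zero]
    intro a ha
    apply (injective_iff_map_eq_zero A).1 hA
    have h1 : inner ℝ ((A.adjoint ∘L A) a) a = 0 := by rw [ha, inner_zero_left]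
    rw [ContinuousLinearMap.comp_apply, ContinuousLinearMap.adjoint_inner_left] at h1
    exact inner_self_eq_zero.1 h1
  exact ⟨hinj, (LinearMap.injective_iff_surjective (f := (A.adjoint ∘L A).toLinearMap)).1 hinj⟩

theorem leftPseudoInverse_apply {A : E3 →L[ℝ] EuclideanSpace ℝ (Fin n)}
    (hA : Function.Injective A) (a : E3) : leftPseudoInverse A (A a) = a := by
  have h := Ring.inverse_mul_cancel _ (isUnit_adjoint_comp_self hA)
  exact congrArg (fun T : E3 →L[ℝ] E3 => T a) h

theorem continuousAt_leftPseudoInverse {A : E3 →L[ℝ] EuclideanSpace ℝ (Fin n)}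
    (hA : Function.Injective A) : ContinuousAt leftPseudoInverse A := by
  have h1 : Continuous fun A : E3 →L[ℝ] EuclideanSpace ℝ (Fin n) => A.adjoint :=
    ContinuousLinearMap.adjoint.continuous
  have h2 : Continuous fun A : E3 →L[ℝ] EuclideanSpace ℝ (Fin n) => A.adjoint ∘L A :=
    h1.clm_comp continuous_id
  obtain ⟨u, hu⟩ := isUnit_adjoint_comp_self hA
  have h3 : ContinuousAt (fun A : E3 →L[ℝ] EuclideanSpace ℝ (Fin n) =>
      Ring.inverse (A.adjoint ∘L A)) A := by
    refine ContinuousAt.comp (g := Ring.inverse) ?_ h2.continuousAt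
    rw [← hu]
    exact NormedRing.inverse_continuousAt u
  exact h3.clm_comp h1.continuousAt

/-- The `i`-th functional dual to `v`, vanishing on the orthogonal complement of its span. -/
noncomputable def dualFunctional (v : Fin 3 → EuclideanSpace ℝ (Fin n)) (i : Fin 3) :
    EuclideanSpace ℝ (Fin n) →L[ℝ] ℝ :=
  (EuclideanSpace.proj (𝕜 := ℝ) i) ∘L leftPseudoInverse (columnMap v)

theorem dualFunctional_sum {v : Fin 3 → EuclideanSpace ℝ (Fin n)} (hv : LinearIndependent ℝ v)
    (i : Fin 3) (a : E3) : dualFunctional v i (∑ j, a j • v j) = a i := by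
  rw [← columnMap_apply, dualFunctional, ContinuousLinearMap.comp_apply,
    leftPseudoInverse_apply (columnMap_injective hv)]
  rfl

theorem continuousAt_dualFunctional {v : Fin 3 → EuclideanSpace ℝ (Fin n)}
    (hv : LinearIndependent ℝ v) (i : Fin 3) : ContinuousAt (fun v => dualFunctional v i) v :=
  continuousAt_const.clm_comp (ContinuousAt.comp (g := leftPseudoInverse)
    (continuousAt_leftPseudoInverse (columnMap_injective hv)) continuous_columnMap.continuousAt)

/-- Sign changes compose the column map with a diagonal orthogonal involution `D`, and the
pseudo-inverse is then composed with `D` on the other side. Absolute coordinates are therefore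
insensitive to the signs of a frame, the only feature of the unit frames below that can be
discontinuous. -/
theorem abs_dualFunctional_of_signs {v w : Fin 3 → EuclideanSpace ℝ (Fin n)}
    (hv : LinearIndependent ℝ v) (h : ∀ i, w i = v i ∨ w i = -v i) (i : Fin 3)
    (z : EuclideanSpace ℝ (Fin n)) : |dualFunctional w i z| = |dualFunctional v i z| := by
  have hs : ∀ i, ∃ s : ℝ, s * s = 1 ∧ w i = s • v i := fun i => by
    rcases h i with h | h
    · exact ⟨1, by norm_num, by simp [h]⟩
    · exact ⟨-1, by norm_num, by simp [h]⟩
  choose s hs1 hs2 using hs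
  set D : E3 →L[ℝ] E3 := ∑ i, (EuclideanSpace.proj (𝕜 := ℝ) i).smulRight
    (EuclideanSpace.single i (s i)) with hD
  have hDa : ∀ a i, D a i = s i * a i := by
    intro a i
    simp [hD, Pi.single_apply, mul_comm]
  have hDD : D * D = 1 := by
    ext a i
    simp only [mul_apply_eq_comp, hDa, ← mul_assoc, hs1, one_mul,
      one_apply_eq_self]
  have hDadj : D.adjoint = D := by
    symm
    rw [ContinuousLinearMap.eq_adjoint_iff]
    intro x y
    simp only [PiLp.inner_apply, hDa]
    refine Finset.sum_congr rfl fun i _ => ?_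
    simp
    ring
  have hwv : columnMap w = columnMap v ∘L D := by
    ext1 a
    simp only [ContinuousLinearMap.comp_apply, columnMap_apply, hDa, hs2, smul_smul]
    refine Finset.sum_congr rfl fun i _ => by rw [mul_comm]
  obtain ⟨u, hu⟩ := isUnit_adjoint_comp_self (columnMap_injective hv)
  let d : (E3 →L[ℝ] E3)ˣ := ⟨D, D, hDD, hDD⟩
  have hinv : leftPseudoInverse (columnMap w) = D ∘L leftPseudoInverse (columnMap v) := by
    unfold leftPseudoInverse
    rw [hwv, ContinuousLinearMap.adjoint_comp, hDadj]
    have e1 : (D ∘L (columnMap v).adjoint) ∘L (columnMap v ∘L D) = ((d * u * d : (E3 →L[ℝ] E3)ˣ) :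
        E3 →L[ℝ] E3) := by
      simp only [Units.val_mul, hu]
      rfl
    rw [e1, Ring.inverse_unit, ← hu, Ring.inverse_unit]
    have e2 : (d * u * d)⁻¹ = d * u⁻¹ * d := by
      have hd : d⁻¹ = d := by ext1; rfl
      simp [mul_inv_rev, hd, mul_assoc]
    rw [e2]
    have e3 : (((d * u⁻¹ * d : (E3 →L[ℝ] E3)ˣ) : E3 →L[ℝ] E3)) ∘L (D ∘L (columnMap v).adjoint)
        = (D * ((u⁻¹ : (E3 →L[ℝ] E3)ˣ) : E3 →L[ℝ] E3) * (D * D)) ∘L (columnMap v).adjoint := rfl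
    rw [e3, hDD, mul_one]
    rfl
  have : dualFunctional w i z = s i * dualFunctional v i z := by
    simp only [dualFunctional, hinv, ContinuousLinearMap.comp_apply]
    exact hDa _ i
  rw [this, abs_mul]
  have : |s i| = 1 := by
    have := abs_mul_abs_self (s i)
    rw [hs1] at this
    nlinarith [abs_nonneg (s i)]
  rw [this, one_mul]

theorem sum_dualFunctional {v : Fin 3 → E3} (hv : LinearIndependent ℝ v) (w : E3) :
    ∑ i, dualFunctional v i w • v i = w := by
  have hs : Function.Surjective (columnMap v) :=
    (LinearMap.injective_iff_surjective (f := (columnMap v).toLinearMap)).1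
      (columnMap_injective hv)
  obtain ⟨a, rfl⟩ := hs w
  rw [columnMap_apply]
  exact Finset.sum_congr rfl fun i _ => by rw [dualFunctional_sum hv]

theorem dualFunctional_apply_self {v : Fin 3 → EuclideanSpace ℝ (Fin n)}
    (hv : LinearIndependent ℝ v) (i j : Fin 3) :
    dualFunctional v i (v j) = if i = j then 1 else 0 := by
  have := dualFunctional_sum hv i (EuclideanSpace.single j (1 : ℝ))
  simpa [Pi.single_apply, ite_smul, Finset.sum_ite_eq] using this

end PseudoInverse

/-! ### Unit frames of the splitting and the separation of two points -/

section Frames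

variable {M : Type*} [TopologicalSpace M] [ChartedSpace E3 M] [IsManifold (𝓡 3) ∞ M] {n : ℕ}

/-- The norm of a tangent vector, seen as a vector of the model space. -/
noncomputable def SmoothMetric.modelNorm (g : SmoothMetric M) (x : M) (v : E3) : ℝ := g.tnorm x v

/-- The subspace `E x`, seen in the model space. -/
def modelFiber (E : TangentField M) (x : M) : Submodule ℝ E3 := E x

theorem SmoothMetric.modelNorm_smul (g : SmoothMetric M) (x : M) (a : ℝ) (v : E3) :
    g.modelNorm x (a • v) = |a| * g.modelNorm x v := g.tnorm_smul x a v

/-- `b` consists of unit vectors spanning the lines `E i`. -/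
structure IsUnitFrame (g : SmoothMetric M) (E : Fin 3 → TangentField M) (b : M → Fin 3 → E3) :
    Prop where
  span_eq : ∀ x i, modelFiber (E i) x = Submodule.span ℝ {b x i}
  norm_eq : ∀ x i, g.modelNorm x (b x i) = 1
  linearIndependent : ∀ x, LinearIndependent ℝ (b x)

/-- The vectors are chosen point by point, with no continuity claimed, because the line bundles need
not be orientable. -/
theorem exists_isUnitFrame (g : SmoothMetric M) {E : Fin 3 → TangentField M}
    (hE : ∀ i, IsContinuousLineBundle (E i))
    (hsplit : ∀ x, DirectSum.IsInternal (fun i => E i x)) :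
    ∃ b : M → Fin 3 → E3, IsUnitFrame g E b := by
  have h1 : ∀ x i, ∃ v : TangentSpace (𝓡 3) x, g.tnorm x v = 1 ∧ E i x = Submodule.span ℝ {v} := by
    intro x i
    obtain ⟨V, hV⟩ := (hE i).exists_local_section x
    obtain ⟨-, h0, hs⟩ := hV.self_of_nhds
    have hp := g.tnorm_pos x h0
    refine ⟨(g.tnorm x (V x))⁻¹ • V x, ?_, ?_⟩
    · rw [g.tnorm_smul, abs_of_pos (inv_pos.2 hp), inv_mul_cancel₀ hp.ne']
    · rw [hs, Submodule.span_singleton_smul_eq (IsUnit.mk0 _ (inv_ne_zero hp.ne'))]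
  choose b hb1 hb2 using h1
  refine ⟨b, ⟨hb2, hb1, fun x => ?_⟩⟩
  have hi := (hsplit x).submodule_iSupIndep
  have := hi.linearIndependent (fun i => E i x) (v := b x)
    (fun i => by rw [hb2 x i]; exact Submodule.mem_span_singleton_self _)
    (fun i h0 => by
      have := hb1 x i
      rw [h0, SmoothMetric.tnorm] at this
      simp at this)
  exact this

variable {g : SmoothMetric M} {E : Fin 3 → TangentField M} {b : M → Fin 3 → E3}
  {e : M → EuclideanSpace ℝ (Fin n)}

/-- The image of the frame under the derivative of `e`. -/
noncomputable def pushedFrame (e : M → EuclideanSpace ℝ (Fin n)) (b : M → Fin 3 → E3) (q : M) :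
    Fin 3 → EuclideanSpace ℝ (Fin n) := fun j => chartDeriv e q (b q j)

/-- The size of the `i`-th component of the displacement from `p` to `q`, measured through `e`. -/
noncomputable def separation (e : M → EuclideanSpace ℝ (Fin n)) (b : M → Fin 3 → E3) (i : Fin 3)
    (p q : M) : ℝ := |dualFunctional (pushedFrame e b p) i (e q - e p)|

theorem IsUnitFrame.linearIndependent_pushedFrame (hb : IsUnitFrame g E b)
    (hinj : ∀ x, Function.Injective (chartDeriv e x)) (q : M) :
    LinearIndependent ℝ (pushedFrame e b q) :=
  (hb.linearIndependent q).map' (chartDeriv e q).toLinearMap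
    (LinearMap.ker_eq_bot.2 (hinj q))

theorem IsUnitFrame.exists_smul (hb : IsUnitFrame g E b) {x : M} {i : Fin 3} {v : E3}
    (hv : v ∈ modelFiber (E i) x) : ∃ a : ℝ, v = a • b x i ∧ g.modelNorm x v = |a| := by
  rw [hb.span_eq] at hv
  obtain ⟨a, rfl⟩ := Submodule.mem_span_singleton.1 hv
  exact ⟨a, rfl, by rw [g.modelNorm_smul, hb.norm_eq, mul_one]⟩

theorem IsUnitFrame.mem (hb : IsUnitFrame g E b) (x : M) (i : Fin 3) :
    b x i ∈ modelFiber (E i) x := by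
  rw [hb.span_eq]; exact Submodule.mem_span_singleton_self _

/-- Up to signs, a unit frame is locally continuous. -/
theorem IsUnitFrame.exists_continuousAt_pushed {F : Type*} [NormedAddCommGroup F]
    [NormedSpace ℝ F] (hb : IsUnitFrame g E b)
    (hE : ∀ i, IsContinuousLineBundle (E i)) {h : M → F} {U : Set M} (hU : IsOpen U)
    (he : ContMDiffOn (𝓡 3) 𝓘(ℝ, F) 1 h U) {r : M} (hr : r ∈ U) :
    ∃ v : M → Fin 3 → F, (∀ᶠ q in 𝓝 r, ContinuousAt v q ∧
      ∀ j, v q j = chartDeriv h q (b q j) ∨ v q j = - chartDeriv h q (b q j)) := by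
  choose V hV using fun i => (hE i).exists_local_section r
  refine ⟨fun q j => (g.tnorm q (V j q))⁻¹ • chartDeriv h q (V j q), ?_⟩
  filter_upwards [Filter.eventually_all.2 hV, hU.mem_nhds hr] with q hq hqU
  constructor
  · refine continuousAt_pi.2 fun j => ?_
    obtain ⟨hc, h0, -⟩ := hq j
    refine ContinuousAt.smul (ContinuousAt.inv₀ ?_ (g.tnorm_pos _ h0).ne')
      (he.continuousAt_mfderiv_apply hU hqU hc)
    exact ContinuousAt.comp (g := fun z : TangentBundle (𝓡 3) M => g.tnorm z.1 z.2)
      g.continuous_tnorm.continuousAt hc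
  · intro j
    obtain ⟨-, h0, hs⟩ := hq j
    obtain ⟨a, ha, hn⟩ := hb.exists_smul (v := V j q) (i := j) (x := q) (by
      change V j q ∈ E j q
      rw [hs]; exact Submodule.mem_span_singleton_self _)
    change g.tnorm q (V j q) = |a| at hn
    have ha0 : a ≠ 0 := by
      rintro rfl
      exact (g.tnorm_pos q h0).ne' (by rw [hn, abs_zero])
    have hD : chartDeriv h q (V j q) = a • chartDeriv h q (b q j) := by
      exact (congrArg (chartDeriv h q) ha).trans (map_smul (chartDeriv h q) a (b q j))
    simp only [hn, hD, smul_smul]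
    rcases abs_choice a with h | h <;> rw [h]
    · left; rw [inv_mul_cancel₀ ha0, one_smul]
    · right; rw [inv_neg, neg_mul, inv_mul_cancel₀ ha0, neg_one_smul]

/-- The derivative of a self-map of `M`, as a map of the model space. -/
noncomputable def chartMapDeriv (f : M → M) (q : M) : E3 →L[ℝ] E3 := mfderiv (𝓡 3) (𝓡 3) f q

theorem chartDeriv_comp {e : M → EuclideanSpace ℝ (Fin n)} {f : M → M} {r : M}
    (he : ContMDiff (𝓡 3) (𝓡 n) 1 e) (hf : ContMDiffAt (𝓡 3) (𝓡 3) 1 f r) :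
    chartDeriv (e ∘ f) r = chartDeriv e (f r) ∘L chartMapDeriv f r :=
  mfderiv_comp r (he.mdifferentiable one_ne_zero (f r)) (hf.mdifferentiableAt one_ne_zero)

/-- On the image of the derivative of `e` the pseudo-inverse recovers coordinates in the frame `b`,
so to first order the separations do not depend on the embedding. -/
theorem dualFunctional_pushedFrame (hb : IsUnitFrame g E b)
    (hinj : ∀ x, Function.Injective (chartDeriv e x)) (q : M) (i : Fin 3) (w : E3) :
    dualFunctional (pushedFrame e b q) i (chartDeriv e q w) = dualFunctional (b q) i w := by
  set a : E3 := WithLp.toLp 2 (fun i => dualFunctional (b q) i w) with ha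
  have h1 : chartDeriv e q w = ∑ j, a j • pushedFrame e b q j := by
    conv_lhs => rw [← sum_dualFunctional (hb.linearIndependent q) w]
    rw [map_sum]
    simp [ha, pushedFrame]
  rw [h1, dualFunctional_sum (hb.linearIndependent_pushedFrame hinj q)]

/-- Difference of the positions of two points in the chart at `r`. -/
noncomputable def chartDiff (r : M) (z : M × M) : E3 :=
  extChartAt (𝓡 3) r z.2 - extChartAt (𝓡 3) r z.1

/-- To first order, the separation of the images is a coordinate of the derivative of `f` applied to
the chart displacement. This rests on strict differentiability of `e ∘ f` and on continuity of the
dual functionals up to signs, which the absolute values absorb. -/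
theorem IsUnitFrame.separation_isLittleO (hb : IsUnitFrame g E b)
    (hE : ∀ i, IsContinuousLineBundle (E i)) (he : ContMDiff (𝓡 3) (𝓡 n) 1 e)
    (hinj : ∀ x, Function.Injective (chartDeriv e x)) {f : M → M} {r : M}
    (hf : ContMDiffAt (𝓡 3) (𝓡 3) 1 f r) (i : Fin 3) :
    (fun z : M × M => separation e b i (f z.1) (f z.2) -
      |dualFunctional (b (f r)) i (chartMapDeriv f r (chartDiff r z))|) =o[𝓝 (r, r)]
      chartDiff r := by
  obtain ⟨v, hv⟩ := hb.exists_continuousAt_pushed hE isOpen_univ he.contMDiffOn (mem_univ (f r))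
  have hLI := hb.linearIndependent_pushedFrame hinj (e := e)
  have hLv : LinearIndependent ℝ (v (f r)) := by
    have h1 := hv.self_of_nhds.2
    have : ∃ s : Fin 3 → ℝˣ, v (f r) = s • pushedFrame e b (f r) := by
      choose s hs using fun j => show ∃ s : ℝˣ, v (f r) j = s • pushedFrame e b (f r) j by
        rcases h1 j with h | h
        · exact ⟨1, by simp [h, pushedFrame]⟩
        · exact ⟨-1, by simp [h, pushedFrame, Units.smul_def]⟩
      exact ⟨s, funext hs⟩
    obtain ⟨s, hs⟩ := this
    rw [hs]
    exact (hLI (f r)).units_smul s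
  set w := chartDiff r with hw
  set B₀ := dualFunctional (v (f r)) i with hB₀
  set T := chartDeriv (e ∘ f) r with hT
  have hδ : (fun z : M × M => e (f z.2) - e (f z.1) - T (w z)) =o[𝓝 (r, r)] w :=
    ContMDiffAt.isLittleO_sub (h := e ∘ f) (he.contMDiffAt.comp r hf)
  have hTw : (fun z => T (w z)) =O[𝓝 (r, r)] w := T.isBigO_comp w _
  have hδO : (fun z : M × M => e (f z.2) - e (f z.1)) =O[𝓝 (r, r)] w := by
    simpa using hδ.isBigO.add hTw
  have hf1 : Filter.Tendsto (fun z : M × M => f z.1) (𝓝 (r, r)) (𝓝 (f r)) :=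
    ContinuousAt.comp (x := (r, r)) (f := Prod.fst) (g := f) hf.continuousAt continuousAt_fst
  have hB : Filter.Tendsto (fun z : M × M => dualFunctional (v (f z.1)) i - B₀) (𝓝 (r, r))
      (𝓝 0) := by
    have h1 : Filter.Tendsto (fun z : M × M => v (f z.1)) (𝓝 (r, r)) (𝓝 (v (f r))) :=
      hv.self_of_nhds.1.tendsto.comp hf1
    have h2 := ((continuousAt_dualFunctional hLv i).tendsto.comp h1).sub_const B₀
    simpa [hB₀] using h2
  -- There are two sources of error: here the functional moves with the base point, and in `h2` the
  -- map `e ∘ f` is not linear.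
  have h1 : (fun z : M × M => (dualFunctional (v (f z.1)) i - B₀) (e (f z.2) - e (f z.1)))
      =o[𝓝 (r, r)] w := by
    have h2 : (fun z : M × M => ‖dualFunctional (v (f z.1)) i - B₀‖ * ‖e (f z.2) - e (f z.1)‖)
        =o[𝓝 (r, r)] (fun z => (1 : ℝ) * ‖w z‖) :=
      ((Asymptotics.isLittleO_one_iff ℝ).2 hB).norm_left.mul_isBigO hδO.norm_norm
    simp only [one_mul] at h2
    refine (Asymptotics.IsBigO.of_bound 1 (Filter.Eventually.of_forall fun z => ?_)).trans_isLittleO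
      h2.of_norm_right
    rw [one_mul, norm_mul, norm_norm, norm_norm]
    exact ContinuousLinearMap.le_opNorm _ _
  have h2 : (fun z : M × M => B₀ (e (f z.2) - e (f z.1) - T (w z))) =o[𝓝 (r, r)] w :=
    (B₀.isBigO_comp _ _).trans_isLittleO hδ
  have h3 := h1.add h2
  refine (Asymptotics.IsBigO.of_bound 1 ?_).trans_isLittleO h3
  filter_upwards [hf1.eventually hv] with z hz
  have e1 : separation e b i (f z.1) (f z.2)
      = |dualFunctional (v (f z.1)) i (e (f z.2) - e (f z.1))| :=
    (abs_dualFunctional_of_signs (hLI (f z.1)) hz.2 i _).symm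
  have e2 : |dualFunctional (b (f r)) i (chartMapDeriv f r (w z))| = |B₀ (T (w z))| := by
    rw [hT, chartDeriv_comp he hf, ContinuousLinearMap.comp_apply,
      hB₀, abs_dualFunctional_of_signs (hLI (f r)) hv.self_of_nhds.2,
      dualFunctional_pushedFrame hb hinj]
  rw [e1, e2, one_mul, Real.norm_eq_abs, Real.norm_eq_abs]
  refine (abs_abs_sub_abs_le _ _).trans (le_of_eq ?_)
  congr 1
  simp

end Frames

/-! ### Cones of pairs of points under a dominated contraction -/

section Dynamics

variable {M : Type*} [TopologicalSpace M] [ChartedSpace E3 M] [IsManifold (𝓡 3) ∞ M] {n : ℕ}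
  {g : SmoothMetric M} {E : Fin 3 → TangentField M} {b : M → Fin 3 → E3}
  {e : M → EuclideanSpace ℝ (Fin n)} {f : M → M} {k : Fin 3}

/-- The factor by which the derivative of `f` stretches the unit vector `b x i`. -/
noncomputable def stretch (g : SmoothMetric M) (b : M → Fin 3 → E3) (f : M → M) (i : Fin 3)
    (x : M) : ℝ := g.modelNorm (f x) (chartMapDeriv f x (b x i))

/-- `f` contracts the line field `E k`, and more strongly than the other two. -/
structure ContractsDominated (g : SmoothMetric M) (E : Fin 3 → TangentField M)
    (b : M → Fin 3 → E3) (f : M → M) (k : Fin 3) : Prop where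
  contMDiff : ContMDiff (𝓡 3) (𝓡 3) 1 f
  map_mem : ∀ x i, ∀ v ∈ modelFiber (E i) x, chartMapDeriv f x v ∈ modelFiber (E i) (f x)
  stretch_lt_one : ∀ x, stretch g b f k x < 1
  stretch_lt : ∀ x, ∀ j ≠ k, stretch g b f k x < stretch g b f j x

theorem stretch_nonneg (i : Fin 3) (x : M) : 0 ≤ stretch g b f i x := g.tnorm_nonneg _ _

/-- The derivative respects the three lines, so in the unit frames it is diagonal, with entries `±
stretch`. -/
theorem abs_dualFunctional_chartMapDeriv (hb : IsUnitFrame g E b)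
    (hf : ContractsDominated g E b f k) (r : M) (i : Fin 3) (w : E3) :
    |dualFunctional (b (f r)) i (chartMapDeriv f r w)|
      = stretch g b f i r * |dualFunctional (b r) i w| := by
  choose a ha hn using fun j => hb.exists_smul (hf.map_mem r j (b r j) (hb.mem r j))
  set c : E3 := WithLp.toLp 2 (fun j => dualFunctional (b r) j w * a j) with hc
  have h1 : chartMapDeriv f r w = ∑ j, c j • b (f r) j := by
    conv_lhs => rw [← sum_dualFunctional (hb.linearIndependent r) w]
    rw [map_sum]
    refine Finset.sum_congr rfl fun j _ => ?_
    rw [map_smul, ha j, smul_smul]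
  rw [h1, dualFunctional_sum (hb.linearIndependent (f r)), stretch, hn i, hc]
  simp [abs_mul, mul_comm]

theorem chartMapDeriv_id (r : M) : chartMapDeriv (id : M → M) r = ContinuousLinearMap.id ℝ E3 :=
  mfderiv_id

theorem IsUnitFrame.separation_sub_isLittleO (hb : IsUnitFrame g E b)
    (hE : ∀ i, IsContinuousLineBundle (E i)) (he : ContMDiff (𝓡 3) (𝓡 n) 1 e)
    (hinj : ∀ x, Function.Injective (chartDeriv e x)) (r : M) (i : Fin 3) :
    (fun z : M × M => separation e b i z.1 z.2 - |dualFunctional (b r) i (chartDiff r z)|)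
      =o[𝓝 (r, r)] chartDiff r := by
  have := hb.separation_isLittleO hE he hinj (f := id) (r := r) contMDiffAt_id i
  simpa [chartMapDeriv_id] using this

theorem separation_nonneg (i : Fin 3) (p q : M) : 0 ≤ separation e b i p q := abs_nonneg _

theorem separation_map_isLittleO (hb : IsUnitFrame g E b)
    (hE : ∀ i, IsContinuousLineBundle (E i)) (he : ContMDiff (𝓡 3) (𝓡 n) 1 e)
    (hinj : ∀ x, Function.Injective (chartDeriv e x)) (hf : ContractsDominated g E b f k)
    (r : M) (i : Fin 3) :
    (fun z : M × M => separation e b i (f z.1) (f z.2)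
      - stretch g b f i r * separation e b i z.1 z.2) =o[𝓝 (r, r)] chartDiff r := by
  have h1 := hb.separation_isLittleO hE he hinj hf.contMDiff.contMDiffAt (r := r) i
  have h2 := (hb.separation_sub_isLittleO hE he hinj r i).const_mul_left (stretch g b f i r)
  refine (h1.sub h2).congr_left fun z => ?_
  rw [abs_dualFunctional_chartMapDeriv hb hf]
  ring

theorem IsUnitFrame.exists_norm_le (hb : IsUnitFrame g E b) (r : M) :
    ∃ C > 0, ∀ w : E3, ‖w‖ ≤ C * ∑ i, |dualFunctional (b r) i w| := by
  refine ⟨1 + ∑ i, ‖b r i‖, by positivity, fun w => ?_⟩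
  conv_lhs => rw [← sum_dualFunctional (hb.linearIndependent r) w]
  refine (norm_sum_le _ _).trans ?_
  rw [Finset.mul_sum]
  refine Finset.sum_le_sum fun i _ => ?_
  rw [norm_smul, Real.norm_eq_abs, mul_comm]
  gcongr
  have : ‖b r i‖ ≤ ∑ i, ‖b r i‖ :=
    Finset.single_le_sum (f := fun i => ‖b r i‖) (fun _ _ => norm_nonneg _) (Finset.mem_univ i)
  linarith

/-- The three separations together control the displacement in the chart, so errors that are
little-o of the displacement can be absorbed into the separations. -/
theorem IsUnitFrame.exists_chartDiff_le (hb : IsUnitFrame g E b)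
    (hE : ∀ i, IsContinuousLineBundle (E i)) (he : ContMDiff (𝓡 3) (𝓡 n) 1 e)
    (hinj : ∀ x, Function.Injective (chartDeriv e x)) (r : M) :
    ∃ C > 0, ∀ᶠ z in 𝓝 (r, r), ‖chartDiff r z‖ ≤ C * ∑ i, separation e b i z.1 z.2 := by
  obtain ⟨C, hC, h⟩ := hb.exists_norm_le r
  refine ⟨2 * C, by positivity, ?_⟩
  -- Three errors with constant `1 / (6 * C)`, multiplied by `C`, add up to half the displacement,
  -- which moves to the left-hand side.
  have h1 : ∀ i, ∀ᶠ z in 𝓝 (r, r), abs (separation e b i z.1 z.2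
      - |dualFunctional (b r) i (chartDiff r z)|) ≤ 1 / (6 * C) * ‖chartDiff r z‖ := fun i =>
    (Asymptotics.isLittleO_iff.1 (hb.separation_sub_isLittleO hE he hinj r i)) (by positivity)
  filter_upwards [Filter.eventually_all.2 h1] with z hz
  have h2 : ∑ i, |dualFunctional (b r) i (chartDiff r z)| ≤
      ∑ i, (separation e b i z.1 z.2 + 1 / (6 * C) * ‖chartDiff r z‖) :=
    Finset.sum_le_sum fun i _ => by linarith [(abs_le.1 (hz i)).1]
  rw [Finset.sum_add_distrib] at h2
  simp only [Finset.sum_const, Finset.card_univ, Fintype.card_fin, nsmul_eq_mul] at h2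
  have h3 := h (chartDiff r z)
  have h4 : C * ((3 : ℕ) * (1 / (6 * C) * ‖chartDiff r z‖)) = ‖chartDiff r z‖ / 2 := by
    field_simp
    push_cast
    ring
  have h5 := mul_le_mul_of_nonneg_left h2 hC.le
  rw [mul_add, h4] at h5
  linarith

/-- The total separation in the directions other than `k`. -/
noncomputable def transverseSeparation (e : M → EuclideanSpace ℝ (Fin n)) (b : M → Fin 3 → E3)
    (k : Fin 3) (p q : M) : ℝ := ∑ j ∈ Finset.univ.erase k, separation e b j p q

theorem sum_separation (k : Fin 3) (p q : M) :
    ∑ i, separation e b i p q = separation e b k p q + transverseSeparation e b k p q :=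
  (Finset.add_sum_erase _ _ (Finset.mem_univ k)).symm

theorem transverseSeparation_nonneg (k : Fin 3) (p q : M) : 0 ≤ transverseSeparation e b k p q :=
  Finset.sum_nonneg fun _ _ => separation_nonneg _ _ _

/-- Near the diagonal, `f` preserves the cone of pairs separated mainly in the directions other
than `k`, and stretches their transverse separation more than it stretches `E k`. -/
theorem exists_cone_step (hb : IsUnitFrame g E b)
    (hE : ∀ i, IsContinuousLineBundle (E i)) (he : ContMDiff (𝓡 3) (𝓡 n) 1 e)
    (hinj : ∀ x, Function.Injective (chartDeriv e x)) (hf : ContractsDominated g E b f k)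
    (r : M) :
    ∃ l ρ : ℝ, stretch g b f k r < l ∧ l < 1 ∧ 1 < ρ ∧ ∀ᶠ z in 𝓝 (r, r),
      separation e b k z.1 z.2 ≤ transverseSeparation e b k z.1 z.2 →
        separation e b k (f z.1) (f z.2) ≤ transverseSeparation e b k (f z.1) (f z.2) ∧
        ρ * l * transverseSeparation e b k z.1 z.2
          ≤ transverseSeparation e b k (f z.1) (f z.2) := by
  set s := stretch g b f with hs
  have h0 : 0 ≤ s k r := stretch_nonneg k r
  -- The rates are arranged as `s k r < l < μ < m ≤ s j r` with also `l < 1`. The gap from `l` to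
  -- `μ` gives `ρ = μ / l`; the gaps around `μ` absorb the nonlinear errors.
  obtain ⟨m, hm, hmj⟩ : ∃ m, s k r < m ∧ ∀ j ≠ k, m ≤ s j r := by
    have : ∀ᶠ m in 𝓝[>] (s k r), ∀ j, j ≠ k → m ≤ s j r := by
      refine Filter.eventually_all.2 fun j => ?_
      by_cases hj : j = k
      · exact Filter.Eventually.of_forall fun _ h => absurd hj h
      · filter_upwards [nhdsWithin_le_nhds (Iic_mem_nhds (hf.stretch_lt r j hj))] with m hm _
        exact hm
    obtain ⟨m, h1, h2⟩ := (this.and self_mem_nhdsWithin).exists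
    exact ⟨m, h2, h1⟩
  obtain ⟨μ, hμ1, hμ2⟩ := exists_between hm
  obtain ⟨l, hl1, hl2⟩ := exists_between (lt_min hμ1 (hf.stretch_lt_one r))
  have hlμ := hl2.trans_le (min_le_left _ _)
  have hl1' := hl2.trans_le (min_le_right _ _)
  have hl0 : 0 < l := h0.trans_lt hl1
  refine ⟨l, μ / l, hl1, hl1', (one_lt_div hl0).2 hlμ, ?_⟩
  obtain ⟨C, hC, hCz⟩ := hb.exists_chartDiff_le hE he hinj r
  -- In the cone the chart displacement is at most `2 * C * T`. The error is thus at most `2 * ε * C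
  -- * T` per direction, and `4 * ε * C * T` for the two transverse directions together.
  set ε := min (m - μ) (μ - s k r) / (4 * C) with hε
  have hmin : 0 < min (m - μ) (μ - s k r) := lt_min (by linarith) (by linarith)
  have hε0 : 0 < ε := by positivity
  have hεC : 4 * (ε * C) = min (m - μ) (μ - s k r) := by rw [hε]; field_simp
  have hdyn : ∀ i, ∀ᶠ z in 𝓝 (r, r), |separation e b i (f z.1) (f z.2)
      - s i r * separation e b i z.1 z.2| ≤ ε * ‖chartDiff r z‖ := fun i =>
    (Asymptotics.isLittleO_iff.1 (separation_map_isLittleO hb hE he hinj hf r i)) hε0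
  filter_upwards [hCz, Filter.eventually_all.2 hdyn] with z hz hd hcone
  set T := transverseSeparation e b k z.1 z.2 with hT
  have hT0 : 0 ≤ T := transverseSeparation_nonneg k _ _
  rw [sum_separation k] at hz
  have hw : ε * ‖chartDiff r z‖ ≤ 2 * (ε * C) * T := by
    calc ε * ‖chartDiff r z‖ ≤ ε * (C * (T + T)) := by
          gcongr
          exact hz.trans (by gcongr)
      _ = _ := by ring
  have e1 : separation e b k (f z.1) (f z.2) ≤ μ * T := by
    have h1 := (abs_le.1 (hd k)).2
    have h2 : s k r * separation e b k z.1 z.2 ≤ s k r * T := by gcongr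
    have h3 : 4 * (ε * C) * T ≤ (μ - s k r) * T := by
      rw [hεC]; gcongr; exact min_le_right _ _
    nlinarith
  have e2 : μ * T ≤ transverseSeparation e b k (f z.1) (f z.2) := by
    have h1 : ∑ j ∈ Finset.univ.erase k, (m * separation e b j z.1 z.2 - ε * ‖chartDiff r z‖)
        ≤ transverseSeparation e b k (f z.1) (f z.2) := by
      refine Finset.sum_le_sum fun j hj => ?_
      have h1 := (abs_le.1 (hd j)).1
      have h2 : m * separation e b j z.1 z.2 ≤ s j r * separation e b j z.1 z.2 := by
        gcongr
        · exact separation_nonneg _ _ _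
        · exact hmj j (Finset.ne_of_mem_erase hj)
      linarith
    rw [Finset.sum_sub_distrib, ← Finset.mul_sum, Finset.sum_const,
      Finset.card_erase_of_mem (Finset.mem_univ k)] at h1
    simp only [Finset.card_univ, Fintype.card_fin, nsmul_eq_mul] at h1
    have h3 : 4 * (ε * C) * T ≤ (m - μ) * T := by
      rw [hεC]; gcongr; exact min_le_left _ _
    have h4 : m * T - 2 * (ε * ‖chartDiff r z‖) ≤ transverseSeparation e b k (f z.1) (f z.2) := by
      refine le_trans (le_of_eq ?_) h1
      norm_num [hT, transverseSeparation]
    nlinarith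
  refine ⟨e1.trans e2, ?_⟩
  rw [div_mul_cancel₀ _ hl0.ne']
  exact e2

/-- Along a nonvanishing continuous local section `V` the stretch is the norm of the image of `V`
divided by the norm of `V`; the sign of the frame vector cancels. -/
theorem eventually_stretch_lt (hb : IsUnitFrame g E b)
    (hE : ∀ i, IsContinuousLineBundle (E i)) (hf : ContractsDominated g E b f k) (r : M) {l : ℝ}
    (hl : stretch g b f k r < l) : ∀ᶠ q in 𝓝 r, stretch g b f k q < l := by
  obtain ⟨V, hV⟩ := (hE k).exists_local_section r
  have hval : ∀ᶠ q in 𝓝 r, stretch g b f k q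
      = (g.tnorm q (V q))⁻¹ * g.tnorm (f q) (mfderiv (𝓡 3) (𝓡 3) f q (V q)) := by
    filter_upwards [hV] with q hq
    obtain ⟨-, h0, hs⟩ := hq
    obtain ⟨a, ha, hn⟩ := hb.exists_smul (v := V q) (i := k) (x := q) (by
      change V q ∈ E k q
      rw [hs]; exact Submodule.mem_span_singleton_self _)
    change g.tnorm q (V q) = |a| at hn
    have hp := g.tnorm_pos q h0
    have h1 : g.tnorm (f q) (mfderiv (𝓡 3) (𝓡 3) f q (V q)) = |a| * stretch g b f k q := by
      change g.modelNorm (f q) (chartMapDeriv f q (V q)) = _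
      rw [stretch, ← g.modelNorm_smul, ← map_smul]
      exact congrArg (fun w : E3 => g.modelNorm (f q) (chartMapDeriv f q w)) ha
    rw [h1, hn, ← mul_assoc, inv_mul_cancel₀ (by rw [← hn]; exact hp.ne'), one_mul]
  obtain ⟨hc, h0, -⟩ := hV.self_of_nhds
  have hcont : ContinuousAt (fun q => (g.tnorm q (V q))⁻¹ *
      g.tnorm (f q) (mfderiv (𝓡 3) (𝓡 3) f q (V q))) r := by
    refine ContinuousAt.mul (ContinuousAt.inv₀ ?_ (g.tnorm_pos _ h0).ne') ?_
    · exact ContinuousAt.comp (g := fun z : TangentBundle (𝓡 3) M => g.tnorm z.1 z.2)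
        g.continuous_tnorm.continuousAt hc
    · exact ContinuousAt.comp (g := fun z : TangentBundle (𝓡 3) M => g.tnorm z.1 z.2)
        (f := fun q => tangentMap (𝓡 3) (𝓡 3) f ⟨q, V q⟩) g.continuous_tnorm.continuousAt
        (ContinuousAt.comp (g := tangentMap (𝓡 3) (𝓡 3) f)
          (f := fun q => (⟨q, V q⟩ : TangentBundle (𝓡 3) M))
          (hf.contMDiff.continuous_tangentMap le_rfl).continuousAt hc)
  rw [hval.self_of_nhds] at hl
  have := hcont.tendsto.eventually_lt_const hl
  filter_upwards [this, hval] with q h1 h2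
  rw [h2]; exact h1

/-- Only local bounds are assumed, since quantities built from the pointwise-chosen frame need not
be continuous. -/
theorem exists_bound_of_locally_bounded {X : Type*} [TopologicalSpace X] [CompactSpace X]
    {u : X → ℝ} (h : ∀ r, ∃ C, ∀ᶠ q in 𝓝 r, u q ≤ C) : ∃ C, 0 ≤ C ∧ ∀ q, u q ≤ C := by
  have := isCompact_univ.induction_on (p := fun S : Set X => ∃ C, 0 ≤ C ∧ ∀ q ∈ S, u q ≤ C)
    ⟨0, le_rfl, fun q hq => absurd hq (notMem_empty q)⟩
    (fun s t hst ⟨C, h0, hC⟩ => ⟨C, h0, fun q hq => hC q (hst hq)⟩)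
    (fun s t ⟨C, h0, hC⟩ ⟨D, h1, hD⟩ => ⟨max C D, h0.trans (le_max_left _ _), fun q hq => by
      rcases hq with hq | hq
      · exact (hC q hq).trans (le_max_left _ _)
      · exact (hD q hq).trans (le_max_right _ _)⟩)
    (fun r _ => by
      obtain ⟨C, hC⟩ := h r
      refine ⟨_, nhdsWithin_le_nhds hC, max C 0, le_max_right _ _, fun q hq => ?_⟩
      exact (show u q ≤ C from hq).trans (le_max_left _ _))
  obtain ⟨C, h0, hC⟩ := this
  exact ⟨C, h0, fun q => hC q (mem_univ q)⟩

theorem IsUnitFrame.eventually_norm_chartDeriv_le {F : Type*} [NormedAddCommGroup F]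
    [NormedSpace ℝ F] (hb : IsUnitFrame g E b)
    (hE : ∀ i, IsContinuousLineBundle (E i)) {h : M → F} {U : Set M} (hU : IsOpen U)
    (hh : ContMDiffOn (𝓡 3) 𝓘(ℝ, F) 1 h U) {r : M} (hr : r ∈ U) (i : Fin 3) :
    ∃ C, ∀ᶠ q in 𝓝 r, ‖chartDeriv h q (b q i)‖ ≤ C := by
  obtain ⟨v, hv⟩ := hb.exists_continuousAt_pushed hE hU hh hr
  refine ⟨‖v r i‖ + 1, ?_⟩
  have h1 : ContinuousAt (fun q => ‖v q i‖) r :=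
    ((continuous_apply i).continuousAt.comp hv.self_of_nhds.1).norm
  filter_upwards [h1.eventually_lt_const (lt_add_one _), hv] with q hq h2
  rcases h2.2 i with h | h
  · rw [← h]; exact hq.le
  · rw [← norm_neg, ← h]; exact hq.le

theorem IsUnitFrame.exists_norm_chartDeriv_le [CompactSpace M] {F : Type*} [NormedAddCommGroup F]
    [NormedSpace ℝ F] (hb : IsUnitFrame g E b)
    (hE : ∀ i, IsContinuousLineBundle (E i)) {h : M → F}
    (hh : ContMDiff (𝓡 3) 𝓘(ℝ, F) 1 h) (i : Fin 3) :
    ∃ C, 0 ≤ C ∧ ∀ q, ∀ v ∈ modelFiber (E i) q, ‖chartDeriv h q v‖ ≤ C * g.modelNorm q v := by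
  obtain ⟨C, h0, hC⟩ := exists_bound_of_locally_bounded
    (u := fun q => ‖chartDeriv h q (b q i)‖) (fun r =>
      hb.eventually_norm_chartDeriv_le hE isOpen_univ hh.contMDiffOn (mem_univ r) i)
  refine ⟨C, h0, fun q v hv => ?_⟩
  obtain ⟨a, rfl, hn⟩ := hb.exists_smul hv
  rw [hn, map_smul, norm_smul, Real.norm_eq_abs, mul_comm]
  gcongr
  exact hC q

theorem IsUnitFrame.exists_separation_le [CompactSpace M] (hb : IsUnitFrame g E b)
    (hE : ∀ i, IsContinuousLineBundle (E i)) (he : ContMDiff (𝓡 3) (𝓡 n) 1 e)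
    (hinj : ∀ x, Function.Injective (chartDeriv e x)) :
    ∃ K, 0 ≤ K ∧ ∀ p, ∀ i q, separation e b i p q ≤ K * ‖e q - e p‖ := by
  have key : ∀ i, ∃ K, 0 ≤ K ∧ ∀ p, ‖dualFunctional (pushedFrame e b p) i‖ ≤ K := by
    intro i
    refine exists_bound_of_locally_bounded fun r => ?_
    obtain ⟨v, hv⟩ := hb.exists_continuousAt_pushed hE isOpen_univ he.contMDiffOn (mem_univ r)
    have hLI := hb.linearIndependent_pushedFrame hinj (e := e) r
    have hLv : LinearIndependent ℝ (v r) := by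
      choose s hs using fun j => show ∃ s : ℝˣ, v r j = s • pushedFrame e b r j by
        rcases hv.self_of_nhds.2 j with h | h
        · exact ⟨1, by simp [h, pushedFrame]⟩
        · exact ⟨-1, by simp [h, pushedFrame, Units.smul_def]⟩
      rw [show v r = s • pushedFrame e b r from funext hs]
      exact hLI.units_smul s
    have h1 : ContinuousAt (fun q => ‖dualFunctional (v q) i‖) r :=
      (ContinuousAt.comp (g := fun v => dualFunctional v i)
        (continuousAt_dualFunctional hLv i) hv.self_of_nhds.1).norm
    refine ⟨‖dualFunctional (v r) i‖ + 1, ?_⟩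
    filter_upwards [h1.eventually_lt_const (lt_add_one _), hv] with q hq h2
    refine ContinuousLinearMap.opNorm_le_bound _ (by positivity) fun z => ?_
    rw [Real.norm_eq_abs, ← abs_dualFunctional_of_signs
      (hb.linearIndependent_pushedFrame hinj q) h2.2 i z, ← Real.norm_eq_abs]
    exact ContinuousLinearMap.le_of_opNorm_le _ hq.le z
  choose K hK0 hK using key
  refine ⟨∑ i, K i, Finset.sum_nonneg fun i _ => hK0 i, fun p i q => ?_⟩
  refine (ContinuousLinearMap.le_of_opNorm_le _ (hK i p) _).trans ?_
  gcongr
  exact Finset.single_le_sum (f := K) (fun i _ => hK0 i) (Finset.mem_univ i)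

end Dynamics

/-! ### Velocities of curves in the manifold -/

section Velocity

variable {M : Type*} [TopologicalSpace M] [ChartedSpace E3 M] [IsManifold (𝓡 3) ∞ M]
  {F : Type*} [NormedAddCommGroup F] [NormedSpace ℝ F]

/-- The curve `c` has velocity `v` at time `t` within `s`. -/
def HasVelocityWithinAt (c : ℝ → M) (s : Set ℝ) (t : ℝ) (v : E3) : Prop :=
  HasMFDerivWithinAt 𝓘(ℝ, ℝ) (𝓡 3) c s t (ContinuousLinearMap.toSpanSingleton ℝ v : ℝ →L[ℝ] E3)

theorem HasVelocityWithinAt.comp_map {c : ℝ → M} {s : Set ℝ} {t : ℝ} {v : E3}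
    (hc : HasVelocityWithinAt c s t v) {f : M → M} (hf : MDifferentiableAt (𝓡 3) (𝓡 3) f (c t)) :
    HasVelocityWithinAt (f ∘ c) s t (chartMapDeriv f (c t) v) := by
  have h := HasMFDerivAt.comp_hasMFDerivWithinAt t hf.hasMFDerivAt hc
  have e1 : (chartMapDeriv f (c t)) ∘L (ContinuousLinearMap.toSpanSingleton ℝ v)
      = ContinuousLinearMap.toSpanSingleton ℝ (chartMapDeriv f (c t) v) := by
    ext1; simp
  unfold HasVelocityWithinAt
  rw [← e1]
  exact h

theorem HasVelocityWithinAt.comp_fun {c : ℝ → M} {s : Set ℝ} {t : ℝ} {v : E3}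
    (hc : HasVelocityWithinAt c s t v) {h : M → F}
    (hh : MDifferentiableAt (𝓡 3) 𝓘(ℝ, F) h (c t)) :
    HasDerivWithinAt (h ∘ c) (chartDeriv h (c t) v) s t := by
  have h' := HasMFDerivAt.comp_hasMFDerivWithinAt t hh.hasMFDerivAt hc
  have e1 : (chartDeriv h (c t)) ∘L (ContinuousLinearMap.toSpanSingleton ℝ v)
      = ContinuousLinearMap.toSpanSingleton ℝ (chartDeriv h (c t) v) := by
    ext1; simp
  unfold HasDerivWithinAt HasDerivAtFilter
  rw [← e1]
  exact h'.hasFDerivWithinAt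

theorem HasVelocityWithinAt.comp_real {c : ℝ → M} {s s' : Set ℝ} {θ a : ℝ} {v : E3} {σ : ℝ → ℝ}
    (hc : HasVelocityWithinAt c s (σ θ) v) (hσ : HasDerivWithinAt σ a s' θ)
    (hm : MapsTo σ s' s) : HasVelocityWithinAt (c ∘ σ) s' θ (a • v) := by
  have h := HasMFDerivWithinAt.comp θ hc hσ.hasFDerivWithinAt.hasMFDerivWithinAt hm
  have e1 : (ContinuousLinearMap.toSpanSingleton ℝ v) ∘L (ContinuousLinearMap.toSpanSingleton ℝ a)
      = ContinuousLinearMap.toSpanSingleton ℝ (a • v) := by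
    ext1; simp
  unfold HasVelocityWithinAt
  rw [← e1]
  exact h

/-- A curve on `[0, 1]` tangent to `E` with speed at most `l`. -/
def IsSlowArc (g : SmoothMetric M) (E : TangentField M) (c : ℝ → M) (l : ℝ) : Prop :=
  ∀ t ∈ Icc (0 : ℝ) 1, ∃ v ∈ modelFiber E (c t), g.modelNorm (c t) v ≤ l ∧
    HasVelocityWithinAt c (Icc 0 1) t v

end Velocity

/-! ### Uniqueness of short curves tangent to the contracted line field -/

section KeyLemma

variable {M : Type*} [TopologicalSpace M] [ChartedSpace E3 M] [IsManifold (𝓡 3) ∞ M] {n : ℕ}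
  {g : SmoothMetric M} {E : Fin 3 → TangentField M} {b : M → Fin 3 → E3}
  {e : M → EuclideanSpace ℝ (Fin n)} {f : M → M} {k : Fin 3}

theorem IsSlowArc.map (hb : IsUnitFrame g E b) (hf : ContractsDominated g E b f k) {c : ℝ → M}
    {l s : ℝ} (hc : IsSlowArc g (E k) c l)
    (hs : ∀ t ∈ Icc (0 : ℝ) 1, stretch g b f k (c t) ≤ s) : IsSlowArc g (E k) (f ∘ c) (s * l) := by
  intro t ht
  obtain ⟨v, hv, hvl, hd⟩ := hc t ht
  refine ⟨_, hf.map_mem _ _ v hv, ?_,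
    hd.comp_map (hf.contMDiff.mdifferentiable one_ne_zero (c t))⟩
  obtain ⟨a, rfl, hn⟩ := hb.exists_smul hv
  have h1 := hs t ht
  have h2 : 0 ≤ stretch g b f k (c t) := stretch_nonneg _ _
  have : g.modelNorm ((f ∘ c) t) (chartMapDeriv f (c t) (a • b (c t) k))
      = stretch g b f k (c t) * |a| := by
    rw [map_smul, g.modelNorm_smul, mul_comm]
    rfl
  rw [this]
  rw [hn] at hvl
  have := h2.trans h1
  gcongr

theorem IsSlowArc.norm_sub_le {F : Type*} [NormedAddCommGroup F] [NormedSpace ℝ F] {D : TangentField M}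
    {c : ℝ → M} {l C : ℝ} (hc : IsSlowArc g D c l) {h : M → F}
    (hh : ContMDiff (𝓡 3) 𝓘(ℝ, F) 1 h) (hC0 : 0 ≤ C)
    (hC : ∀ q, ∀ v ∈ modelFiber D q, ‖chartDeriv h q v‖ ≤ C * g.modelNorm q v) {t : ℝ}
    (ht : t ∈ Icc (0 : ℝ) 1) : ‖h (c t) - h (c 0)‖ ≤ C * l := by
  choose! v hv hvl hd using hc
  have hl : 0 ≤ l := (g.tnorm_nonneg _ _).trans (hvl t ht)
  have := Convex.norm_image_sub_le_of_norm_hasDerivWithin_le (s := Icc (0 : ℝ) 1) (f := h ∘ c)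
    (f' := fun t => chartDeriv h (c t) (v t)) (C := C * l) (x := 0) (y := t)
    (fun t ht => (hd t ht).comp_fun (hh.mdifferentiable one_ne_zero _))
    (fun t ht => (hC _ _ (hv t ht)).trans (by have := hvl t ht; gcongr))
    (convex_Icc 0 1) (by simp) ht
  refine this.trans ?_
  rw [sub_zero, Real.norm_of_nonneg ht.1]
  have : 0 ≤ C * l := by positivity
  nlinarith [ht.2]

/-- Endpoints of two short curves tangent to the dominated contracted line field that issue from
the same point are never separated mainly in the other directions. -/
theorem exists_endpoint_eq [CompactSpace M] (hb : IsUnitFrame g E b)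
    (hE : ∀ i, IsContinuousLineBundle (E i)) (he : ContMDiff (𝓡 3) (𝓡 n) 1 e)
    (hemb : IsEmbedding e)
    (hinj : ∀ x, Function.Injective (chartDeriv e x)) (hf : ContractsDominated g E b f k) :
    ∃ l₀ > 0, ∀ c₁ c₂ : ℝ → M, IsSlowArc g (E k) c₁ l₀ → IsSlowArc g (E k) c₂ l₀ →
      c₁ 0 = c₂ 0 →
      separation e b k (c₁ 1) (c₂ 1) ≤ transverseSeparation e b k (c₁ 1) (c₂ 1) →
      c₁ 1 = c₂ 1 := by
  obtain ⟨C, hC0, hC⟩ := hb.exists_norm_chartDeriv_le hE he k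
  obtain ⟨K, hK0, hK⟩ := hb.exists_separation_le hE he hinj
  choose L ρ hL hL1 hρ hstep using exists_cone_step hb hE he hinj hf
  -- The neighbourhoods are cut out by open sets of the ambient Euclidean space, so that a Lebesgue
  -- number can be taken for its metric on the compact image of `e`.
  have hopen : ∀ r, ∃ O : Set (EuclideanSpace ℝ (Fin n)), IsOpen O ∧ e r ∈ O ∧
      ∀ p q, e p ∈ O → e q ∈ O → (stretch g b f k p ≤ L r) ∧
        (∑ i, separation e b i p q = 0 → p = q) ∧
        (separation e b k p q ≤ transverseSeparation e b k p q →
          separation e b k (f p) (f q) ≤ transverseSeparation e b k (f p) (f q) ∧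
          ρ r * L r * transverseSeparation e b k p q
            ≤ transverseSeparation e b k (f p) (f q)) := by
    intro r
    obtain ⟨A, hA, hAz⟩ := hb.exists_chartDiff_le hE he hinj r
    have hs : ∀ᶠ q in 𝓝 r, stretch g b f k q < L r ∧ q ∈ (extChartAt (𝓡 3) r).source :=
      (eventually_stretch_lt hb hE hf r (hL r)).and (extChartAt_source_mem_nhds r)
    have hs' : ∀ᶠ z : M × M in 𝓝 (r, r), (stretch g b f k z.1 < L r ∧
        z.1 ∈ (extChartAt (𝓡 3) r).source) ∧ (stretch g b f k z.2 < L r ∧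
        z.2 ∈ (extChartAt (𝓡 3) r).source) := by
      rw [nhds_prod_eq]
      exact hs.prod_mk hs
    obtain ⟨U, V, hU, hrU, hV, hrV, hUV⟩ := mem_nhds_prod_iff'.1 ((hs'.and hAz).and (hstep r))
    obtain ⟨O, hO, hOU⟩ := hemb.isOpen_iff.1 (hU.inter hV)
    have hmem : ∀ p, e p ∈ O ↔ p ∈ U ∩ V := fun p => by rw [← hOU]; rfl
    refine ⟨O, hO, (hmem r).2 ⟨hrU, hrV⟩, fun p q hp hq => ?_⟩
    obtain ⟨⟨h1, h2⟩, h3⟩ := hUV (show (p, q) ∈ U ×ˢ V from ⟨((hmem p).1 hp).1, ((hmem q).1 hq).2⟩)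
    refine ⟨h1.1.1.le, fun h0 => ?_, h3⟩
    simp only at h2
    rw [h0, mul_zero, norm_le_zero_iff, chartDiff, sub_eq_zero] at h2
    exact ((extChartAt (𝓡 3) r).injOn h1.2.2 h1.1.2 h2).symm
  choose O hO hrO hOp using hopen
  obtain ⟨t, ht⟩ := isCompact_univ.elim_nhds_subcover (fun r => e ⁻¹' O r)
    (fun r _ => ((hO r).preimage hemb.continuous).mem_nhds (hrO r))
  obtain ⟨ρ₀, hρ₀, hρ₀1⟩ : ∃ ρ₀ : ℝ, (∀ r ∈ t, ρ₀ ≤ ρ r) ∧ 1 < ρ₀ := by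
    have : ∀ᶠ x in 𝓝[>] (1 : ℝ), ∀ r ∈ t, x ≤ ρ r := by
      refine (Filter.eventually_all_finset t).2 fun r _ => ?_
      exact nhdsWithin_le_nhds (Iic_mem_nhds (hρ r))
    exact (this.and self_mem_nhdsWithin).exists
  obtain ⟨δ, hδ, hball⟩ := lebesgue_number_lemma_of_metric (isCompact_range hemb.continuous)
    (c := fun r : t => O r) (fun r => hO r) (by
      rintro _ ⟨q, rfl⟩
      obtain ⟨r, hr, hq⟩ := mem_iUnion₂.1 (ht.2 (mem_univ q))
      exact mem_iUnion.2 ⟨⟨r, hr⟩, hq⟩)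
  -- Arcs of speed at most `l₀` move less than `δ` in the embedding. Both arcs then lie in a single
  -- `O r`, with a single pair of rates.
  set l₀ := δ / (2 * (C + 1)) with hl₀
  have hl₀pos : 0 < l₀ := by positivity
  have hCl : ∀ l ≤ l₀, C * l < δ := by
    intro l hl
    calc C * l ≤ C * l₀ := by gcongr
      _ ≤ (C + 1) * l₀ := by nlinarith
      _ = δ / 2 := by rw [hl₀]; field_simp
      _ < δ := by linarith
  -- The bound is linear in the speed `l`, which is generalised in the induction. Applying `f`
  -- replaces `l` by `L r * l` and multiplies the gap by at least `ρ₀ * L r`; the local factor `L r`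
  -- cancels, so domination is needed only pointwise. The second conjunct does not involve `N` and
  -- is settled in the base case.
  have main : ∀ N : ℕ, ∀ l ≤ l₀, ∀ c₁ c₂ : ℝ → M, IsSlowArc g (E k) c₁ l → IsSlowArc g (E k) c₂ l →
      c₁ 0 = c₂ 0 → separation e b k (c₁ 1) (c₂ 1) ≤ transverseSeparation e b k (c₁ 1) (c₂ 1) →
      transverseSeparation e b k (c₁ 1) (c₂ 1) * ρ₀ ^ N ≤ (3 * K * (2 * C)) * l ∧
      (∑ i, separation e b i (c₁ 1) (c₂ 1) = 0 → c₁ 1 = c₂ 1) := by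
    intro N
    induction N with
    | zero =>
      intro l hl c₁ c₂ h₁ h₂ h0 hcone
      have hn : ∀ t ∈ Icc (0 : ℝ) 1, ‖e (c₁ t) - e (c₁ 0)‖ ≤ C * l := fun t ht =>
        h₁.norm_sub_le he hC0 hC ht
      have hn2 : ∀ t ∈ Icc (0 : ℝ) 1, ‖e (c₂ t) - e (c₁ 0)‖ ≤ C * l := fun t ht => by
        rw [h0]; exact h₂.norm_sub_le he hC0 hC ht
      have h11 : (1 : ℝ) ∈ Icc (0 : ℝ) 1 := by simp
      constructor
      · have hd : ‖e (c₂ 1) - e (c₁ 1)‖ ≤ 2 * C * l := by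
          calc ‖e (c₂ 1) - e (c₁ 1)‖ = ‖(e (c₂ 1) - e (c₁ 0)) - (e (c₁ 1) - e (c₁ 0))‖ := by
                congr 1; abel
            _ ≤ C * l + C * l := norm_sub_le_of_le (hn2 1 h11) (hn 1 h11)
            _ = _ := by ring
        rw [pow_zero, mul_one]
        calc transverseSeparation e b k (c₁ 1) (c₂ 1)
            ≤ ∑ i, separation e b i (c₁ 1) (c₂ 1) := by
              rw [sum_separation k]
              linarith [separation_nonneg (e := e) (b := b) k (c₁ 1) (c₂ 1)]
          _ ≤ ∑ _i : Fin 3, K * (2 * C * l) := Finset.sum_le_sum fun i _ =>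
              (hK _ i _).trans (by gcongr)
          _ = _ := by simp; ring
      · obtain ⟨r, hr⟩ := hball (e (c₁ 0)) (mem_range_self _)
        exact ((hOp r _ _ (hr (by
          rw [mem_ball_iff_norm]; exact (hn 1 h11).trans_lt (hCl l hl))) (hr (by
          rw [mem_ball_iff_norm]; exact (hn2 1 h11).trans_lt (hCl l hl)))).2.1)
    | succ N ih =>
      intro l hl c₁ c₂ h₁ h₂ h0 hcone
      refine ⟨?_, (ih l hl c₁ c₂ h₁ h₂ h0 hcone).2⟩
      obtain ⟨r, hr⟩ := hball (e (c₁ 0)) (mem_range_self _)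
      have hin₁ : ∀ t ∈ Icc (0 : ℝ) 1, e (c₁ t) ∈ O r := fun t ht => hr (by
        rw [mem_ball_iff_norm]; exact (h₁.norm_sub_le he hC0 hC ht).trans_lt (hCl l hl))
      have hin₂ : ∀ t ∈ Icc (0 : ℝ) 1, e (c₂ t) ∈ O r := fun t ht => hr (by
        rw [mem_ball_iff_norm, h0]; exact (h₂.norm_sub_le he hC0 hC ht).trans_lt (hCl l hl))
      have h11 : (1 : ℝ) ∈ Icc (0 : ℝ) 1 := by simp
      have hl0 : 0 ≤ l := by
        obtain ⟨v, -, hv, -⟩ := h₁ 1 h11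
        exact (g.tnorm_nonneg _ _).trans hv
      have hLr : 0 < L r := (stretch_nonneg (g := g) (b := b) (f := f) k r.1).trans_lt (hL r)
      obtain ⟨hc1, hc2⟩ := (hOp r _ _ (hin₁ 1 h11) (hin₂ 1 h11)).2.2 hcone
      have := (ih (L r * l) (by nlinarith [hL1 r]) (f ∘ c₁) (f ∘ c₂)
        (h₁.map hb hf fun t ht => (hOp r _ _ (hin₁ t ht) (hin₁ t ht)).1)
        (h₂.map hb hf fun t ht => (hOp r _ _ (hin₂ t ht) (hin₂ t ht)).1)
        (by simp [h0]) hc1).1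
      simp only [Function.comp] at this
      set T := transverseSeparation e b k (c₁ 1) (c₂ 1)
      have hT0 : 0 ≤ T := transverseSeparation_nonneg k _ _
      have hρr := hρ₀ r r.2
      have hpow : 0 ≤ ρ₀ ^ N := by positivity
      have h4 : ρ₀ * L r * T ≤ ρ r * L r * T := by gcongr
      have h5 : ρ₀ * L r * T * ρ₀ ^ N ≤ 3 * K * (2 * C) * (L r * l) :=
        (mul_le_mul_of_nonneg_right (h4.trans hc2) hpow).trans this
      refine le_of_mul_le_mul_left ?_ hLr
      calc L r * (T * ρ₀ ^ (N + 1)) = ρ₀ * L r * T * ρ₀ ^ N := by ring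
        _ ≤ _ := h5
        _ = _ := by ring
  refine ⟨l₀, hl₀pos, fun c₁ c₂ h₁ h₂ h0 hcone => ?_⟩
  refine (main 0 l₀ le_rfl c₁ c₂ h₁ h₂ h0 hcone).2 ?_
  have hT : transverseSeparation e b k (c₁ 1) (c₂ 1) ≤ 0 := by
    by_contra! hpos
    obtain ⟨N, hN⟩ := pow_unbounded_of_one_lt
      (((3 * K * (2 * C)) * l₀) / transverseSeparation e b k (c₁ 1) (c₂ 1)) hρ₀1
    rw [div_lt_iff₀ hpos, mul_comm] at hN
    exact absurd (main N l₀ le_rfl c₁ c₂ h₁ h₂ h0 hcone).1 (by rw [not_le]; rw [mul_comm] at hN; linarith)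
  rw [sum_separation k]
  linarith [separation_nonneg (e := e) (b := b) k (c₁ 1) (c₂ 1),
    transverseSeparation_nonneg (e := e) (b := b) k (c₁ 1) (c₂ 1)]

/-- Two short curves tangent to the dominated contracted line field that issue from the same point
and end near `p` at the same `k`-th coordinate end at the same point. -/
theorem exists_endpoint_eq_of_coord_eq [CompactSpace M] [T2Space M]
    (hb : IsUnitFrame g E b) (hE : ∀ i, IsContinuousLineBundle (E i))
    (hf : ContractsDominated g E b f k) :
    ∃ l₀ > 0, ∀ p : M, ∃ U ∈ 𝓝 p, ∀ c₁ c₂ : ℝ → M, IsSlowArc g (E k) c₁ l₀ →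
      IsSlowArc g (E k) c₂ l₀ → c₁ 0 = c₂ 0 → c₁ 1 ∈ U → c₂ 1 ∈ U →
      dualFunctional (b p) k (extChartAt (𝓡 3) p (c₁ 1))
        = dualFunctional (b p) k (extChartAt (𝓡 3) p (c₂ 1)) → c₁ 1 = c₂ 1 := by
  obtain ⟨n, e, he, hemb, hinj⟩ := exists_embedding_euclidean_of_compact (I := 𝓡 3) (M := M)
  have he1 : ContMDiff (𝓡 3) (𝓡 n) 1 e := he.of_le (by norm_cast)
  have hinj' : ∀ x, Function.Injective (chartDeriv e x) := hinj
  obtain ⟨l₀, hl₀, H⟩ := exists_endpoint_eq hb hE he1 hemb.isEmbedding hinj' hf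
  refine ⟨l₀, hl₀, fun p => ?_⟩
  obtain ⟨C, hC, hCz⟩ := hb.exists_chartDiff_le hE he1 hinj' p
  -- When the `k`-th coordinates agree, the constant `1 / (2 * C)` bounds the `k`-th separation by
  -- half of the total separation, which is exactly the cone condition.
  have h1 : ∀ᶠ z in 𝓝 (p, p), abs (separation e b k z.1 z.2
      - |dualFunctional (b p) k (chartDiff p z)|) ≤ 1 / (2 * C) * ‖chartDiff p z‖ :=
    (Asymptotics.isLittleO_iff.1 (hb.separation_sub_isLittleO hE he1 hinj' p k)) (by positivity)
  obtain ⟨U, hU, V, hV, hUV⟩ := mem_nhds_prod_iff.1 (hCz.and h1)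
  refine ⟨U ∩ V, Filter.inter_mem hU hV, fun c₁ c₂ h₁ h₂ h0 hc₁ hc₂ heq => H c₁ c₂ h₁ h₂ h0 ?_⟩
  obtain ⟨h2, h3⟩ := hUV (show (c₁ 1, c₂ 1) ∈ U ×ˢ V from ⟨hc₁.1, hc₂.2⟩)
  have h4 : dualFunctional (b p) k (chartDiff p (c₁ 1, c₂ 1)) = 0 := by
    rw [chartDiff, map_sub, heq, sub_self]
  simp only at h2 h3
  rw [h4, abs_zero, sub_zero, abs_of_nonneg (separation_nonneg _ _ _)] at h3
  rw [sum_separation k] at h2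
  have h5 : 1 / (2 * C) * ‖chartDiff p (c₁ 1, c₂ 1)‖ ≤
      1 / 2 * (separation e b k (c₁ 1) (c₂ 1) + transverseSeparation e b k (c₁ 1) (c₂ 1)) := by
    calc 1 / (2 * C) * ‖chartDiff p (c₁ 1, c₂ 1)‖ ≤ 1 / (2 * C) * (C * (separation e b k (c₁ 1) (c₂ 1)
          + transverseSeparation e b k (c₁ 1) (c₂ 1))) := by gcongr
      _ = _ := by field_simp
  linarith

end KeyLemma

/-! ### Normalised sections of a line field in a chart -/

section ChartField

variable {M : Type*} [TopologicalSpace M] [ChartedSpace E3 M] [IsManifold (𝓡 3) ∞ M]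
  {g : SmoothMetric M} {E : Fin 3 → TangentField M} {b : M → Fin 3 → E3} {D : TangentField M}

theorem hasVelocityWithinAt_chart_symm_comp {p : M} {y : ℝ → E3} {s : Set ℝ} {t : ℝ} {w v : E3}
    (hy : HasDerivWithinAt y w s t) (hyt : y t ∈ (extChartAt (𝓡 3) p).target)
    (hv : chartDeriv (extChartAt (𝓡 3) p) ((extChartAt (𝓡 3) p).symm (y t)) v = w) :
    HasVelocityWithinAt ((extChartAt (𝓡 3) p).symm ∘ y) s t v := by
  have h1 : MDifferentiableAt 𝓘(ℝ, E3) (𝓡 3) (extChartAt (𝓡 3) p).symm (y t) :=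
    (mdifferentiableOn_extChartAt_symm (y t) hyt).mdifferentiableAt
      ((isOpen_extChartAt_target p).mem_nhds hyt)
  have h2 := HasMFDerivAt.comp_hasMFDerivWithinAt t h1.hasMFDerivAt
    hy.hasFDerivWithinAt.hasMFDerivWithinAt
  set A : E3 →L[ℝ] E3 := mfderiv 𝓘(ℝ, E3) (𝓡 3) (extChartAt (𝓡 3) p).symm (y t) with hA
  have h3 : A w = v := by
    have h4 := mfderivWithin_extChartAt_symm_comp_mfderiv_extChartAt (I := 𝓡 3) (x := p) hyt
    have h5 : (range (𝓡 3) : Set E3) = univ := (𝓡 3).range_eq_univ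
    rw [h5, mfderivWithin_univ] at h4
    rw [← hv]
    exact congrArg (fun T : E3 →L[ℝ] E3 => T v) h4
  have e1 : A ∘L (ContinuousLinearMap.toSpanSingleton ℝ w)
      = ContinuousLinearMap.toSpanSingleton ℝ v := by
    ext1; simp [h3]
  unfold HasVelocityWithinAt
  rw [← e1]
  exact h2

/-- A vector field `X` in the chart at `p` which is tangent to `D` and normalised by `ℓ X = 1` on a
ball around `p`. -/
structure IsChartField (g : SmoothMetric M) (D : TangentField M) (p : M) (ℓ : E3 →L[ℝ] ℝ) (u : E3)
    (ε : ℝ) (X : E3 → E3) (L R : ℝ) : Prop where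
  uniformContinuous : UniformContinuous X
  norm_le : ∀ y, ‖X y‖ ≤ L
  radius_pos : 0 < R
  ball_subset : Metric.closedBall (extChartAt (𝓡 3) p p) R ⊆ (extChartAt (𝓡 3) p).target
  coord_eq_one : ∀ y ∈ Metric.closedBall (extChartAt (𝓡 3) p p) R, ℓ (X y) = 1
  near : ∀ y ∈ Metric.closedBall (extChartAt (𝓡 3) p p) R, ‖X y - u‖ ≤ ε
  tangent : ∀ y ∈ Metric.closedBall (extChartAt (𝓡 3) p p) R,
    ∃ v ∈ modelFiber D ((extChartAt (𝓡 3) p).symm y),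
      g.modelNorm ((extChartAt (𝓡 3) p).symm y) v ≤ 2 ∧
      chartDeriv (extChartAt (𝓡 3) p) ((extChartAt (𝓡 3) p).symm y) v = X y

theorem chartDeriv_extChartAt_self (p : M) :
    chartDeriv (extChartAt (𝓡 3) p) p = ContinuousLinearMap.id ℝ E3 :=
  mfderiv_extChartAt_self

/-- Dividing a local section by its coordinate `ℓ` fixes its sign and makes `ℓ` grow at unit speed
along solutions. A cutoff makes the field globally bounded and uniformly continuous, as Peano's
theorem requires. -/
theorem IsUnitFrame.exists_isChartField (hb : IsUnitFrame g E b)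
    (hE : ∀ i, IsContinuousLineBundle (E i)) (p : M) (i : Fin 3) {ε : ℝ} (hε : 0 < ε)
    {U : Set M} (hU : U ∈ 𝓝 p) :
    ∃ X L R, IsChartField g (E i) p (dualFunctional (b p) i) (b p i) ε X L R ∧
      (extChartAt (𝓡 3) p).symm '' Metric.closedBall (extChartAt (𝓡 3) p p) R ⊆ U := by
  set φ := extChartAt (𝓡 3) p with hφ
  set ℓ := dualFunctional (b p) i with hℓ
  have hsrc : IsOpen φ.source := isOpen_extChartAt_source p
  obtain ⟨v, hv⟩ := hb.exists_continuousAt_pushed hE hsrc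
    (h := φ) (by
      rw [hφ, extChartAt_source]
      exact contMDiffOn_extChartAt) (mem_extChartAt_source p)
  have hsymm : ContinuousAt φ.symm (φ p) := continuousAt_extChartAt_symm p
  have hφp : φ.symm (φ p) = p := φ.left_inv (mem_extChartAt_source p)
  set Z : E3 → E3 := fun y => v (φ.symm y) i with hZ
  have hvp := hv.self_of_nhds
  have hZp : Z (φ p) = b p i ∨ Z (φ p) = - b p i := by
    have := hvp.2 i
    rw [hφ, chartDeriv_extChartAt_self] at this
    simpa [hZ, hφp] using this
  have hℓb : ℓ (b p i) = 1 := by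
    rw [hℓ, dualFunctional_apply_self (hb.linearIndependent p), if_pos rfl]
  have hℓZ : |ℓ (Z (φ p))| = 1 := by
    rcases hZp with h | h <;> rw [h] <;> simp [hℓb]
  -- Invariant under `Z ↦ -Z`, hence equal to `b p i` at the center of the chart whichever sign `Z`
  -- has. The bound `|ℓ (Z y)| > 1 / 2` below gives the speed bound `2`.
  set Y : E3 → E3 := fun y => (ℓ (Z y))⁻¹ • Z y with hY
  have hYp : Y (φ p) = b p i := by
    rcases hZp with h | h <;> simp [hY, h, hℓb]
  have hev : ∀ᶠ y in 𝓝 (φ p), ContinuousAt Z y ∧ y ∈ φ.target ∧ φ.symm y ∈ U ∧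
      (Z y = chartDeriv φ (φ.symm y) (b (φ.symm y) i) ∨
        Z y = - chartDeriv φ (φ.symm y) (b (φ.symm y) i)) := by
    have h1 : ∀ᶠ q in 𝓝 (φ.symm (φ p)), (ContinuousAt v q ∧
        ∀ j, v q j = chartDeriv φ q (b q j) ∨ v q j = - chartDeriv φ q (b q j)) ∧ q ∈ U := by
      rw [hφp]; exact hv.and hU
    filter_upwards [hsymm.eventually h1, extChartAt_target_mem_nhds (I := 𝓡 3) p] with y hy hyt
    refine ⟨?_, hyt, hy.2, hy.1.2 i⟩
    have h2 : ContinuousAt φ.symm y := continuousAt_extChartAt_symm'' hyt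
    exact (continuous_apply i).continuousAt.comp
      (ContinuousAt.comp (g := v) (f := φ.symm) hy.1.1 h2)
  have hZc : ContinuousAt Z (φ p) := hev.self_of_nhds.1
  have hℓc : ContinuousAt (fun y => |ℓ (Z y)|) (φ p) :=
    (ℓ.continuous.continuousAt.comp hZc).abs
  have hℓ0 : ∀ᶠ y in 𝓝 (φ p), 1 / 2 < |ℓ (Z y)| :=
    hℓc.tendsto.eventually_const_lt (by rw [hℓZ]; norm_num)
  have hYc : ∀ y, ContinuousAt Z y → 1 / 2 < |ℓ (Z y)| → ContinuousAt Y y := by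
    intro y h1 h2
    have h3 : ℓ (Z y) ≠ 0 := by
      intro h0; rw [h0] at h2; norm_num at h2
    exact ((ℓ.continuous.continuousAt.comp h1).inv₀ h3).smul h1
  have hnear : ∀ᶠ y in 𝓝 (φ p), ‖Y y - b p i‖ < ε := by
    have h1 : ContinuousAt (fun y => ‖Y y - b p i‖) (φ p) :=
      ((hYc (φ p) hZc (by rw [hℓZ]; norm_num)).sub continuousAt_const).norm
    refine h1.tendsto.eventually_lt_const ?_
    rw [hYp, sub_self, norm_zero]
    exact hε
  obtain ⟨R₀, hR₀, hball⟩ := Metric.eventually_nhds_iff_ball.1 (hev.and (hℓ0.and hnear))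
  let χ : ContDiffBump (φ p) := ⟨R₀ / 3, R₀ / 2, by positivity, by linarith⟩
  set X : E3 → E3 := fun y => χ y • Y y with hX
  have hXc : Continuous X := by
    rw [continuous_iff_continuousAt]
    intro y
    by_cases hy : y ∈ Metric.closedBall (φ p) (R₀ / 2)
    · have h1 := hball y (Metric.closedBall_subset_ball (by linarith) hy)
      exact χ.continuous.continuousAt.smul (hYc y h1.1.1 h1.2.1)
    · have h1 : X =ᶠ[𝓝 y] fun _ => 0 := by
        filter_upwards [Metric.isClosed_closedBall.isOpen_compl.mem_nhds hy] with z hz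
        have : χ z = 0 := χ.zero_of_le_dist (by
          simp only [mem_compl_iff, Metric.mem_closedBall, not_le] at hz
          exact hz.le)
        simp [hX, this]
      exact continuousAt_const.congr h1.symm
  have hXs : HasCompactSupport X := χ.hasCompactSupport.smul_right
  obtain ⟨L, hL⟩ := hXs.exists_bound_of_continuous hXc
  have hX1 : ∀ y ∈ Metric.closedBall (φ p) (R₀ / 3), X y = Y y := by
    intro y hy
    simp [hX, χ.one_of_mem_closedBall hy]
  have hb3 : ∀ y ∈ Metric.closedBall (φ p) (R₀ / 3), y ∈ Metric.ball (φ p) R₀ := fun y hy =>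
    Metric.closedBall_subset_ball (by linarith) hy
  refine ⟨X, L, R₀ / 3, ⟨hXs.uniformContinuous_of_continuous hXc, hL, by positivity,
    fun y hy => (hball y (hb3 y hy)).1.2.1, fun y hy => ?_, fun y hy => ?_, fun y hy => ?_⟩, ?_⟩
  · rw [hX1 y hy]
    have h2 := (hball y (hb3 y hy)).2.1
    have h3 : ℓ (Z y) ≠ 0 := by
      intro h0; rw [h0] at h2; norm_num at h2
    simp [hY, h3]
  · rw [hX1 y hy]; exact (hball y (hb3 y hy)).2.2.le
  · rw [hX1 y hy]
    have h1 := hball y (hb3 y hy)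
    have h2 := h1.2.1
    have h4 : |(ℓ (Z y))⁻¹| ≤ 2 := by
      rw [abs_inv]
      exact inv_le_of_inv_le₀ (by norm_num) (by linarith)
    rcases h1.1.2.2.2 with h | h
    · refine ⟨(ℓ (Z y))⁻¹ • b (φ.symm y) i, Submodule.smul_mem _ _ (hb.mem _ _), ?_, ?_⟩
      · rw [g.modelNorm_smul, hb.norm_eq, mul_one]; exact h4
      · rw [map_smul, ← h]
    · refine ⟨(-(ℓ (Z y))⁻¹) • b (φ.symm y) i, Submodule.smul_mem _ _ (hb.mem _ _), ?_, ?_⟩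
      · rw [g.modelNorm_smul, hb.norm_eq, mul_one, abs_neg]; exact h4
      · rw [map_smul, neg_smul, ← smul_neg, ← h]
  · rintro _ ⟨y, hy, rfl⟩
    exact (hball y (hb3 y hy)).1.2.2.1

variable {p : M} {ℓ : E3 →L[ℝ] ℝ} {u : E3} {ε : ℝ} {X : E3 → E3} {L R : ℝ}

theorem IsChartField.coord_solution (hX : IsChartField g D p ℓ u ε X L R) {y : ℝ → E3}
    (hy : ∀ t, HasDerivAt y (X (y t)) t) {s : Set ℝ} (hs : Convex ℝ s) (h0 : (0 : ℝ) ∈ s)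
    (hin : ∀ t ∈ s, y t ∈ Metric.closedBall (extChartAt (𝓡 3) p p) R) {τ : ℝ} (hτ : τ ∈ s) :
    ℓ (y τ) = ℓ (y 0) + τ ∧ ‖y τ - y 0 - τ • u‖ ≤ ε * |τ| := by
  constructor
  · have := Convex.norm_image_sub_le_of_norm_hasDerivWithin_le (s := s)
      (f := fun t => ℓ (y t) - t) (f' := fun t => ℓ (X (y t)) - 1) (C := 0) (x := 0) (y := τ)
      (fun t _ => ((ℓ.hasFDerivAt.comp_hasDerivAt t (hy t)).sub (hasDerivAt_id t)).hasDerivWithinAt)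
      (fun t ht => by simp [hX.coord_eq_one _ (hin t ht)]) hs h0 hτ
    rw [zero_mul, norm_le_zero_iff] at this
    linarith
  · have := Convex.norm_image_sub_le_of_norm_hasDerivWithin_le (s := s)
      (f := fun t => y t - t • u) (f' := fun t => X (y t) - (1 : ℝ) • u) (C := ε) (x := 0) (y := τ)
      (fun t _ => ((hy t).sub ((hasDerivAt_id t).smul_const u)).hasDerivWithinAt)
      (fun t ht => by rw [one_smul]; exact hX.near _ (hin t ht)) hs h0 hτ
    simp only [zero_smul, sub_zero, Real.norm_eq_abs] at this
    rwa [sub_right_comm] at this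

/-- Rescaled pieces of solutions of a chart field are slow arcs tangent to `D`. -/
theorem IsChartField.isSlowArc (hX : IsChartField g D p ℓ u ε X L R) {y : ℝ → E3}
    (hy : ∀ t, HasDerivAt y (X (y t)) t) {τ l : ℝ} (hl : 2 * |τ| ≤ l)
    (hin : ∀ θ ∈ Icc (0 : ℝ) 1, y (θ * τ) ∈ Metric.closedBall (extChartAt (𝓡 3) p p) R) :
    IsSlowArc g D (fun θ => (extChartAt (𝓡 3) p).symm (y (θ * τ))) l := by
  intro θ hθ
  obtain ⟨v, hv, hvn, hvX⟩ := hX.tangent _ (hin θ hθ)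
  refine ⟨τ • v, Submodule.smul_mem _ _ hv, ?_, ?_⟩
  · rw [g.modelNorm_smul]
    nlinarith [abs_nonneg τ]
  · have h1 : HasDerivWithinAt (fun θ : ℝ => y (θ * τ)) (τ • X (y (θ * τ))) (Icc 0 1) θ := by
      have h2 : HasDerivAt (fun θ : ℝ => θ * τ) τ θ := by simpa using (hasDerivAt_id θ).mul_const τ
      exact ((hy (θ * τ)).scomp θ h2).hasDerivWithinAt
    exact hasVelocityWithinAt_chart_symm_comp h1 (hX.ball_subset (hin θ hθ)) (by rw [map_smul, hvX])

theorem isTangentArc_of_hasVelocityWithinAt {c : ℝ → M} {a b : ℝ} (hab : a < b)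
    (hc : ContMDiffOn 𝓘(ℝ, ℝ) (𝓡 3) 1 c (Icc a b))
    (hv : ∀ t ∈ Icc a b, ∃ v ∈ modelFiber D (c t), HasVelocityWithinAt c (Icc a b) t v) :
    IsTangentArc D c a b := by
  refine ⟨hc, fun t ht => ?_⟩
  obtain ⟨v, hvD, hd⟩ := hv t ht
  have h1 : mfderivWithin 𝓘(ℝ, ℝ) (𝓡 3) c (Icc a b) t
      = (ContinuousLinearMap.toSpanSingleton ℝ v : ℝ →L[ℝ] E3) :=
    hd.mfderivWithin ((uniqueDiffOn_Icc hab).uniqueMDiffOn t ht)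
  have h2 : (mfderivWithin 𝓘(ℝ, ℝ) (𝓡 3) c (Icc a b) t (1 : ℝ) : E3) = v := by
    rw [h1]
    exact ContinuousLinearMap.toSpanSingleton_apply_one ℝ v
  have h3 : (mfderivWithin 𝓘(ℝ, ℝ) (𝓡 3) c (Icc a b) t (1 : ℝ) : E3) ∈ modelFiber D (c t) := by
    rw [h2]; exact hvD
  exact h3

theorem IsChartField.contMDiffOn (hX : IsChartField g D p ℓ u ε X L R) {y : ℝ → E3}
    (hy : ∀ t, HasDerivAt y (X (y t)) t) {τ : ℝ} {s : Set ℝ}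
    (hin : ∀ θ ∈ s, y (θ * τ) ∈ Metric.closedBall (extChartAt (𝓡 3) p p) R) :
    ContMDiffOn 𝓘(ℝ, ℝ) (𝓡 3) 1 (fun θ => (extChartAt (𝓡 3) p).symm (y (θ * τ))) s := by
  have h1 : ContDiff ℝ 1 y := by
    rw [contDiff_one_iff_deriv]
    refine ⟨fun t => (hy t).differentiableAt, ?_⟩
    have : deriv y = fun t => X (y t) := funext fun t => (hy t).deriv
    rw [this]
    exact hX.uniformContinuous.continuous.comp
      (continuous_iff_continuousAt.2 fun t => (hy t).continuousAt)
  have h2 : ContDiff ℝ 1 (fun θ : ℝ => y (θ * τ)) := h1.comp (contDiff_id.mul contDiff_const)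
  have h3 : ContMDiffOn 𝓘(ℝ, E3) (𝓡 3) 1 (extChartAt (𝓡 3) p).symm (extChartAt (𝓡 3) p).target :=
    contMDiffOn_extChartAt_symm p
  exact h3.comp h2.contMDiff.contMDiffOn fun θ hθ => hX.ball_subset (hin θ hθ)

/-- Two points are joined by a single arc tangent to `D`. -/
def JoinedByArc (D : TangentField M) (x y : M) : Prop :=
  ∃ c : ℝ → M, IsTangentArc D c 0 1 ∧ c 0 = x ∧ c 1 = y

end ChartField

/-! ### Continuous local flows along the contracted line field -/

section Flow

variable {M : Type*} [TopologicalSpace M] [ChartedSpace E3 M] [IsManifold (𝓡 3) ∞ M]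
  {g : SmoothMetric M} {E : Fin 3 → TangentField M} {b : M → Fin 3 → E3} {f : M → M} {k : Fin 3}

/-- A local flow `Φ` along the line field `D` near `p`, parametrised by the coordinate `ℓ` in the
chart at `p`, whose orbits contain all slow arcs tangent to `D`. -/
structure IsLocalFlow (g : SmoothMetric M) (D : TangentField M) (p : M) (ℓ : E3 →L[ℝ] ℝ) (u : E3)
    (ε l : ℝ) (U : Set M) (T : ℝ) (Φ : ℝ → M → M) : Prop where
  isOpen : IsOpen U
  mem : p ∈ U
  time_pos : 0 < T
  subset_source : U ⊆ (extChartAt (𝓡 3) p).source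
  mem_source : ∀ q ∈ U, ∀ τ ∈ Icc (-T) T, Φ τ q ∈ (extChartAt (𝓡 3) p).source
  joined : ∀ q ∈ U, ∀ τ ∈ Icc (-T) T, JoinedByArc D q (Φ τ q)
  continuousOn : ContinuousOn (fun z : ℝ × M => Φ z.1 z.2) (Icc (-T) T ×ˢ U)
  coord : ∀ q ∈ U, ∀ τ ∈ Icc (-T) T,
    ℓ (extChartAt (𝓡 3) p (Φ τ q)) = ℓ (extChartAt (𝓡 3) p q) + τ
  displacement : ∀ q ∈ U, ∀ τ ∈ Icc (-T) T,
    ‖extChartAt (𝓡 3) p (Φ τ q) - extChartAt (𝓡 3) p q - τ • u‖ ≤ ε * |τ|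
  slowArc : ∀ c : ℝ → M, IsSlowArc g D c l → c 0 ∈ U → c 1 ∈ U →
    ∃ τ ∈ Icc (-T) T, Φ τ (c 0) = c 1

/-- Orbits are Peano solutions of a chart field. At time `τ` every solution from a given point has
the same coordinate, so the key lemma makes solutions unique, hence continuous in the starting
point. Comparison of a slow arc with the orbit segment reaching the same coordinate shows that their
endpoints agree. -/
theorem exists_isLocalFlow [CompactSpace M] [T2Space M]
    (hb : IsUnitFrame g E b) (hE : ∀ i, IsContinuousLineBundle (E i))
    (hf : ContractsDominated g E b f k) :
    ∃ l > 0, ∀ p : M, ∀ ε > 0, ∃ U T Φ,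
      IsLocalFlow g (E k) p (dualFunctional (b p) k) (b p k) ε l U T Φ := by
  obtain ⟨l, hl, hend⟩ := exists_endpoint_eq_of_coord_eq hb hE hf
  refine ⟨l, hl, fun p ε hε => ?_⟩
  obtain ⟨U₀, hU₀, huniq⟩ := hend p
  obtain ⟨X, L, R, hX, hXU⟩ := hb.exists_isChartField hE p k hε hU₀
  set φ := extChartAt (𝓡 3) p with hφ
  set ℓ := dualFunctional (b p) k with hℓ
  choose Y hY0 hY using exists_solution hX.uniformContinuous hX.norm_le
  have hL0 : 0 ≤ L := (norm_nonneg _).trans (hX.norm_le 0)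
  have hR := hX.radius_pos
  -- The first bound makes orbit pieces slow, as a chart field has speed at most `2`; the second
  -- keeps them in the ball where the field is tangent.
  set T := min (l / 2) (R / (2 * (L + 1))) with hT
  have hTpos : 0 < T := by positivity
  have hTl : T ≤ l / 2 := min_le_left _ _
  have hLT : L * T ≤ R / 2 := by
    calc L * T ≤ (L + 1) * (R / (2 * (L + 1))) := by
          gcongr
          · linarith
          · exact min_le_right _ _
      _ = R / 2 := by field_simp
  -- The second bound makes the coordinates of any two points of `U` differ by at most `T`, so the
  -- flow time from one to the other is admissible.
  set δ := min (R / 2) (T / (2 * (‖ℓ‖ + 1))) with hδ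
  have hδpos : 0 < δ := by positivity
  have hδR : δ ≤ R / 2 := min_le_left _ _
  have hδT : ‖ℓ‖ * (2 * δ) ≤ T := by
    calc ‖ℓ‖ * (2 * δ) ≤ (‖ℓ‖ + 1) * (2 * (T / (2 * (‖ℓ‖ + 1)))) := by
          gcongr
          · linarith
          · exact min_le_right _ _
      _ = T := by field_simp
  have hin : ∀ y : ℝ → E3, (∀ t, HasDerivAt y (X (y t)) t) → y 0 ∈ Metric.ball (φ p) δ →
      ∀ τ ∈ Icc (-T) T, y τ ∈ Metric.closedBall (φ p) R := by
    intro y hy h0 τ hτ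
    rw [mem_closedBall_iff_norm]
    rw [mem_ball_iff_norm] at h0
    have h1 := norm_sub_le_of_hasDerivAt_bounded hX.norm_le hy 0 τ
    rw [sub_zero] at h1
    have h2 : L * |τ| ≤ L * T := by gcongr; exact abs_le.2 hτ
    calc ‖y τ - φ p‖ = ‖(y τ - y 0) + (y 0 - φ p)‖ := by congr 1; abel
      _ ≤ R / 2 + R / 2 := norm_add_le_of_le (by linarith) (by linarith)
      _ = R := by ring
  have hseg : ∀ τ ∈ Icc (-T) T, ∀ θ ∈ Icc (0 : ℝ) 1, θ * τ ∈ Icc (-T) T := by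
    intro τ hτ θ hθ
    rw [mem_Icc, ← abs_le] at hτ ⊢
    rw [abs_mul, abs_of_nonneg hθ.1]
    nlinarith [hθ.2, abs_nonneg τ, hθ.1]
  have hcs : ∀ y : ℝ → E3, (∀ t, HasDerivAt y (X (y t)) t) → y 0 ∈ Metric.ball (φ p) δ →
      ∀ τ ∈ Icc (-T) T, ℓ (y τ) = ℓ (y 0) + τ ∧ ‖y τ - y 0 - τ • b p k‖ ≤ ε * |τ| :=
    fun y hy h0 τ hτ => hX.coord_solution hy (convex_Icc (-T) T)
      ⟨by linarith, hTpos.le⟩ (hin y hy h0) hτ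
  have hslow : ∀ y : ℝ → E3, (∀ t, HasDerivAt y (X (y t)) t) → y 0 ∈ Metric.ball (φ p) δ →
      ∀ τ ∈ Icc (-T) T, IsSlowArc g (E k) (fun θ => φ.symm (y (θ * τ))) l :=
    fun y hy h0 τ hτ => hX.isSlowArc hy (by linarith [abs_le.2 hτ])
      fun θ hθ => hin y hy h0 _ (hseg τ hτ θ hθ)
  have hright : ∀ y ∈ Metric.closedBall (φ p) R, φ (φ.symm y) = y := fun y hy =>
    φ.right_inv (hX.ball_subset hy)
  have hunique : ∀ x ∈ Metric.ball (φ p) δ, ∀ τ ∈ Icc (-T) T, ∀ y : ℝ → E3, y 0 = x →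
      (∀ t, HasDerivAt y (X (y t)) t) → y τ = Y x τ := by
    intro x hx τ hτ y h0 hy
    have hx1 : y 0 ∈ Metric.ball (φ p) δ := by rwa [h0]
    have hx2 : Y x 0 ∈ Metric.ball (φ p) δ := by rwa [hY0]
    have i1 := hin y hy hx1 τ hτ
    have i2 := hin (Y x) (hY x) hx2 τ hτ
    have h1 := huniq _ _ (hslow y hy hx1 τ hτ) (hslow (Y x) (hY x) hx2 τ hτ)
      (by simp [h0, hY0]) (by simpa using hXU (mem_image_of_mem _ i1))
      (by simpa using hXU (mem_image_of_mem _ i2)) (by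
        simp only [one_mul]
        rw [hright _ i1, hright _ i2, (hcs y hy hx1 τ hτ).1, (hcs (Y x) (hY x) hx2 τ hτ).1,
          h0, hY0])
    simp only [one_mul] at h1
    rw [← hright _ i1, h1, hright _ i2]
  set U : Set M := φ.source ∩ φ ⁻¹' Metric.ball (φ p) δ with hU
  have hq0 : ∀ q ∈ U, Y (φ q) 0 ∈ Metric.ball (φ p) δ := fun q hq => by rw [hY0]; exact hq.2
  have hqin : ∀ q ∈ U, ∀ τ ∈ Icc (-T) T, Y (φ q) τ ∈ Metric.closedBall (φ p) R := fun q hq =>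
    hin _ (hY _) (hq0 q hq)
  have harc : ∀ q ∈ U, ∀ τ ∈ Icc (-T) T,
      IsTangentArc (E k) (fun θ => φ.symm (Y (φ q) (θ * τ))) 0 1 := fun q hq τ hτ =>
    isTangentArc_of_hasVelocityWithinAt zero_lt_one
      (hX.contMDiffOn (hY _) fun θ hθ => hqin q hq _ (hseg τ hτ θ hθ)) fun θ hθ => by
        obtain ⟨v, hv, -, hd⟩ := hslow _ (hY _) (hq0 q hq) τ hτ θ hθ
        exact ⟨v, hv, hd⟩
  have hleft : ∀ q ∈ U, φ.symm (Y (φ q) 0) = q := fun q hq => by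
    rw [hY0]; exact φ.left_inv hq.1
  refine ⟨U, T, fun τ q => φ.symm (Y (φ q) τ), ?_⟩
  refine
    { isOpen := ?_
      mem := ⟨mem_extChartAt_source p, Metric.mem_ball_self hδpos⟩
      time_pos := hTpos
      subset_source := inter_subset_left
      mem_source := fun q hq τ hτ => φ.map_target (hX.ball_subset (hqin q hq τ hτ))
      joined := fun q hq τ hτ => ⟨_, harc q hq τ hτ, by simp [hleft q hq], by simp⟩
      continuousOn := ?_
      coord := fun q hq τ hτ => ?_
      displacement := fun q hq τ hτ => ?_
      slowArc := fun c hc h0 h1 => ?_ }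
  · exact (continuousOn_extChartAt p).isOpen_inter_preimage (isOpen_extChartAt_source p)
      Metric.isOpen_ball
  · rintro ⟨τ, q⟩ ⟨hτ, hq⟩
    have h1 : ContinuousAt (fun z : E3 × ℝ => Y z.1 z.2) (φ q, τ) :=
      tendsto_solution_of_unique hX.uniformContinuous hX.norm_le hY0 hY
        fun y h0 hy => hunique (φ q) hq.2 τ hτ y h0 hy
    have h2 : ContinuousAt (fun z : ℝ × M => (φ z.2, z.1)) (τ, q) := by
      refine ContinuousAt.prodMk ?_ continuousAt_fst
      exact ContinuousAt.comp (g := φ) (f := Prod.snd) (x := (τ, q))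
        (continuousAt_extChartAt' hq.1) continuousAt_snd
    have h3 : ContinuousAt φ.symm (Y (φ q) τ) :=
      continuousAt_extChartAt_symm'' (hX.ball_subset (hqin q hq τ hτ))
    have h4 : ContinuousAt (fun z : ℝ × M => Y (φ z.2) z.1) (τ, q) :=
      ContinuousAt.comp (g := fun z : E3 × ℝ => Y z.1 z.2)
        (f := fun z : ℝ × M => (φ z.2, z.1)) h1 h2
    exact (ContinuousAt.comp (g := φ.symm) (f := fun z : ℝ × M => Y (φ z.2) z.1) h3
      h4).continuousWithinAt
  · rw [hright _ (hqin q hq τ hτ), (hcs _ (hY _) (hq0 q hq) τ hτ).1, hY0]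
  · have := (hcs _ (hY _) (hq0 q hq) τ hτ).2
    rw [hright _ (hqin q hq τ hτ)]
    rwa [hY0] at this
  · set τ := ℓ (φ (c 1)) - ℓ (φ (c 0)) with hτ
    have hτT : τ ∈ Icc (-T) T := by
      rw [mem_Icc, ← abs_le, hτ, ← map_sub, ← Real.norm_eq_abs]
      refine (ℓ.le_opNorm _).trans (le_trans ?_ hδT)
      gcongr
      have a1 := h0.2
      have a2 := h1.2
      simp only [mem_preimage, mem_ball_iff_norm] at a1 a2
      calc ‖φ (c 1) - φ (c 0)‖ = ‖(φ (c 1) - φ p) - (φ (c 0) - φ p)‖ := by congr 1; abel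
        _ ≤ δ + δ := norm_sub_le_of_le a2.le a1.le
        _ = 2 * δ := by ring
    refine ⟨τ, hτT, ?_⟩
    have i2 := hqin (c 0) h0 τ hτT
    have hc1U : c 1 ∈ U₀ := by
      have := hXU (mem_image_of_mem φ.symm
        (Metric.ball_subset_closedBall (Metric.ball_subset_ball (by linarith) h1.2)))
      rwa [φ.left_inv h1.1] at this
    have := huniq _ c (hslow _ (hY _) (hq0 _ h0) τ hτT) hc (by simp [hleft _ h0])
      (by simpa using hXU (mem_image_of_mem _ i2)) hc1U (by
        simp only [one_mul]
        rw [hright _ i2, (hcs _ (hY _) (hq0 _ h0) τ hτT).1, hY0, hτ]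
        ring)
    simpa using this

end Flow

/-! ### Tangent arcs and accessibility classes as chains of arcs -/

section Arcs

variable {M : Type*} [TopologicalSpace M] [ChartedSpace E3 M] [IsManifold (𝓡 3) ∞ M]
  {D Es Eu : TangentField M}

theorem hasVelocityWithinAt_of_hasMFDerivWithinAt {c : ℝ → M} {s : Set ℝ} {t : ℝ} {A : ℝ →L[ℝ] E3}
    (h : HasMFDerivWithinAt 𝓘(ℝ, ℝ) (𝓡 3) c s t A) : HasVelocityWithinAt c s t (A 1) := by
  have h2 : ContinuousLinearMap.toSpanSingleton ℝ (A 1) = A := by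
    ext1; simp
  unfold HasVelocityWithinAt
  rw [h2]
  exact h

theorem IsTangentArc.exists_hasVelocityWithinAt {c : ℝ → M} {a b : ℝ} (hc : IsTangentArc D c a b)
    {t : ℝ} (ht : t ∈ Icc a b) :
    ∃ v ∈ modelFiber D (c t), v = mfderivWithin 𝓘(ℝ, ℝ) (𝓡 3) c (Icc a b) t (1 : ℝ) ∧
      HasVelocityWithinAt c (Icc a b) t v := by
  refine ⟨mfderivWithin 𝓘(ℝ, ℝ) (𝓡 3) c (Icc a b) t (1 : ℝ), hc.2 t ht, rfl, ?_⟩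
  exact hasVelocityWithinAt_of_hasMFDerivWithinAt
    (hc.1.mdifferentiableOn one_ne_zero t ht).hasMFDerivWithinAt

/-- The slope may be negative or zero, so reversal and restriction are both covered. Agreement is
required only on the interval, as concatenation needs. -/
theorem IsTangentArc.comp_affine {c c' : ℝ → M} {a b a' b' : ℝ} (hc : IsTangentArc D c a b)
    (hab : a' < b') (α β : ℝ) (hm : MapsTo (fun s => α * s + β) (Icc a' b') (Icc a b))
    (heq : ∀ s ∈ Icc a' b', c' s = c (α * s + β)) : IsTangentArc D c' a' b' := by
  have hσ : ContDiff ℝ 1 (fun s : ℝ => α * s + β) := (contDiff_const.mul contDiff_id).add contDiff_const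
  refine isTangentArc_of_hasVelocityWithinAt hab
    ((hc.1.comp hσ.contMDiff.contMDiffOn hm).congr fun s hs => heq s hs) fun s hs => ?_
  obtain ⟨v, hv, -, hd⟩ := hc.exists_hasVelocityWithinAt (hm hs)
  refine ⟨α • v, ?_, ?_⟩
  · rw [heq s hs]; exact Submodule.smul_mem _ _ hv
  · have h1 : HasDerivWithinAt (fun s : ℝ => α * s + β) α (Icc a' b') s := by
      simpa using (((hasDerivAt_id s).const_mul α).add_const β).hasDerivWithinAt
    have h2 := HasVelocityWithinAt.comp_real (σ := fun s => α * s + β) hd h1 hm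
    have h3 := HasMFDerivWithinAt.congr_mono h2 (fun s hs => heq s hs) (heq s hs) Subset.rfl
    exact h3

theorem IsTangentArc.joinedByArc {c : ℝ → M} {a b : ℝ} (hc : IsTangentArc D c a b) {s t : ℝ}
    (hs : s ∈ Icc a b) (ht : t ∈ Icc a b) : JoinedByArc D (c s) (c t) := by
  refine ⟨fun θ => c ((t - s) * θ + s), hc.comp_affine zero_lt_one (t - s) s (fun θ hθ => ?_)
    (fun θ _ => rfl), by simp, by simp⟩
  have := (convex_Icc a b).add_smul_sub_mem hs ht hθ
  rw [smul_eq_mul] at this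
  rwa [add_comm, mul_comm] at this

theorem JoinedByArc.symm {x y : M} (h : JoinedByArc D x y) : JoinedByArc D y x := by
  obtain ⟨c, hc, rfl, rfl⟩ := h
  exact hc.joinedByArc (by simp) (by simp)

/-- Two points are joined by a single arc tangent to `Es` or to `Eu`. -/
def SuStep (Es Eu : TangentField M) (x y : M) : Prop := JoinedByArc Es x y ∨ JoinedByArc Eu x y

theorem SuStep.symm {x y : M} (h : SuStep Es Eu x y) : SuStep Es Eu y x :=
  h.imp JoinedByArc.symm JoinedByArc.symm

theorem isTangentArc_const (x : M) {a b : ℝ} (hab : a < b) : IsTangentArc D (fun _ => x) a b := by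
  refine isTangentArc_of_hasVelocityWithinAt hab contMDiffOn_const fun t _ =>
    ⟨0, Submodule.zero_mem _, ?_⟩
  unfold HasVelocityWithinAt
  rw [ContinuousLinearMap.toSpanSingleton_zero]
  exact hasMFDerivWithinAt_const x _ t

theorem accessibilityClass_step {x y z : M} (hy : y ∈ accessibilityClass Es Eu x)
    (hyz : SuStep Es Eu y z) : z ∈ accessibilityClass Es Eu x := by
  obtain ⟨c, ⟨N, t, ht0, htN, ht⟩, hc0, hc1⟩ := hy
  obtain ⟨d, hd, hd0, hd1⟩ : ∃ d : ℝ → M, (IsTangentArc Es d 0 1 ∨ IsTangentArc Eu d 0 1) ∧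
      d 0 = y ∧ d 1 = z := by
    rcases hyz with ⟨d, hd, h0, h1⟩ | ⟨d, hd, h0, h1⟩
    exacts [⟨d, Or.inl hd, h0, h1⟩, ⟨d, Or.inr hd, h0, h1⟩]
  have htle : ∀ i ≤ N, t i ≤ 1 := by
    intro i hi
    induction hi using Nat.decreasingInduction with
    | self => exact htN.le
    | of_succ j hj ih => exact (ht j hj).1.le.trans ih
  set c' : ℝ → M := fun s => if s ≤ 1 / 2 then c (2 * s + 0) else d (2 * s + (-1)) with hc'
  have e1 : ∀ s ≤ (1 / 2 : ℝ), c' s = c (2 * s + 0) := fun s hs => if_pos hs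
  have e2 : ∀ s, (1 / 2 : ℝ) ≤ s → c' s = d (2 * s + (-1)) := by
    intro s hs
    rcases hs.eq_or_lt with h | h
    · rw [e1 s h.ge, ← h]
      norm_num [hc1, hd0]
    · exact if_neg (not_le.2 h)
  -- The old path is run at double speed on `[0, 1/2]`, so its subdivision points are halved and
  -- index `N` sits at `1/2`; the new arc occupies the last interval.
  refine ⟨c', ⟨N + 1, fun i => if i ≤ N then t i / 2 else 1, by simp [ht0], by simp, ?_⟩, ?_, ?_⟩
  · intro i hi
    rcases (Nat.lt_succ_iff.1 hi).lt_or_eq with h | rfl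
    · simp only [h.le, if_true, Nat.succ_le_iff.2 h]
      have h1 := ht i h
      have hlt : t i / 2 < t (i + 1) / 2 := by linarith [h1.1]
      have hmaps : MapsTo (fun s : ℝ => 2 * s + 0) (Icc (t i / 2) (t (i + 1) / 2))
          (Icc (t i) (t (i + 1))) := fun s hs =>
        ⟨by linarith [hs.1], by linarith [hs.2]⟩
      have heq : ∀ s ∈ Icc (t i / 2) (t (i + 1) / 2), c' s = c (2 * s + 0) := fun s hs =>
        e1 s (by linarith [hs.2, htle (i + 1) h])
      exact ⟨hlt, h1.2.imp (fun h => h.comp_affine hlt 2 0 hmaps heq)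
        (fun h => h.comp_affine hlt 2 0 hmaps heq)⟩
    · simp only [le_refl, if_true, htN, Nat.succ_le_iff, lt_self_iff_false, if_false]
      have hlt : (1 : ℝ) / 2 < 1 := by norm_num
      have hmaps : MapsTo (fun s : ℝ => 2 * s + (-1)) (Icc (1 / 2) 1) (Icc 0 1) := fun s hs =>
        ⟨by linarith [hs.1], by linarith [hs.2]⟩
      have heq : ∀ s ∈ Icc (1 / 2 : ℝ) 1, c' s = d (2 * s + (-1)) := fun s hs => e2 s hs.1
      exact ⟨hlt, hd.imp (fun h => h.comp_affine hlt 2 (-1) hmaps heq)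
        (fun h => h.comp_affine hlt 2 (-1) hmaps heq)⟩
  · rw [e1 0 (by norm_num)]; simpa using hc0
  · rw [e2 1 (by norm_num)]; norm_num [hd1]

theorem mem_accessibilityClass_self (x : M) : x ∈ accessibilityClass Es Eu x := by
  refine ⟨fun _ => x, ⟨1, fun i => i, by simp, by simp, fun i hi => ?_⟩, rfl, rfl⟩
  have : (i : ℝ) < ((i + 1 : ℕ) : ℝ) := by push_cast; linarith
  exact ⟨this, Or.inl (isTangentArc_const x this)⟩

/-- Replaces paths and subdivisions by a chain of a symmetric relation, on which saturation
arguments proceed by induction. -/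
theorem mem_accessibilityClass_iff {x y : M} :
    y ∈ accessibilityClass Es Eu x ↔ Relation.ReflTransGen (SuStep Es Eu) x y := by
  constructor
  · rintro ⟨c, ⟨N, t, ht0, htN, ht⟩, rfl, rfl⟩
    have : ∀ i ≤ N, Relation.ReflTransGen (SuStep Es Eu) (c 0) (c (t i)) := by
      intro i
      induction i with
      | zero => intro _; rw [ht0]
      | succ i ih =>
        intro hi
        have h1 := ht i (Nat.lt_of_succ_le hi)
        refine (ih (Nat.le_of_succ_le hi)).tail ?_
        exact h1.2.imp
          (fun h => h.joinedByArc (left_mem_Icc.2 h1.1.le) (right_mem_Icc.2 h1.1.le))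
          (fun h => h.joinedByArc (left_mem_Icc.2 h1.1.le) (right_mem_Icc.2 h1.1.le))
    simpa [htN] using this N le_rfl
  · intro h
    induction h with
    | refl => exact mem_accessibilityClass_self x
    | tail _ hyz ih => exact accessibilityClass_step ih hyz

end Arcs

/-! ### Propagation of interior points along tangent arcs -/

section Interior

variable {M : Type*} [TopologicalSpace M] [ChartedSpace E3 M] [IsManifold (𝓡 3) ∞ M]
  {g : SmoothMetric M} {D : TangentField M}

theorem IsTangentArc.exists_speed_le (g : SmoothMetric M) {c : ℝ → M}
    (hc : IsTangentArc D c 0 1) :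
    ∃ K > 0, ∀ t ∈ Icc (0 : ℝ) 1, ∃ v ∈ modelFiber D (c t), g.modelNorm (c t) v ≤ K ∧
      HasVelocityWithinAt c (Icc 0 1) t v := by
  have h1 := hc.1.continuousOn_tangentMapWithin le_rfl (uniqueDiffOn_Icc zero_lt_one).uniqueMDiffOn
  have h2 : Continuous (fun t : ℝ => (⟨t, (1 : ℝ)⟩ : TangentBundle 𝓘(ℝ, ℝ) ℝ)) :=
    (tangentBundleModelSpaceHomeomorph 𝓘(ℝ, ℝ)).symm.continuous.comp
      (continuous_id.prodMk continuous_const)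
  have h3 : ContinuousOn (fun t : ℝ => g.tnorm (c t)
      (mfderivWithin 𝓘(ℝ, ℝ) (𝓡 3) c (Icc 0 1) t (1 : ℝ))) (Icc 0 1) :=
    g.continuous_tnorm.comp_continuousOn (h1.comp h2.continuousOn fun t ht => ht)
  obtain ⟨K, hK⟩ := isCompact_Icc.exists_bound_of_continuousOn h3
  refine ⟨|K| + 1, by positivity, fun t ht => ?_⟩
  obtain ⟨v, hv, hve, hd⟩ := hc.exists_hasVelocityWithinAt ht
  refine ⟨v, hv, ?_, hd⟩
  have := (le_abs_self _).trans (hK t ht)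
  rw [hve]
  change g.tnorm (c t) (mfderivWithin 𝓘(ℝ, ℝ) (𝓡 3) c (Icc 0 1) t (1 : ℝ)) ≤ |K| + 1
  linarith [le_abs_self K]

/-- The interior of a saturated set is saturated. -/
theorem mem_interior_of_joinedByArc {ℓ : M → E3 →L[ℝ] ℝ} {u : M → E3} {ε l : ℝ} (hl : 0 < l)
    (hflow : ∀ p, ∃ U T Φ, IsLocalFlow g D p (ℓ p) (u p) ε l U T Φ) {A : Set M}
    (hA : ∀ x ∈ A, ∀ y, JoinedByArc D x y → y ∈ A) {x y : M} (hxy : JoinedByArc D x y)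
    (hx : x ∈ interior A) : y ∈ interior A := by
  obtain ⟨c, hc, rfl, rfl⟩ := hxy
  obtain ⟨K, hK0, hK⟩ := hc.exists_speed_le g
  -- By connectedness of the parameter interval it suffices to propagate locally, in both
  -- directions, between `t₀` and nearby parameters.
  refine isPreconnected_Icc.induction₂' (s := Icc (0 : ℝ) 1)
    (fun s t => c s ∈ interior A → c t ∈ interior A) (fun t₀ ht₀ => ?_)
    (fun r s t _ _ _ h1 h2 h => h2 (h1 h)) (by simp) (by simp) hx
  obtain ⟨U, T, Φ, hΦ⟩ := hflow (c t₀)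
  -- The piece of `c` from `t` to `s` is a slow arc, so `c s = Φ τ (c t)` for some `τ`. Points near
  -- `c t` are carried by the continuous map `Φ τ` into the interior of `A`, and the reversed orbits
  -- bring membership in `A` back to them.
  have key : ∀ s ∈ Icc (0 : ℝ) 1, ∀ t ∈ Icc (0 : ℝ) 1, c s ∈ U → c t ∈ U → |s - t| * K ≤ l →
      c s ∈ interior A → c t ∈ interior A := by
    intro s hs t ht hsU htU hst hsA
    have hmaps : MapsTo (fun θ : ℝ => (s - t) * θ + t) (Icc 0 1) (Icc 0 1) := fun θ hθ => by
      have := (convex_Icc (0 : ℝ) 1).add_smul_sub_mem ht hs hθ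
      rw [smul_eq_mul] at this
      rwa [add_comm, mul_comm] at this
    have hslow : IsSlowArc g D (fun θ => c ((s - t) * θ + t)) l := by
      intro θ hθ
      obtain ⟨v, hv, hvK, hd⟩ := hK _ (hmaps hθ)
      have h1 : HasDerivWithinAt (fun θ : ℝ => (s - t) * θ + t) (s - t) (Icc 0 1) θ := by
        simpa using (((hasDerivAt_id θ).const_mul (s - t)).add_const t).hasDerivWithinAt
      refine ⟨(s - t) • v, Submodule.smul_mem _ _ hv, ?_,
        HasVelocityWithinAt.comp_real (σ := fun θ => (s - t) * θ + t) hd h1 hmaps⟩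
      rw [g.modelNorm_smul]
      exact (mul_le_mul_of_nonneg_left hvK (abs_nonneg _)).trans hst
    obtain ⟨τ, hτ, hτe⟩ := hΦ.slowArc _ hslow (by simpa using htU) (by simpa using hsU)
    simp only [mul_zero, zero_add, mul_one, sub_add_cancel] at hτe
    have hcont : ContinuousAt (fun q => Φ τ q) (c t) := by
      have h1 : ContinuousOn (fun q => Φ τ q) U :=
        hΦ.continuousOn.comp (f := fun q => (τ, q)) (by fun_prop) fun q hq => ⟨hτ, hq⟩
      exact h1.continuousAt (hΦ.isOpen.mem_nhds htU)
    rw [mem_interior_iff_mem_nhds]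
    have h2 : ∀ᶠ q in 𝓝 (c t), Φ τ q ∈ interior A :=
      hcont.eventually_mem (by rw [hτe]; exact isOpen_interior.mem_nhds hsA)
    filter_upwards [h2, hΦ.isOpen.mem_nhds htU] with q hq hqU
    exact hA _ (interior_subset hq) _ (hΦ.joined q hqU τ hτ).symm
  have hcc : ContinuousWithinAt c (Icc 0 1) t₀ := hc.1.continuousOn t₀ ht₀
  have h1 : ∀ᶠ t in 𝓝[Icc 0 1] t₀, c t ∈ U := hcc.eventually_mem (hΦ.isOpen.mem_nhds hΦ.mem)
  have h2 : ∀ᶠ t in 𝓝[Icc 0 1] t₀, |t - t₀| * K < l := by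
    have : Continuous (fun t : ℝ => |t - t₀| * K) := by fun_prop
    refine nhdsWithin_le_nhds ((this.tendsto t₀).eventually_lt_const ?_)
    simpa using hl
  filter_upwards [h1, h2, self_mem_nhdsWithin] with t htU htK ht
  exact ⟨key t₀ ht₀ t ht hΦ.mem htU (by rw [abs_sub_comm]; exact htK.le),
    key t ht t₀ ht₀ htU hΦ.mem htK.le⟩

end Interior

/-! ### Center curves and transversality -/

section Transverse

variable {M : Type*} [TopologicalSpace M] [ChartedSpace E3 M] [IsManifold (𝓡 3) ∞ M]
  {g : SmoothMetric M} {E : Fin 3 → TangentField M} {b : M → Fin 3 → E3}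

/-- A set saturated by the flows along `E 0` and `E 2` that contains a curve tangent to `E 1` is a
neighbourhood of the points of that curve. -/
theorem mem_nhds_of_transverse_curve (hb : IsUnitFrame g E b) {l l' : ℝ} {γ : ℝ → M} {t₀ : ℝ}
    {v : E3} (hγ : HasVelocityWithinAt γ univ t₀ v) (hv : v ∈ modelFiber (E 1) (γ t₀))
    (hv0 : v ≠ 0) (hγc : ∀ᶠ t in 𝓝 t₀, ContinuousAt γ t)
    (h0 : ∀ ε > 0, ∃ U T Φ, IsLocalFlow g (E 0) (γ t₀) (dualFunctional (b (γ t₀)) 0)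
      (b (γ t₀) 0) ε l U T Φ)
    (h2 : ∀ ε > 0, ∃ U T Φ, IsLocalFlow g (E 2) (γ t₀) (dualFunctional (b (γ t₀)) 2)
      (b (γ t₀) 2) ε l' U T Φ) {A : Set M}
    (hA0 : ∀ x ∈ A, ∀ y, JoinedByArc (E 0) x y → y ∈ A)
    (hA2 : ∀ x ∈ A, ∀ y, JoinedByArc (E 2) x y → y ∈ A)
    (hγA : ∀ᶠ t in 𝓝 t₀, γ t ∈ A) : A ∈ 𝓝 (γ t₀) := by
  set p := γ t₀ with hp
  set φ := extChartAt (𝓡 3) p with hφ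
  set ℓ : Fin 3 → E3 →L[ℝ] ℝ := dualFunctional (b p) with hℓ
  set u := b p with hu
  have hLI := hb.linearIndependent p
  have hdual : ∀ i j, ℓ i (u j) = if i = j then 1 else 0 := dualFunctional_apply_self hLI
  obtain ⟨κ, hκ, -⟩ := hb.exists_smul hv
  have hκ0 : κ ≠ 0 := by
    rintro rfl
    exact hv0 (by rw [hκ, zero_smul])
  have hκpos : 0 < |κ| := abs_pos.2 hκ0
  set Λ : ℝ := 1 + ∑ i, ‖ℓ i‖ with hΛ
  have hΛ1 : 1 ≤ Λ := by
    have : 0 ≤ ∑ i, ‖ℓ i‖ := Finset.sum_nonneg fun i _ => norm_nonneg _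
    linarith
  have hΛi : ∀ i z, |ℓ i z| ≤ Λ * ‖z‖ := by
    intro i z
    refine ((ℓ i).le_opNorm z).trans ?_
    gcongr
    have : ‖ℓ i‖ ≤ ∑ i, ‖ℓ i‖ :=
      Finset.single_le_sum (f := fun i => ‖ℓ i‖) (fun _ _ => norm_nonneg _) (Finset.mem_univ i)
    linarith
  -- Small enough that the total coordinate error `4 * Λ * ε * r` is below both `r` and `r * |κ|`,
  -- the leading terms on the sides of the rectangle.
  set ε : ℝ := min 1 |κ| / (12 * Λ) with hε
  have hΛpos : 0 < Λ := by linarith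
  have hε0 : 0 < ε := by positivity
  have hΛε : 12 * (Λ * ε) = min 1 |κ| := by rw [hε]; field_simp
  have hΛε1 : 12 * (Λ * ε) ≤ 1 := hΛε.le.trans (min_le_left _ _)
  have hΛεκ : 12 * (Λ * ε) ≤ |κ| := hΛε.le.trans (min_le_right _ _)
  obtain ⟨U, T, Φ, hΦ⟩ := h0 ε hε0
  obtain ⟨U', T', Ψ, hΨ⟩ := h2 ε hε0
  have hy : HasDerivAt (fun t => φ (γ t)) (κ • u 1) t₀ := by
    have h1 : MDifferentiableAt (𝓡 3) 𝓘(ℝ, E3) φ (γ t₀) :=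
      mdifferentiableAt_extChartAt (mem_chart_source E3 p)
    have h3 := hγ.comp_fun h1
    rw [hasDerivWithinAt_univ] at h3
    have h4 : chartDeriv φ (γ t₀) v = κ • u 1 := by
      rw [hφ, ← hp, chartDeriv_extChartAt_self, hκ]
      rfl
    rw [h4] at h3
    exact h3
  have hyε : ∀ᶠ t in 𝓝 t₀, ‖φ (γ t) - φ p - (t - t₀) • κ • u 1‖ ≤ ε * ‖t - t₀‖ :=
    (hasDerivAt_iff_isLittleO.1 hy).def hε0
  have hγp : ContinuousAt γ t₀ := hγc.self_of_nhds
  have hγU : ∀ᶠ t in 𝓝 t₀, γ t ∈ U := hγp.eventually_mem (hΦ.isOpen.mem_nhds hΦ.mem)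
  obtain ⟨r₀, hr₀, hball⟩ := Metric.eventually_nhds_iff_ball.1
    (((hyε.and hγU).and hγA).and hγc)
  set r := min (r₀ / 2) (min T T') with hr
  have hTpos := hΦ.time_pos
  have hT'pos := hΨ.time_pos
  have hrpos : 0 < r := by positivity
  have hrT : r ≤ T := (min_le_right _ _).trans (min_le_left _ _)
  have hrT' : r ≤ T' := (min_le_right _ _).trans (min_le_right _ _)
  have hin : ∀ t ∈ Icc (t₀ - r) (t₀ + r), t ∈ Metric.ball t₀ r₀ := by
    intro t ht
    rw [Metric.mem_ball, Real.dist_eq, abs_lt]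
    have := min_le_left (r₀ / 2) (min T T')
    constructor <;> linarith [ht.1, ht.2]
  have hst : ∀ t ∈ Icc (t₀ - r) (t₀ + r), |t - t₀| ≤ r := fun t ht => by
    rw [abs_le]; constructor <;> linarith [ht.1, ht.2]
  have hqnear : ∀ᶠ q in 𝓝 p, q ∈ U' ∧ ‖φ q - φ p‖ < ε * r := by
    have hU'ev : ∀ᶠ q in 𝓝 p, q ∈ U' := hΨ.isOpen.mem_nhds hΨ.mem
    refine hU'ev.and ?_
    have h1 : ContinuousAt φ p := continuousAt_extChartAt p
    have h3 : ContinuousAt (fun q => ‖φ q - φ p‖) p := (h1.sub continuousAt_const).norm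
    exact h3.tendsto.eventually_lt_const (by simpa using mul_pos hε0 hrpos)
  filter_upwards [hqnear] with q hq
  obtain ⟨hqU, hqφ⟩ := hq
  set Q : ℝ → E3 := fun w => φ (Ψ w q) with hQ
  -- For `z = (t, w)`, this is the time for which the flow of `γ t` along `E 0` reaches the
  -- coordinate `ℓ 0` of the flow of `q` along `E 2` at time `w`. Two coordinate equations in `(t,
  -- w)` remain.
  set a : ℝ × ℝ → ℝ := fun z => ℓ 0 (Q z.2) - ℓ 0 (φ (γ z.1)) with ha
  set P : ℝ × ℝ → E3 := fun z => φ (Φ (a z) (γ z.1)) with hP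
  set S : Set (ℝ × ℝ) := Icc (t₀ - r) (t₀ + r) ×ˢ Icc (-r) r with hS
  have hwT' : ∀ w ∈ Icc (-r) r, w ∈ Icc (-T') T' := fun w hw =>
    ⟨by linarith [hw.1], hw.2.trans hrT'⟩
  have dQ : ∀ w ∈ Icc (-r) r, ‖Q w - φ p - w • u 2‖ ≤ 2 * (ε * r) := by
    intro w hw
    have h1 := hΨ.displacement q hqU w (hwT' w hw)
    have h3 : ε * |w| ≤ ε * r := by gcongr; exact abs_le.2 hw
    calc ‖Q w - φ p - w • u 2‖ = ‖(Q w - φ q - w • u 2) + (φ q - φ p)‖ := by congr 1; abel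
      _ ≤ ε * r + ε * r := norm_add_le_of_le (h1.trans h3) hqφ.le
      _ = _ := by ring
  have dy : ∀ t ∈ Icc (t₀ - r) (t₀ + r), ‖φ (γ t) - φ p - ((t - t₀) * κ) • u 1‖ ≤ ε * r := by
    intro t ht
    have h1 := (hball t (hin t ht)).1.1.1
    rw [smul_smul] at h1
    refine h1.trans ?_
    gcongr
    exact hst t ht
  have hεr : 0 < ε * r := mul_pos hε0 hrpos
  have dabs : ∀ z ∈ S, |a z| ≤ 3 * (Λ * (ε * r)) := by
    intro z hz
    have e1 : a z = ℓ 0 (Q z.2 - φ p - z.2 • u 2)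
        - ℓ 0 (φ (γ z.1) - φ p - ((z.1 - t₀) * κ) • u 1) := by
      simp [ha, hdual]
    rw [e1]
    have b1 := (hΛi 0 (Q z.2 - φ p - z.2 • u 2)).trans
      (mul_le_mul_of_nonneg_left (dQ z.2 hz.2) hΛpos.le)
    have b2 := (hΛi 0 (φ (γ z.1) - φ p - ((z.1 - t₀) * κ) • u 1)).trans
      (mul_le_mul_of_nonneg_left (dy z.1 hz.1) hΛpos.le)
    refine (abs_sub _ _).trans ?_
    linarith
  have hΛεr : Λ * (ε * r) * 12 ≤ r := by nlinarith
  have haT : ∀ z ∈ S, a z ∈ Icc (-T) T := by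
    intro z hz
    rw [mem_Icc, ← abs_le]
    linarith [dabs z hz]
  have hγUz : ∀ z ∈ S, γ z.1 ∈ U := fun z hz => (hball z.1 (hin z.1 hz.1)).1.1.2
  have dP : ∀ z ∈ S, ‖P z - φ (γ z.1) - a z • u 0‖ ≤ ε * r := by
    intro z hz
    refine (hΦ.displacement _ (hγUz z hz) _ (haT z hz)).trans ?_
    gcongr
    linarith [dabs z hz]
  have dPQ : ∀ z ∈ S, ∀ i, |ℓ i (P z - Q z.2)
      - ((z.1 - t₀) * κ * ℓ i (u 1) + a z * ℓ i (u 0) - z.2 * ℓ i (u 2))|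
        ≤ 4 * (Λ * (ε * r)) := by
    intro z hz i
    have e1 : ℓ i (P z - Q z.2)
        - ((z.1 - t₀) * κ * ℓ i (u 1) + a z * ℓ i (u 0) - z.2 * ℓ i (u 2))
        = ℓ i ((P z - φ (γ z.1) - a z • u 0) + (φ (γ z.1) - φ p - ((z.1 - t₀) * κ) • u 1)
          - (Q z.2 - φ p - z.2 • u 2)) := by
      simp only [map_sub, map_add, map_smul, smul_eq_mul]
      ring
    rw [e1]
    refine (hΛi i _).trans ?_
    have := norm_sub_le_of_le (norm_add_le_of_le (dP z hz) (dy z.1 hz.1)) (dQ z.2 hz.2)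
    calc Λ * _ ≤ Λ * (ε * r + ε * r + 2 * (ε * r)) := by gcongr
      _ = _ := by ring
  have hQc : ContinuousOn Q (Icc (-r) r) := by
    have c1 : ContinuousOn (fun w => Ψ w q) (Icc (-r) r) :=
      hΨ.continuousOn.comp (f := fun w => (w, q)) (by fun_prop) fun w hw => ⟨hwT' w hw, hqU⟩
    exact (continuousOn_extChartAt p).comp c1 fun w hw => hΨ.mem_source q hqU w (hwT' w hw)
  have hQc' : ContinuousOn (fun z : ℝ × ℝ => Q z.2) S :=
    hQc.comp continuousOn_snd fun z hz => hz.2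
  have hγc' : ContinuousOn (fun z : ℝ × ℝ => γ z.1) S := by
    have : ContinuousOn γ (Icc (t₀ - r) (t₀ + r)) := fun t ht =>
      (hball t (hin t ht)).2.continuousWithinAt
    exact this.comp continuousOn_fst fun z hz => hz.1
  have hyc : ContinuousOn (fun z : ℝ × ℝ => φ (γ z.1)) S :=
    (continuousOn_extChartAt p).comp hγc' fun z hz => hΦ.subset_source (hγUz z hz)
  have hac : ContinuousOn a S :=
    ((ℓ 0).continuous.comp_continuousOn hQc').sub ((ℓ 0).continuous.comp_continuousOn hyc)
  have hPc : ContinuousOn P S := by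
    have c1 : ContinuousOn (fun z => Φ (a z) (γ z.1)) S :=
      hΦ.continuousOn.comp (f := fun z => (a z, γ z.1)) (hac.prodMk hγc')
        fun z hz => ⟨haT z hz, hγUz z hz⟩
    exact (continuousOn_extChartAt p).comp c1 fun z hz => hΦ.mem_source _ (hγUz z hz) _ (haT z hz)
  have hκ2 : |κ| * |κ| = κ * κ := abs_mul_abs_self κ
  -- Multiplication by `κ`, and the minus sign in `hGb`, make both leading coefficients positive,
  -- giving the signs that Poincaré–Miranda requires on opposite sides.
  have hFb : ∀ z ∈ S, |κ * ℓ 1 (P z - Q z.2) - (z.1 - t₀) * (κ * κ)| < r * (κ * κ) := by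
    intro z hz
    have h1 := dPQ z hz 1
    rw [hdual, hdual, hdual, if_pos rfl, if_neg (by decide), if_neg (by decide)] at h1
    have e1 : κ * ℓ 1 (P z - Q z.2) - (z.1 - t₀) * (κ * κ)
        = κ * (ℓ 1 (P z - Q z.2) - (z.1 - t₀) * κ) := by ring
    rw [e1, abs_mul, ← hκ2]
    have h3 : |ℓ 1 (P z - Q z.2) - (z.1 - t₀) * κ| ≤ 4 * (Λ * (ε * r)) := by simpa using h1
    have h4 : 4 * (Λ * (ε * r)) < r * |κ| := by nlinarith [mul_pos hrpos hκpos]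
    calc |κ| * |ℓ 1 (P z - Q z.2) - (z.1 - t₀) * κ| < |κ| * (r * |κ|) := by
          gcongr; exact h3.trans_lt h4
      _ = r * (|κ| * |κ|) := by ring
  have hGb : ∀ z ∈ S, |-ℓ 2 (P z - Q z.2) - z.2| < r := by
    intro z hz
    have h1 := dPQ z hz 2
    rw [hdual, hdual, hdual, if_neg (by decide), if_neg (by decide), if_pos rfl] at h1
    have h3 : |-ℓ 2 (P z - Q z.2) - z.2| ≤ 4 * (Λ * (ε * r)) := by
      rw [← abs_neg]
      convert h1 using 2
      simp only [map_sub]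
      ring
    linarith
  have l1 : t₀ - r ∈ Icc (t₀ - r) (t₀ + r) := ⟨le_rfl, by linarith⟩
  have l2 : t₀ + r ∈ Icc (t₀ - r) (t₀ + r) := ⟨by linarith, le_rfl⟩
  have l3 : -r ∈ Icc (-r) r := ⟨le_rfl, by linarith⟩
  have l4 : r ∈ Icc (-r) r := ⟨by linarith, le_rfl⟩
  obtain ⟨z, hz, hF, hG⟩ := exists_zero_of_sign_changes
    (a := t₀ - r) (b := t₀ + r) (c := -r) (d := r)
    (F := fun z => κ * ℓ 1 (P z - Q z.2)) (G := fun z => -ℓ 2 (P z - Q z.2))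
    (by linarith) (by linarith)
    (continuousOn_const.mul ((ℓ 1).continuous.comp_continuousOn (hPc.sub hQc')))
    ((ℓ 2).continuous.comp_continuousOn (hPc.sub hQc')).neg
    (fun w hw => by
      have := (abs_lt.1 (hFb (t₀ - r, w) ⟨l1, hw⟩)).2
      simp only at this ⊢
      nlinarith)
    (fun w hw => by
      have := (abs_lt.1 (hFb (t₀ + r, w) ⟨l2, hw⟩)).1
      simp only at this ⊢
      nlinarith)
    (fun t ht => by
      have := (abs_lt.1 (hGb (t, -r) ⟨ht, l3⟩)).2
      simp only at this ⊢
      linarith)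
    (fun t ht => by
      have := (abs_lt.1 (hGb (t, r) ⟨ht, l4⟩)).1
      simp only at this ⊢
      linarith)
  have hz1 : ℓ 1 (P z - Q z.2) = 0 := (mul_eq_zero.1 hF).resolve_left hκ0
  have hz2 : ℓ 2 (P z - Q z.2) = 0 := neg_eq_zero.1 hG
  have hz0 : ℓ 0 (P z - Q z.2) = 0 := by
    have := hΦ.coord _ (hγUz z hz) _ (haT z hz)
    rw [map_sub]
    change ℓ 0 (P z) = _ at this
    rw [this, ha]
    ring
  have hPQ : P z = Q z.2 := by
    rw [← sub_eq_zero, ← sum_dualFunctional hLI (P z - Q z.2)]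
    simp only [Fin.sum_univ_three]
    change ℓ 0 _ • _ + ℓ 1 _ • _ + ℓ 2 _ • _ = _
    rw [hz0, hz1, hz2]
    simp
  have heq : Φ (a z) (γ z.1) = Ψ z.2 q :=
    φ.injOn (hΦ.mem_source _ (hγUz z hz) _ (haT z hz)) (hΨ.mem_source q hqU _ (hwT' _ hz.2)) hPQ
  -- The meeting point is reached from the curve along `E 0`, and `q` is reached from it by
  -- reversing its arc along `E 2`.
  have hmem : Φ (a z) (γ z.1) ∈ A :=
    hA0 _ (hball z.1 (hin z.1 hz.1)).1.2 _ (hΦ.joined _ (hγUz z hz) _ (haT z hz))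
  rw [heq] at hmem
  exact hA2 _ hmem _ (hΨ.joined q hqU _ (hwT' _ hz.2)).symm

/-- Local center curves exist through every point. -/
theorem exists_isLocalCenterCurve (hb : IsUnitFrame g E b)
    (hE : ∀ i, IsContinuousLineBundle (E i)) (i : Fin 3) (x : M) :
    ∃ W, IsLocalCenterCurve (E i) x W := by
  obtain ⟨X, L, R, hX, -⟩ := hb.exists_isChartField hE x i one_pos Filter.univ_mem
  set φ := extChartAt (𝓡 3) x with hφ
  set ℓ := dualFunctional (b x) i with hℓ
  obtain ⟨y, hy0, hy⟩ := exists_solution hX.uniformContinuous hX.norm_le (φ x)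
  have hL0 : 0 ≤ L := (norm_nonneg _).trans (hX.norm_le 0)
  have hR := hX.radius_pos
  set ε := R / (L + 1) with hε
  have hεpos : 0 < ε := by positivity
  have hin : ∀ t ∈ Ioo (-ε) ε, y t ∈ Metric.closedBall (φ x) R := by
    intro t ht
    rw [mem_closedBall_iff_norm, ← hy0]
    refine (norm_sub_le_of_hasDerivAt_bounded hX.norm_le hy 0 t).trans ?_
    rw [sub_zero]
    calc L * |t| ≤ (L + 1) * ε := by
          gcongr
          · linarith
          · exact (abs_lt.2 ht).le
      _ = R := by rw [hε]; field_simp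
  have hcoord : ∀ t ∈ Ioo (-ε) ε, ℓ (y t) = ℓ (y 0) + t := fun t ht =>
    (hX.coord_solution hy (convex_Ioo (-ε) ε) ⟨by linarith, hεpos⟩ hin ht).1
  have hsm : ContMDiffOn 𝓘(ℝ, ℝ) (𝓡 3) 1 (fun t => φ.symm (y t)) (Ioo (-ε) ε) := by
    have := hX.contMDiffOn hy (τ := 1) (s := Ioo (-ε) ε) 
      (fun θ hθ => by rw [mul_one]; exact hin θ hθ)
    simp only [mul_one] at this
    exact this
  refine ⟨_, ε, fun t => φ.symm (y t), hεpos, ?_, rfl, hsm, ?_, fun t ht => ?_⟩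
  · change φ.symm (y 0) = x
    rw [hy0]
    exact φ.left_inv (mem_extChartAt_source x)
  · have hsrc : ∀ t : Ioo (-ε) ε, φ.symm (y t) ∈ φ.source := fun t =>
      φ.map_target (hX.ball_subset (hin t t.2))
    set F : Ioo (-ε) ε → φ.source := fun t => ⟨φ.symm (y t), hsrc t⟩ with hF
    have hFc : Continuous F :=
      (continuousOn_iff_continuous_domRestrict.1 hsm.continuousOn).subtype_mk _
    set G : φ.source → ℝ := fun q => ℓ (φ q) - ℓ (y 0) with hG
    have hGc : Continuous G := by
      have h1 : Continuous (fun q : φ.source => φ q) :=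
        continuousOn_iff_continuous_domRestrict.1 (continuousOn_extChartAt x)
      exact (ℓ.continuous.comp h1).sub continuous_const
    -- The coordinate `ℓ` recovers the time, so the curve has a continuous left inverse on the chart
    -- domain and is an embedding.
    have hGF : G ∘ F = Subtype.val := by
      funext t
      simp only [Function.comp, hG, hF]
      rw [φ.right_inv (hX.ball_subset (hin t t.2)), hcoord t t.2]
      ring
    have hFe : IsEmbedding F :=
      IsEmbedding.of_comp hFc hGc (by rw [hGF]; exact IsEmbedding.subtypeVal)
    exact IsEmbedding.subtypeVal.comp hFe
  · obtain ⟨v, hv, -, hvX⟩ := hX.tangent _ (hin t ht)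
    have h1 : HasVelocityWithinAt (φ.symm ∘ y) univ t v :=
      hasVelocityWithinAt_chart_symm_comp (hy t).hasDerivWithinAt (hX.ball_subset (hin t ht)) hvX
    have h2 : mfderiv 𝓘(ℝ, ℝ) (𝓡 3) (fun t => φ.symm (y t)) t
        = (ContinuousLinearMap.toSpanSingleton ℝ v : ℝ →L[ℝ] E3) :=
      (hasMFDerivWithinAt_univ.1 h1).mfderiv
    have h3 : (mfderiv 𝓘(ℝ, ℝ) (𝓡 3) (fun t => φ.symm (y t)) t (1 : ℝ) : E3) = v := by
      rw [h2]
      exact ContinuousLinearMap.toSpanSingleton_apply_one ℝ v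
    have hv0 : v ≠ 0 := by
      rintro rfl
      have := hX.coord_eq_one _ (hin t ht)
      rw [← hvX] at this
      simp at this
    constructor
    · intro h
      exact hv0 (h3.symm.trans h)
    · have h4 : (mfderiv 𝓘(ℝ, ℝ) (𝓡 3) (fun t => φ.symm (y t)) t (1 : ℝ) : E3)
          ∈ modelFiber (E i) (φ.symm (y t)) := by rw [h3]; exact hv
      exact h4

end Transverse

/-! ### Both hyperbolic directions as dominated contractions -/

section PartiallyHyperbolic

variable {M : Type*} [TopologicalSpace M] [ChartedSpace E3 M] [IsManifold (𝓡 3) ∞ M]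
  {g : SmoothMetric M} {E : Fin 3 → TangentField M} {b : M → Fin 3 → E3}
  {f : M ≃ₘ^1⟮𝓡 3, 𝓡 3⟯ M} {Es Ec Eu : TangentField M}

theorem chartMapDeriv_symm_apply (f : M ≃ₘ^1⟮𝓡 3, 𝓡 3⟯ M) (x : M) (v : E3) :
    chartMapDeriv f.symm (f x) (chartMapDeriv f x v) = v := by
  have h1 : mfderiv (𝓡 3) (𝓡 3) (f.symm ∘ f) x
      = (mfderiv (𝓡 3) (𝓡 3) f.symm (f x)).comp (mfderiv (𝓡 3) (𝓡 3) f x) :=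
    mfderiv_comp x (f.symm.contMDiff.mdifferentiable one_ne_zero (f x))
      (f.contMDiff.mdifferentiable one_ne_zero x)
  have h2 : (f.symm ∘ f : M → M) = id := funext f.symm_apply_apply
  rw [h2, mfderiv_id] at h1
  exact (DFunLike.congr_fun h1 v).symm

theorem stretch_symm_mul_stretch (hb : IsUnitFrame g E b)
    (hmap : ∀ x i, ∀ v ∈ modelFiber (E i) x, chartMapDeriv f x v ∈ modelFiber (E i) (f x))
    (x : M) (i : Fin 3) : stretch g b f.symm i (f x) * stretch g b f i x = 1 := by
  obtain ⟨a, ha, hn⟩ := hb.exists_smul (hmap x i _ (hb.mem x i))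
  have h1 := chartMapDeriv_symm_apply f x (b x i)
  rw [ha, map_smul] at h1
  have h2 := congrArg (g.modelNorm x) h1
  rw [g.modelNorm_smul, hb.norm_eq] at h2
  rw [stretch, stretch, hn, f.symm_apply_apply, mul_comm]
  exact h2

theorem chartMapDeriv_symm_mem
    (hmap : ∀ x i, (E i x).map (mfderiv (𝓡 3) (𝓡 3) f x).toLinearMap = E i (f x)) (y : M)
    (i : Fin 3) {v : E3} (hv : v ∈ modelFiber (E i) y) :
    chartMapDeriv f.symm y v ∈ modelFiber (E i) (f.symm y) := by
  obtain ⟨x, rfl⟩ : ∃ x, f x = y := f.surjective y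
  have hv' : v ∈ (E i x).map (mfderiv (𝓡 3) (𝓡 3) f x).toLinearMap := by
    rw [hmap]; exact hv
  obtain ⟨w, hw, rfl⟩ := hv'
  have h1 : chartMapDeriv f.symm (f x) (chartMapDeriv f x w) = w := chartMapDeriv_symm_apply f x w
  have h2 : w ∈ modelFiber (E i) (f.symm (f x)) := by
    rw [f.symm_apply_apply]; exact hw
  rw [← h1] at h2
  exact h2

/-- The invariant splitting as a family of tangent fields. -/
def splittingFamily (Es Ec Eu : TangentField M) : Fin 3 → TangentField M := ![Es, Ec, Eu]

theorem IsPartiallyHyperbolic.isContinuousLineBundle (hf : IsPartiallyHyperbolic f Es Ec Eu)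
    (i : Fin 3) : IsContinuousLineBundle (splittingFamily Es Ec Eu i) := by
  fin_cases i
  exacts [hf.lineBundle_s, hf.lineBundle_c, hf.lineBundle_u]

theorem IsPartiallyHyperbolic.isInternal (hf : IsPartiallyHyperbolic f Es Ec Eu) (x : M) :
    DirectSum.IsInternal (fun i => splittingFamily Es Ec Eu i x) := by
  have h : (fun i => splittingFamily Es Ec Eu i x) = ![Es x, Ec x, Eu x] := by
    funext i
    fin_cases i <;> rfl
  rw [h]
  exact hf.splitting x

theorem IsPartiallyHyperbolic.map_eq (hf : IsPartiallyHyperbolic f Es Ec Eu) (x : M) (i : Fin 3) :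
    (splittingFamily Es Ec Eu i x).map (mfderiv (𝓡 3) (𝓡 3) f x).toLinearMap
      = splittingFamily Es Ec Eu i (f x) := by
  fin_cases i
  exacts [hf.invariant_s x, hf.invariant_c x, hf.invariant_u x]

/-- Passing to the inverse inverts the stretches along each line, so the strongest expansion becomes
the strongest contraction. Everything proved for contracted line fields then applies to `Eu` as
well. -/
theorem IsPartiallyHyperbolic.exists_contractsDominated (hf : IsPartiallyHyperbolic f Es Ec Eu) :
    ∃ g b, IsUnitFrame g (splittingFamily Es Ec Eu) b ∧
      ContractsDominated g (splittingFamily Es Ec Eu) b f 0 ∧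
      ContractsDominated g (splittingFamily Es Ec Eu) b f.symm 2 := by
  obtain ⟨g, hg⟩ := hf.hyperbolicity
  obtain ⟨b, hb⟩ := exists_isUnitFrame g hf.isContinuousLineBundle hf.isInternal
  have hrate : ∀ x, stretch g b f 0 x < 1 ∧ 1 < stretch g b f 2 x ∧
      stretch g b f 0 x < stretch g b f 1 x ∧ stretch g b f 1 x < stretch g b f 2 x := fun x =>
    hg x (b x 0) (hb.mem x 0) (b x 1) (hb.mem x 1) (b x 2) (hb.mem x 2)
      (hb.norm_eq x 0) (hb.norm_eq x 1) (hb.norm_eq x 2)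
  have hmap : ∀ x i, ∀ v ∈ modelFiber (splittingFamily Es Ec Eu i) x,
      chartMapDeriv f x v ∈ modelFiber (splittingFamily Es Ec Eu i) (f x) := by
    intro x i v hv
    have h := Submodule.mem_map_of_mem (f := (mfderiv (𝓡 3) (𝓡 3) f x).toLinearMap)
      (p := splittingFamily Es Ec Eu i x) hv
    rw [hf.map_eq x i] at h
    exact h
  have hinv : ∀ x i, stretch g b f.symm i (f x) = (stretch g b f i x)⁻¹ := fun x i =>
    eq_inv_of_mul_eq_one_left (stretch_symm_mul_stretch hb hmap x i)
  have hpos : ∀ x i, 0 < stretch g b f i x := fun x i =>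
    (stretch_nonneg i x).lt_of_ne'
      (right_ne_zero_of_mul_eq_one (stretch_symm_mul_stretch hb hmap x i))
  refine ⟨g, b, hb, ⟨f.contMDiff, hmap, fun x => (hrate x).1, fun x j hj => ?_⟩,
    ⟨f.symm.contMDiff, fun y i v => chartMapDeriv_symm_mem hf.map_eq y i, fun y => ?_,
      fun y j hj => ?_⟩⟩
  · obtain ⟨-, -, h1, h2⟩ := hrate x
    fin_cases j
    exacts [absurd rfl hj, h1, h1.trans h2]
  · obtain ⟨x, rfl⟩ : ∃ x, f x = y := f.surjective y
    rw [hinv]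
    exact inv_lt_one_of_one_lt₀ (hrate x).2.1
  · obtain ⟨x, rfl⟩ : ∃ x, f x = y := f.surjective y
    rw [hinv, hinv]
    refine inv_strictAnti₀ (hpos x j) ?_
    obtain ⟨-, -, h1, h2⟩ := hrate x
    fin_cases j
    exacts [h1.trans h2, h2, absurd rfl hj]

/-- A local center curve meeting a set in a relatively open set stays in it near some parameter. -/
theorem HasInteriorIn.exists_eventually_mem {γ : ℝ → M} {ε : ℝ} {A : Set M}
    (hγ : ContinuousOn γ (Ioo (-ε) ε)) (h : HasInteriorIn A (γ '' Ioo (-ε) ε)) :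
    ∃ t₀ ∈ Ioo (-ε) ε, ∀ᶠ t in 𝓝 t₀, γ t ∈ A := by
  obtain ⟨⟨_, t₀, ht₀, rfl⟩, hw⟩ := h
  obtain ⟨V, hV, hVA⟩ := mem_nhds_subtype _ _ _ |>.1 (mem_interior_iff_mem_nhds.1 hw)
  refine ⟨t₀, ht₀, ?_⟩
  filter_upwards [(hγ.continuousAt (isOpen_Ioo.mem_nhds ht₀)).eventually_mem hV,
    isOpen_Ioo.mem_nhds ht₀] with t htV ht
  exact hVA (show (⟨γ t, t, ht, rfl⟩ : γ '' Ioo (-ε) ε) ∈ _ from htV)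

theorem IsOpen.hasInteriorIn {A W : Set M} (hA : IsOpen A) {x : M} (hxA : x ∈ A) (hxW : x ∈ W) :
    HasInteriorIn A W :=
  ⟨⟨x, hxW⟩, by rw [(hA.preimage continuous_subtype_val).interior_eq]; exact hxA⟩

theorem IsLocalCenterCurve.mem {x : M} {W : Set M} (hW : IsLocalCenterCurve Ec x W) : x ∈ W := by
  obtain ⟨ε, γ, hε, rfl, rfl, -⟩ := hW
  exact ⟨0, ⟨by linarith, hε⟩, rfl⟩

end PartiallyHyperbolic

/-! ### The equivalence -/

theorem mainTheorem5 {M : Type*} [TopologicalSpace M] [ChartedSpace E3 M]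
    [IsManifold (𝓡 3) ∞ M] [CompactSpace M] [T2Space M]
    (f : M ≃ₘ^1⟮𝓡 3, 𝓡 3⟯ M) (Es Ec Eu : TangentField M)
    (hf : IsPartiallyHyperbolic f Es Ec Eu) (x : M) :
    List.TFAE [
      IsOpen (accessibilityClass Es Eu x),
      (interior (accessibilityClass Es Eu x)).Nonempty,
      ∀ W : Set M, IsLocalCenterCurve Ec x W →
        HasInteriorIn (accessibilityClass Es Eu x) W,
      ∃ W : Set M, IsLocalCenterCurve Ec x W ∧
        HasInteriorIn (accessibilityClass Es Eu x) W] := by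
  obtain ⟨g, b, hb, hs, hu⟩ := hf.exists_contractsDominated
  obtain ⟨l, hl, hflow⟩ := exists_isLocalFlow hb hf.isContinuousLineBundle hs
  obtain ⟨l', hl', hflow'⟩ := exists_isLocalFlow hb hf.isContinuousLineBundle hu
  set A := accessibilityClass Es Eu x with hA
  have hAs : ∀ y ∈ A, ∀ z, JoinedByArc Es y z → z ∈ A := fun y hy z h =>
    accessibilityClass_step hy (Or.inl h)
  have hAu : ∀ y ∈ A, ∀ z, JoinedByArc Eu y z → z ∈ A := fun y hy z h =>
    accessibilityClass_step hy (Or.inr h)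
  tfae_have 1 → 2 := fun h => ⟨x, by rw [h.interior_eq]; exact mem_accessibilityClass_self x⟩
  tfae_have 1 → 3 := fun h W hW => h.hasInteriorIn (mem_accessibilityClass_self x) hW.mem
  tfae_have 3 → 4 := fun h => by
    obtain ⟨W, hW⟩ := exists_isLocalCenterCurve hb hf.isContinuousLineBundle 1 x
    exact ⟨W, hW, h W hW⟩
  -- The interior point found is some `γ t₀`, possibly different from `x`; the implication from 2 to
  -- 1 carries interiority to the whole class.
  tfae_have 4 → 2 := by
    rintro ⟨W, ⟨ε, γ, hε, -, rfl, hγ, -, hγt⟩, hW⟩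
    obtain ⟨t₀, ht₀, hev⟩ := hW.exists_eventually_mem hγ.continuousOn
    have hd : HasMFDerivAt 𝓘(ℝ, ℝ) (𝓡 3) γ t₀ (mfderiv 𝓘(ℝ, ℝ) (𝓡 3) γ t₀) :=
      (((hγ.contMDiffAt (isOpen_Ioo.mem_nhds ht₀))).mdifferentiableAt one_ne_zero).hasMFDerivAt
    have hcont : ∀ᶠ t in 𝓝 t₀, ContinuousAt γ t := by
      filter_upwards [isOpen_Ioo.mem_nhds ht₀] with t ht
      exact hγ.continuousOn.continuousAt (isOpen_Ioo.mem_nhds ht)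
    exact ⟨γ t₀, mem_interior_iff_mem_nhds.2 (mem_nhds_of_transverse_curve hb
      (hasVelocityWithinAt_of_hasMFDerivWithinAt hd.hasMFDerivWithinAt) (hγt t₀ ht₀).2
      (hγt t₀ ht₀).1 hcont (hflow (γ t₀)) (hflow' (γ t₀)) hAs hAu hev)⟩
  -- Interiority travels along a chain from `y` back to `x`, by symmetry, and from `x` to every
  -- point of the class. The precision of the flows is irrelevant here, so it is set to `1`.
  tfae_have 2 → 1 := by
    rintro ⟨y, hy⟩
    have hstep : ∀ p q, SuStep Es Eu p q → p ∈ interior A → q ∈ interior A := by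
      rintro p q (h | h) hp
      · exact mem_interior_of_joinedByArc hl (fun p => hflow p 1 one_pos) hAs h hp
      · exact mem_interior_of_joinedByArc hl' (fun p => hflow' p 1 one_pos) hAu h hp
    have hpath : ∀ p q, Relation.ReflTransGen (SuStep Es Eu) p q → p ∈ interior A →
        q ∈ interior A := fun p q h hp => by
      induction h with
      | refl => exact hp
      | tail _ h ih => exact hstep _ _ h ih
    have hsymm : Std.Symm (SuStep Es Eu) := ⟨fun _ _ => SuStep.symm⟩
    have hx : x ∈ interior A := hpath y x
      (Std.Symm.symm _ _
        (mem_accessibilityClass_iff.1 (interior_subset hy))) hy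
    exact isOpen_iff_mem_nhds.2 fun z hz =>
      mem_interior_iff_mem_nhds.1 (hpath x z (mem_accessibilityClass_iff.1 hz) hx)
  tfae_finish
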